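/- **Manifolds.** A *manifold* below is a compact Hausdorff orientable smooth Riemannian manifold $(M,g)$ without boundary, of constant finite dimension, not necessarily connected. Consider the nine categories $\mathcal M$ whose objects are all manifolds and whose arrows are, respectively: (1) smooth maps; (2) smooth embeddings; (3) smooth submersions; (4) Riemannian (isometric) embeddings; (5) Riemannian submersions; (6) totally geodesic Riemannian embeddings; (7) totally geodesic Riemannian submersions; (8) totally geodesic Riemannian embeddings that are open (embeddings of unions of connected components); (9) totally geodesic Riemannian coverings. A smooth map $f$ is *totally geodesic* if $Df$ commutes with the Levi-Civita covariant differentiation of vector fields along curves. The categories (4)-(9) are called *Riemannian*, and (6)-(9) *geodesic*. **Bundles and propagators.** The category $\mathcal E^1$ has as objects the smooth Hermitian vector bundles over manifolds, and as arrows the pairs $(f,F)$ of a smooth map $f$ of the bases and a smooth fibrewise complex linear map $F$ over $f$. The category $\mathcal E^3$ of *propagators* has the same objects; an arrow from $E^1\to X^1$ to $E^2\to X^2$ is an isomorphism class of spans $X^1\xleftarrow{\rho_1}R\xrightarrow{\rho_2}X^2$ of smooth continuous maps on a compact Hausdorff diffeological space $R$ (with continuous plots), together with a family of complex subspaces $E_r\subset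 E^1_{\rho_1(r)}\oplus E^2_{\rho_2(r)}$, $r\in R$, each of which is the graph of an isometry between a subspace of $E^1_{\rho_1(r)}$ and a subspace of $E^2_{\rho_2(r)}$, such that for a pair $(a,b)$ of sections along a plot with values in the $E_r$, $a$ is smooth if and only if $b$ is. Propagators are composed by the fibre product of spans and the composition of relations; the identity of $E\to X$ is the span $X=X=X$ with the diagonals of $E_x\oplus E_x$. The category $\mathcal E^4$ of *amplified propagators* has as objects pairs $(E,W)$ of Hermitian bundles over the same manifold (with their tensor product), and as arrows $(E^1,W^1)\to(E^2,W^2)$ the propagators from $E^1\otimes W^1$ to $E^2\otimes W^2$. The functor $\mathcal E^3\to\mathcal E^4$ takes $W$ to be the trivial Hermitian line bundle. **Theorem.** Every manifold has a Levi-Civita connection, and the following holds. 1. *Objects.* For each manifold $M$ the complexified exterior algebras $\Lambda^{\mathbb C}(T_xM)$, with the Hermitian form $\langle v_1\wedge\dots\wedge v_k,w_1\wedge\dots\wedge w_k\rangle=\det(g(v_i,w_j))$ (different degrees being orthogonal), are the fibres of a smooth Hermitian bundle $\Lambda^{\mathbb C}(M)$, in which the unit section is smooth and exterior products of smooth vector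 fields with smooth sections are smooth. Let $\mathbb{C}l(T_xM)$ be the complexified Clifford algebra, with $v^2=-g(v,v)$, identified with $\Lambda^{\mathbb C}(T_xM)$ by the symbol map (which sends products of pairwise orthogonal vectors to their exterior products). Left and right multiplication by $\mathbb{C}l(T_xM)$ and the extension of the Levi-Civita connection to $\Lambda^{\mathbb C}(M)$ as a derivation make $\Lambda^{\mathbb C}(M)$ a bundle of Clifford bimodules with compatible connection: the two actions are smooth and commute, tangent vectors act by skew-adjoint operators, and the connection is smooth, complex linear, metric, and satisfies the Leibniz rule with respect to both Clifford actions. The $\mathbb{C}l(T_xM)$ likewise form a smooth Hermitian bundle $\mathbb{C}l(M)$, with the Hermitian form for which the symbol map is unitary. 2. *Functors to bundle morphisms.* For a smooth map $f\colon M\to N$ let $\Lambda^{\mathbb C}(Df)\colon\Lambda^{\mathbb C}(M)\to\Lambda^{\mathbb C}(N)$ be the fibrewise homomorphism of complexified exterior algebras extending $Df$. For each of the nine categories $\mathcal M$, the assignment $M\mapsto\Lambda^{\mathbb C}(M)$, $f\mapsto(f,\Lambda^{\mathbb C}(Df))$ is a covariant functor $\mathcal M\to\mathcal E^1$. If $f$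 is a Riemannian embedding, $\Lambda^{\mathbb C}(Df)$ is fibrewise isometric; if $f$ is a Riemannian submersion, $\Lambda^{\mathbb C}(Df)$ is fibrewise co-isometric (surjective, and isometric on the orthogonal complement of its kernel). 3. *Functors to propagators.* For each of the six Riemannian categories $\mathcal M$, the assignment $M\mapsto\Lambda^{\mathbb C}(M)$, $f\mapsto$ the span $M\xleftarrow{\mathrm{id}}M\xrightarrow{f}N$ with the graph over each $x\in M$ of the restriction of $\Lambda^{\mathbb C}(D_xf)$ to the orthogonal complement of its kernel, is a covariant functor $\mathcal M\to\mathcal E^3$, and hence gives a covariant functor $\mathcal M\to\mathcal E^4$. In the same way $M\mapsto\mathbb{C}l(M)$, $f\mapsto$ the same span with, over $x$, the subalgebra of $\mathbb{C}l(T_xM)\times\mathbb{C}l(T_{f(x)}N)$ generated by the pairs $(v,D_xf(v))$ with $v\perp\ker D_xf$, is a covariant functor to $\mathcal E^3$ and hence gives one to $\mathcal E^4$. For each arrow $f$ of a Riemannian category, both relations are locally trivial smooth subbundles of the corresponding Whitney sums over $M$. 4. *Clifford action and connection.* For each arrow $f$ of a Riemannian category, the Grassmann propagator of $f$ is stable under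 the left and the right action of the Clifford propagator of $f$. For each arrow $f$ of a geodesic category, the pull-back of the direct sum of the connections of $\Lambda^{\mathbb C}(M)$ and $\Lambda^{\mathbb C}(N)$ to the Whitney sum $\Lambda^{\mathbb C}(M)\oplus f^*\Lambda^{\mathbb C}(N)$ preserves the Grassmann propagator of $f$ and its orthogonal complement, so that it decomposes as a direct sum and induces a covariant derivative on the propagator bundle. -/

import Mathlib

open CategoryTheory Bundle Manifold Diffeology TensorProduct
open scoped ContDiff Topology Bundle

/-! ## Riemannian manifolds and smooth maps -/

/-- Euclidean `k`-space. -/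
abbrev Euc (k : ℕ) : Type := EuclideanSpace ℝ (Fin k)

/-- A smooth manifold is orientable if it is covered by compatible smooth charts whose transition
maps have positive Jacobian determinant. -/
def IsOrientable (n : ℕ) (M : Type) [TopologicalSpace M] [ChartedSpace (Euc n) M] : Prop :=
  ∃ A ⊆ IsManifold.maximalAtlas (𝓡 n) ∞ M, (∀ x : M, ∃ e ∈ A, x ∈ e.source) ∧
    ∀ e ∈ A, ∀ e' ∈ A, ∀ y ∈ (e.symm.trans e').source,
      0 < (fderiv ℝ (e.symm.trans e' : Euc n → Euc n) y).det

/-- A compact Hausdorff orientable smooth Riemannian manifold without boundary, of finite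
dimension, not necessarily connected. -/
structure RMfd : Type 1 where
  carrier : Type
  dim : ℕ
  [top : TopologicalSpace carrier]
  [t2 : T2Space carrier]
  [compact : CompactSpace carrier]
  [charted : ChartedSpace (Euc dim) carrier]
  [manifold : IsManifold (𝓡 dim) ∞ carrier]
  metric : ContMDiffRiemannianMetric (𝓡 dim) ∞ (Euc dim)
    (fun x : carrier => TangentSpace (𝓡 dim) x)
  orientable : IsOrientable dim carrier

attribute [instance] RMfd.top RMfd.t2 RMfd.compact RMfd.charted RMfd.manifold

instance : CoeSort RMfd Type := ⟨RMfd.carrier⟩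

namespace RMfd

/-- The model with corners (without boundary) of `M`. -/
noncomputable abbrev I (M : RMfd) : ModelWithCorners ℝ (Euc M.dim) (Euc M.dim) := 𝓡 M.dim

/-- The tangent space of `M` at `x`. -/
abbrev T (M : RMfd) (x : M) : Type := TangentSpace M.I x

/-- The Riemannian metric of `M` at `x`. -/
noncomputable abbrev g (M : RMfd) (x : M) : M.T x →L[ℝ] M.T x →L[ℝ] ℝ := M.metric.inner x

/-- Smooth vector fields. -/
def IsSmoothVF (M : RMfd) (X : ∀ x : M, M.T x) : Prop :=
  ContMDiff M.I M.I.tangent ∞ (fun x => (⟨x, X x⟩ : TangentBundle M.I M))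

end RMfd

/-- Smooth maps between Riemannian manifolds. -/
structure SmoothMap (M N : RMfd) : Type where
  toFun : M → N
  smooth : ContMDiff M.I N.I ∞ toFun

instance (M N : RMfd) : CoeFun (SmoothMap M N) (fun _ => M → N) := ⟨SmoothMap.toFun⟩

/-- The category of compact orientable Riemannian manifolds and smooth maps. -/
instance : Category RMfd where
  Hom := SmoothMap
  id M := ⟨id, contMDiff_id⟩
  comp f h := ⟨h.toFun ∘ f.toFun, h.smooth.comp f.smooth⟩

instance (M N : RMfd) : CoeFun (M ⟶ N) (fun _ => M → N) := ⟨SmoothMap.toFun⟩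

/-- The differential of a smooth map. -/
noncomputable def differential {M N : RMfd} (f : M ⟶ N) (x : M) : M.T x →L[ℝ] N.T (f x) :=
  mfderiv M.I N.I f x

/-- `v` is orthogonal to the kernel of the differential of `f` at `x`. -/
def IsHorizontal {M N : RMfd} (f : M ⟶ N) (x : M) (v : M.T x) : Prop :=
  ∀ w : M.T x, differential f x w = 0 → M.g x v w = 0

/-! ## Connections -/

section CovAlong

variable {P : Type} [NormedAddCommGroup P] [NormedSpace ℝ P]
  {n : ℕ} {M : Type} [TopologicalSpace M] [ChartedSpace (Euc n) M]
  {F : Type} [NormedAddCommGroup F] [NormedSpace ℝ F]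
  {V : M → Type} [∀ x, AddCommGroup (V x)] [∀ x, Module ℝ (V x)] [∀ x, TopologicalSpace (V x)]
  [TopologicalSpace (TotalSpace F V)] [FiberBundle F V]

/-- The pull-back connection: the covariant derivative at `t` in direction `u` of a section `a`
along the map `t ↦ (a t).proj`. In the trivialization `e` around `(a t).proj` it is
`d a + A(dp u) a`: the derivative of the components of `a`, plus the covariant derivative in
direction `dp u` of the section with constant components which agrees with `a` at `t`. -/
noncomputable def covAlong
    (D : (Π x : M, V x) → (Π x : M, TangentSpace (𝓡 n) x →L[ℝ] V x))
    (a : P → TotalSpace F V) (t u : P) : V (a t).proj :=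
  letI e := trivializationAt F V (a t).proj
  e.symm (a t).proj (fderiv ℝ (fun s => (e (a s)).2) t u) +
    D (fun y => e.symm y (e (a t)).2) (a t).proj
      (mfderiv 𝓘(ℝ, P) (𝓡 n) (fun s => (a s).proj) t u)

end CovAlong

/-- `D` is a Levi-Civita connection of `M`: it is torsion-free and compatible with the metric. -/
def IsLeviCivita (M : RMfd) (D : CovariantDerivative M.I (Euc M.dim) (TangentSpace M.I : M → Type)) :
    Prop :=
  D.torsion = 0 ∧
  ∀ (X Y : Π x : M, M.T x) (x : M),
    MDifferentiableAt M.I M.I.tangent (fun y => (⟨y, X y⟩ : TangentBundle M.I M)) x →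
    MDifferentiableAt M.I M.I.tangent (fun y => (⟨y, Y y⟩ : TangentBundle M.I M)) x →
    ∀ u : M.T x, mvfderiv M.I (fun y => M.g y (X y) (Y y)) x u =
      M.g x (D X x u) (Y x) + M.g x (X x) (D Y x u)

open Classical in
/-- The Levi-Civita connection of `M` (with the junk value `0` if there were none). The argument
order is that of `CovariantDerivative`: `leviCivita M X x u` is the derivative of `X` at `x` in
direction `u`. -/
noncomputable def leviCivita (M : RMfd) : (Π x : M, M.T x) → (Π x : M, M.T x →L[ℝ] M.T x) :=
  if h : ∃ D, IsLeviCivita M D then (Classical.choose h).toFun else 0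

/-- `f` is totally geodesic: its differential commutes with the covariant differentiation of vector
fields along curves. -/
def IsTotallyGeodesic {M N : RMfd} (f : M ⟶ N) : Prop :=
  ∀ σ : ℝ → TangentBundle M.I M, ContMDiff 𝓘(ℝ, ℝ) M.I.tangent ∞ σ → ∀ t : ℝ,
    mfderiv M.I N.I f (σ t).proj (covAlong (leviCivita M) σ t 1) =
      covAlong (leviCivita N) (fun s => tangentMap M.I N.I f (σ s)) t 1

/-! ## Classes of maps -/

/-- Smooth embeddings: topological embeddings which are immersions. -/
def IsEmb : MorphismProperty RMfd := fun _ _ f =>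
  Topology.IsEmbedding f.toFun ∧ ∀ x, Function.Injective (differential f x)

/-- Submersions. -/
def IsSub : MorphismProperty RMfd := fun _ _ f => ∀ x, Function.Surjective (differential f x)

/-- Riemannian embeddings. -/
def IsRiemEmb : MorphismProperty RMfd := fun M N f =>
  IsEmb f ∧ ∀ x (v w : M.T x), N.g (f x) (differential f x v) (differential f x w) = M.g x v w

/-- Riemannian submersions: the differential is isometric on the horizontal space, that is, it is
a co-isometry. (Since `w` and its horizontal part have the same image, and `v` is orthogonal to the
vertical part of `w`, it makes no difference whether `w` is assumed to be horizontal too.) -/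
def IsRiemSub : MorphismProperty RMfd := fun M N f =>
  IsSub f ∧ ∀ x (v w : M.T x), IsHorizontal f x v →
    N.g (f x) (differential f x v) (differential f x w) = M.g x v w

/-- Totally geodesic maps. -/
def IsTotGeo : MorphismProperty RMfd := fun _ _ f => IsTotallyGeodesic f

/-- Maps which are homeomorphisms onto an open subset. Since the manifolds are compact, the image
of such a map is a union of connected components. -/
def IsOpenEmb : MorphismProperty RMfd := fun _ _ f => Topology.IsOpenEmbedding f.toFun

/-- Covering maps. -/
def IsCov : MorphismProperty RMfd := fun _ _ f => IsCoveringMap f.toFun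

section Multiplicative

variable {M N P : RMfd}

lemma differential_id (x : M) (v : M.T x) : differential (𝟙 M) x v = v := by
  change mfderiv M.I M.I id x v = v
  rw [mfderiv_id]; rfl

lemma differential_comp (f : M ⟶ N) (h : N ⟶ P) (x : M) (v : M.T x) :
    differential (f ≫ h) x v = differential h (f x) (differential f x v) := by
  change mfderiv M.I P.I (h.toFun ∘ f.toFun) x v = _
  rw [mfderiv_comp (I' := N.I) x ((h.smooth _).mdifferentiableAt (by simp))
    ((f.smooth _).mdifferentiableAt (by simp))]
  rfl

instance : IsEmb.IsMultiplicative where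
  id_mem M := ⟨Topology.IsEmbedding.id, fun x v w h => by
    rwa [differential_id, differential_id] at h⟩
  comp_mem f h hf hh := ⟨hh.1.comp hf.1, fun x v w e => by
    rw [differential_comp, differential_comp] at e
    exact hf.2 x (hh.2 _ e)⟩

instance : IsSub.IsMultiplicative where
  id_mem M := fun x v => ⟨v, differential_id x v⟩
  comp_mem f h hf hh := fun x u => by
    obtain ⟨w, hw⟩ := hh (f x) u
    obtain ⟨v, hv⟩ := hf x w
    exact ⟨v, by rw [differential_comp, hv, hw]⟩

instance : IsRiemEmb.IsMultiplicative where
  id_mem M := ⟨IsEmb.id_mem M, fun x v w => by rw [differential_id, differential_id]; rfl⟩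
  comp_mem f h hf hh := ⟨IsEmb.comp_mem f h hf.1 hh.1, fun x v w => by
    rw [differential_comp, differential_comp]
    exact (hh.2 (f x) _ _).trans (hf.2 x v w)⟩

instance : IsRiemSub.IsMultiplicative where
  id_mem M := ⟨IsSub.id_mem M, fun x v w _ => by rw [differential_id, differential_id]; rfl⟩
  comp_mem f h hf hh := ⟨IsSub.comp_mem f h hf.1 hh.1, fun x v w hv => by
    have hv' : IsHorizontal f x v := fun u hu => hv u (by rw [differential_comp, hu, map_zero])
    rw [differential_comp, differential_comp]
    refine (hh.2 (f x) _ _ ?_).trans (hf.2 x v w hv')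
    intro u hu
    obtain ⟨u', rfl⟩ := hf.1 x u
    rw [hf.2 x v u' hv']
    exact hv u' (by rw [differential_comp, hu])⟩

instance : IsTotGeo.IsMultiplicative where
  id_mem M := by
    intro σ _ t
    have h1 : mfderiv M.I M.I (𝟙 M : M ⟶ M).toFun (σ t).proj
        (covAlong (leviCivita M) σ t 1) = covAlong (leviCivita M) σ t 1 :=
      differential_id (M := M) _ _
    have h2 : (fun s => tangentMap M.I M.I (𝟙 M : M ⟶ M).toFun (σ s)) = σ := by
      funext s
      exact congrFun (tangentMap_id (I := M.I) (M := M)) (σ s)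
    rw [h1]
    exact (congrArg (fun a : ℝ → TangentBundle M.I M =>
      (covAlong (leviCivita M) a t 1 : Euc M.dim)) h2).symm
  comp_mem {M N P} f h hf hh := by
    intro σ hσ t
    have e : (fun s => tangentMap M.I P.I (f ≫ h).toFun (σ s)) =
        fun s => tangentMap N.I P.I h.toFun (tangentMap M.I N.I f.toFun (σ s)) := by
      funext s
      exact congrFun (tangentMap_comp (I' := N.I) (h.smooth.mdifferentiable (by simp))
        (f.smooth.mdifferentiable (by simp))) (σ s)
    have e1 := hf σ hσ t
    have e2 := hh (fun s => tangentMap M.I N.I f.toFun (σ s))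
      ((f.smooth.contMDiff_tangentMap (m := ∞) (by simp)).comp hσ) t
    have e3 := differential_comp f h (σ t).proj (covAlong (leviCivita M) σ t 1)
    refine e3.trans ?_
    have e4 := congrArg (fun a : ℝ → TangentBundle P.I P =>
      (covAlong (leviCivita P) a t 1 : Euc P.dim)) e
    refine Eq.trans ?_ e4.symm
    refine Eq.trans ?_ e2
    exact congrArg (differential h (f.toFun (σ t).proj)) e1

instance : IsOpenEmb.IsMultiplicative where
  id_mem M := Topology.IsOpenEmbedding.id
  comp_mem f h hf hh := by
    have h1 : Topology.IsOpenEmbedding f.toFun := hf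
    have h2 : Topology.IsOpenEmbedding h.toFun := hh
    exact h2.comp h1

instance : IsCov.IsMultiplicative where
  id_mem M := isLocalHomeomorph_iff_isCoveringMap.1 (Homeomorph.refl M).isLocalHomeomorph
  comp_mem {M N P} f h hf hh := by
    have h1 : IsCoveringMap f.toFun := hf
    have h2 : IsCoveringMap h.toFun := hh
    exact isLocalHomeomorph_iff_isCoveringMap.1 (h2.isLocalHomeomorph.comp h1.isLocalHomeomorph)

end Multiplicative

/-- The categories of manifolds, all with the same objects, named after their arrows. -/
inductive MfdClass : Type
  /-- smooth maps -/
  | smooth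
  /-- smooth embeddings -/
  | emb
  /-- smooth submersions -/
  | sub
  /-- Riemannian embeddings -/
  | riemEmb
  /-- Riemannian submersions -/
  | riemSub
  /-- totally geodesic Riemannian embeddings -/
  | geoEmb
  /-- totally geodesic Riemannian submersions -/
  | geoSub
  /-- totally geodesic Riemannian embeddings of connected components -/
  | geoEmbComp
  /-- totally geodesic Riemannian coverings -/
  | geoCov

namespace MfdClass

/-- The arrows of the category. -/
def arrows : MfdClass → MorphismProperty RMfd
  | smooth => ⊤
  | emb => IsEmb
  | sub => IsSub
  | riemEmb => IsRiemEmb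
  | riemSub => IsRiemSub
  | geoEmb => IsRiemEmb ⊓ IsTotGeo
  | geoSub => IsRiemSub ⊓ IsTotGeo
  | geoEmbComp => IsRiemEmb ⊓ IsTotGeo ⊓ IsOpenEmb
  | geoCov => IsRiemSub ⊓ IsTotGeo ⊓ IsCov

instance (c : MfdClass) : c.arrows.IsMultiplicative := by
  cases c <;> (unfold arrows; infer_instance)

/-- The categories of Riemannian maps, i.e. isometries or co-isometries. -/
def IsRiemannian : MfdClass → Prop
  | smooth | emb | sub => False
  | _ => True

/-- The categories of totally geodesic maps. -/
def IsGeodesic : MfdClass → Prop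
  | geoEmb | geoSub | geoEmbComp | geoCov => True
  | _ => False

/-- The category of manifolds. -/
abbrev Cat (c : MfdClass) : Type 1 := WideSubcategory c.arrows

end MfdClass

/-! ## Clifford and Grassmann algebras of the tangent spaces -/

/-- The quadratic form `v ↦ -g(v, v)` on the tangent space at `x`. -/
noncomputable def cliffordForm (M : RMfd) (x : M) : QuadraticForm ℝ (M.T x) :=
  -(LinearMap.BilinMap.toQuadraticMap
    (LinearMap.mk₂ ℝ (fun v w => M.g x v w) (by simp) (by simp) (by simp) (by simp)))

/-- The complexified Grassmann (exterior) algebra of the tangent space at `x`. -/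
abbrev Grassmann (M : RMfd) (x : M) : Type := ℂ ⊗[ℝ] ExteriorAlgebra ℝ (M.T x)

/-- The complexified Clifford algebra of the tangent space at `x`, in which `v² = -g(v, v)`. -/
abbrev Clifford (M : RMfd) (x : M) : Type := ℂ ⊗[ℝ] CliffordAlgebra (cliffordForm M x)

/-- A tangent vector as an element of the complexified Grassmann algebra. -/
noncomputable def gvec {M : RMfd} {x : M} (v : M.T x) : Grassmann M x :=
  1 ⊗ₜ ExteriorAlgebra.ι ℝ v

/-- A tangent vector as an element of the complexified Clifford algebra. -/
noncomputable def cvec {M : RMfd} {x : M} (v : M.T x) : Clifford M x :=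
  1 ⊗ₜ CliffordAlgebra.ι (cliffordForm M x) v

/-- The product `v₁ ∧ ⋯ ∧ vₖ` of tangent vectors in the complexified Grassmann algebra. -/
noncomputable def gwedge {M : RMfd} {x : M} {k : ℕ} (v : Fin k → M.T x) : Grassmann M x :=
  1 ⊗ₜ ExteriorAlgebra.ιMulti ℝ k v

/-- The canonical linear isomorphism between the Clifford and the Grassmann algebra (the symbol
map), which sends a product of pairwise orthogonal vectors to their exterior product. -/
noncomputable def symbolMap (M : RMfd) (x : M) : Clifford M x ≃ₗ[ℂ] Grassmann M x :=
  (CliffordAlgebra.equivExterior (cliffordForm M x)).baseChange ℝ ℂ _ _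

/-- The second quantization `Λ^ℂ(Df)` of the differential of `f` at `x`: the homomorphism of
complexified Grassmann algebras which extends the differential. -/
noncomputable def secondQuant {M N : RMfd} (f : M ⟶ N) (x : M) :
    Grassmann M x →ₐ[ℂ] Grassmann N (f x) :=
  Algebra.TensorProduct.map (AlgHom.id ℂ ℂ)
    (ExteriorAlgebra.map (differential f x : M.T x →ₗ[ℝ] N.T (f x)))

/-- The fibre at `x` of the Clifford propagator of `f`: the algebra of pairs generated by
the pairs `(v, Df v)` with `v` orthogonal to the kernel of `Df`. If `Df` is an isometry this is
the graph of the homomorphism of Clifford algebras induced by `Df`, if `Df` is a co-isometry it is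
the transposed graph of the homomorphism induced by the isometry `(Df)^*`. -/
noncomputable def cliffordGraph {M N : RMfd} (f : M ⟶ N) (x : M) :
    Subalgebra ℂ (Clifford M x × Clifford N (f x)) :=
  Algebra.adjoin ℂ {p | ∃ v : M.T x, IsHorizontal f x v ∧ p = (cvec v, cvec (differential f x v))}

/-! ## Hermitian bundles -/

/-- A smooth Hermitian vector bundle over `M`: a smooth vector bundle (in the sense of Mathlib, over
the reals) whose fibres are complex vector spaces, whose trivializations are complex linear, and
which has a smooth family of positive definite Hermitian forms on its fibres. -/
structure HermBundleOver (M : RMfd) : Type 1 where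
  model : Type
  [modelNorm : NormedAddCommGroup model]
  [modelSpace : NormedSpace ℂ model]
  [modelFin : FiniteDimensional ℂ model]
  fiber : M → Type
  [fiberAdd : ∀ x, AddCommGroup (fiber x)]
  [fiberModule : ∀ x, Module ℂ (fiber x)]
  [fiberTop : ∀ x, TopologicalSpace (fiber x)]
  [fiberTopAdd : ∀ x, IsTopologicalAddGroup (fiber x)]
  [fiberTopSMul : ∀ x, ContinuousSMul ℝ (fiber x)]
  [totalTop : TopologicalSpace (TotalSpace model fiber)]
  [fiberBundle : FiberBundle model fiber]
  [vectorBundle : VectorBundle ℝ model fiber]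
  [smoothBundle : ContMDiffVectorBundle ∞ model fiber M.I]
  trivialization_smul : ∀ (e : Trivialization model (π model fiber)) [MemTrivializationAtlas e],
    ∀ x ∈ e.baseSet, ∀ (c : ℂ) (v : fiber x), (e ⟨x, c • v⟩).2 = c • (e ⟨x, v⟩).2
  /-- the Hermitian form, conjugate linear in the first variable -/
  herm : ∀ x, fiber x →ₗ⋆[ℂ] fiber x →ₗ[ℂ] ℂ
  herm_symm : ∀ x v w, herm x v w = starRingEnd ℂ (herm x w v)
  herm_pos : ∀ x v, v ≠ 0 → 0 < (herm x v v).re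
  herm_smooth : ∀ s t : ∀ x, fiber x,
    ContMDiff M.I (M.I.prod 𝓘(ℝ, model)) ∞ (fun x => (⟨x, s x⟩ : TotalSpace model fiber)) →
    ContMDiff M.I (M.I.prod 𝓘(ℝ, model)) ∞ (fun x => (⟨x, t x⟩ : TotalSpace model fiber)) →
    ContMDiff M.I 𝓘(ℝ, ℂ) ∞ (fun x => herm x (s x) (t x))

attribute [instance] HermBundleOver.modelNorm HermBundleOver.modelSpace HermBundleOver.modelFin
  HermBundleOver.fiberAdd HermBundleOver.fiberModule HermBundleOver.fiberTop
  HermBundleOver.fiberTopAdd HermBundleOver.fiberTopSMul HermBundleOver.totalTop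
  HermBundleOver.fiberBundle HermBundleOver.vectorBundle HermBundleOver.smoothBundle

namespace HermBundleOver

variable {M : RMfd}

/-- The total space of a Hermitian bundle. -/
abbrev Tot (E : HermBundleOver M) : Type := TotalSpace E.model E.fiber

/-- The model with corners of the total space. -/
noncomputable abbrev TI (E : HermBundleOver M) :
    ModelWithCorners ℝ (Euc M.dim × E.model) (ModelProd (Euc M.dim) E.model) :=
  M.I.prod 𝓘(ℝ, E.model)

/-- Smooth sections. -/
def IsSmoothSection (E : HermBundleOver M) (s : ∀ x, E.fiber x) : Prop :=
  ContMDiff M.I E.TI ∞ (fun x => (⟨x, s x⟩ : E.Tot))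

end HermBundleOver

/-- A Hermitian bundle of Clifford bimodules with a compatible connection: left and right
actions of the complexified Clifford algebras of the tangent spaces, which commute, are smooth, and
for which tangent vectors act by skew-adjoint operators; and a smooth complex linear connection
compatible with the Hermitian form and, through the Levi-Civita connection, with
both Clifford actions. -/
structure DiracBundleOver (M : RMfd) extends HermBundleOver M where
  left : ∀ x, Clifford M x →ₐ[ℂ] Module.End ℂ (fiber x)
  right : ∀ x, Clifford M x →ₐ[ℂ] (Module.End ℂ (fiber x))ᵐᵒᵖ
  left_right : ∀ x a b v, left x a ((right x b).unop v) = (right x b).unop (left x a v)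
  left_skew : ∀ x (u : M.T x) v w, herm x (left x (cvec u) v) w = -herm x v (left x (cvec u) w)
  right_skew : ∀ x (u : M.T x) v w,
    herm x ((right x (cvec u)).unop v) w = -herm x v ((right x (cvec u)).unop w)
  left_smooth : ∀ X s, M.IsSmoothVF X → toHermBundleOver.IsSmoothSection s →
    toHermBundleOver.IsSmoothSection (fun x => left x (cvec (X x)) (s x))
  right_smooth : ∀ X s, M.IsSmoothVF X → toHermBundleOver.IsSmoothSection s →
    toHermBundleOver.IsSmoothSection (fun x => (right x (cvec (X x))).unop (s x))
  conn : CovariantDerivative M.I model fiber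
  conn_smooth : CovariantDerivative.ContMDiffCovariantDerivative conn ∞
  conn_complex : ∀ (c : ℂ) s, toHermBundleOver.IsSmoothSection s → ∀ x (u : M.T x),
    conn (fun y => c • s y) x u = c • conn s x u
  conn_herm : ∀ s t, toHermBundleOver.IsSmoothSection s → toHermBundleOver.IsSmoothSection t →
    ∀ x (u : M.T x), mvfderiv M.I (fun y => herm y (s y) (t y)) x u =
      herm x (conn s x u) (t x) + herm x (s x) (conn t x u)
  conn_left : ∀ X s, M.IsSmoothVF X → toHermBundleOver.IsSmoothSection s → ∀ x (u : M.T x),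
    conn (fun y => left y (cvec (X y)) (s y)) x u =
      left x (cvec (leviCivita M X x u)) (s x) + left x (cvec (X x)) (conn s x u)
  conn_right : ∀ X s, M.IsSmoothVF X → toHermBundleOver.IsSmoothSection s → ∀ x (u : M.T x),
    conn (fun y => (right y (cvec (X y))).unop (s y)) x u =
      (right x (cvec (leviCivita M X x u))).unop (s x) + (right x (cvec (X x))).unop (conn s x u)

/-- `E` is, through the identifications `φ` of its fibres with the complexified Grassmann algebras
of the tangent spaces, the complexified Grassmann bundle of `M` with its standard structure. -/
structure IsGrassmannBundle (M : RMfd) (E : DiracBundleOver M)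
    (φ : ∀ x, E.fiber x ≃ₗ[ℂ] Grassmann M x) : Prop where
  one_smooth : E.IsSmoothSection (fun x => (φ x).symm 1)
  wedge_smooth : ∀ X s, M.IsSmoothVF X → E.IsSmoothSection s →
    E.IsSmoothSection (fun x => (φ x).symm (gvec (X x) * φ x (s x)))
  herm_wedge : ∀ x k (v w : Fin k → M.T x), E.herm x ((φ x).symm (gwedge v)) ((φ x).symm (gwedge w)) =
    ((Matrix.of fun i j => M.g x (v i) (w j)).det : ℝ)
  herm_wedge_ne : ∀ x k l (v : Fin k → M.T x) (w : Fin l → M.T x), k ≠ l →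
    E.herm x ((φ x).symm (gwedge v)) ((φ x).symm (gwedge w)) = 0
  left_eq : ∀ x a s, φ x (E.left x a s) = symbolMap M x (a * (symbolMap M x).symm (φ x s))
  right_eq : ∀ x a s, φ x ((E.right x a).unop s) = symbolMap M x ((symbolMap M x).symm (φ x s) * a)
  conn_one : ∀ x (u : M.T x), E.conn (fun y => (φ y).symm 1) x u = 0
  conn_wedge : ∀ X s, M.IsSmoothVF X → E.IsSmoothSection s → ∀ x (u : M.T x),
    φ x (E.conn (fun y => (φ y).symm (gvec (X y) * φ y (s y))) x u) =
      gvec (leviCivita M X x u) * φ x (s x) + gvec (X x) * φ x (E.conn s x u)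

/-- `K` is, through the identifications `ψ` of its fibres with the complexified Clifford algebras
of the tangent spaces, the complexified Clifford bundle of `M`, with the Hermitian form for which
the symbol map to the Grassmann bundle `(E, φ)` is unitary. -/
structure IsCliffordBundle (M : RMfd) (E : DiracBundleOver M)
    (φ : ∀ x, E.fiber x ≃ₗ[ℂ] Grassmann M x) (K : HermBundleOver M)
    (ψ : ∀ x, K.fiber x ≃ₗ[ℂ] Clifford M x) : Prop where
  one_smooth : K.IsSmoothSection (fun x => (ψ x).symm 1)
  mul_smooth : ∀ X s, M.IsSmoothVF X → K.IsSmoothSection s →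
    K.IsSmoothSection (fun x => (ψ x).symm (cvec (X x) * ψ x (s x)))
  herm_eq : ∀ x a b, K.herm x a b =
    E.herm x ((φ x).symm (symbolMap M x (ψ x a))) ((φ x).symm (symbolMap M x (ψ x b)))

/-- A Hermitian bundle over some manifold. -/
structure HermBundle : Type 1 where
  base : RMfd
  bundle : HermBundleOver base

namespace HermBundle

/-- The total space. -/
abbrev Tot (A : HermBundle) : Type := A.bundle.Tot

/-- Smooth maps from Euclidean spaces to the total space. -/
def IsSmoothPlot (A : HermBundle) {k : ℕ} (a : Euc k → A.Tot) : Prop :=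
  ContMDiff 𝓘(ℝ, Euc k) A.bundle.TI ∞ a

end HermBundle

/-! ## Bundle morphisms -/

/-- Smoothness of a family of linear maps between fibres over a map of the base spaces: the
induced map of total spaces is smooth. -/
def IsSmoothFamily {A B : HermBundle} (f : A.base ⟶ B.base)
    (F : ∀ x, A.bundle.fiber x →ₗ[ℂ] B.bundle.fiber (f x)) : Prop :=
  ContMDiff A.bundle.TI B.bundle.TI ∞
    (fun p : A.Tot => (⟨f p.proj, F p.proj p.snd⟩ : B.Tot))

/-- Fibrewise linear smooth bundle morphisms over smooth maps. -/
structure BundleMap (A B : HermBundle) : Type where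
  base : A.base ⟶ B.base
  fib : ∀ x, A.bundle.fiber x →ₗ[ℂ] B.bundle.fiber (base x)
  smooth : IsSmoothFamily base fib

/-- The category of Hermitian bundles and bundle morphisms has Hermitian bundles as objects. -/
structure BundleCat : Type 1 where
  obj : HermBundle

instance : Category BundleCat where
  Hom A B := BundleMap A.obj B.obj
  id A := ⟨𝟙 _, fun _ => LinearMap.id, contMDiff_id⟩
  comp f h := ⟨f.base ≫ h.base, fun x => (h.fib (f.base x)).comp (f.fib x), h.smooth.comp f.smooth⟩

/-! ## Propagators -/

/-- The diffeology of a manifold: the plots are the smooth maps. -/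
noncomputable instance (M : RMfd) : DiffeologicalSpace M :=
  .ofCorePlotsOn {
    isPlotOn := fun {k u} _ p => ContMDiffOn 𝓘(ℝ, Euc k) M.I ∞ p u
    isPlotOn_congr := fun _ _ _ h => contMDiffOn_congr h
    isPlot := fun {k} p => ContMDiff 𝓘(ℝ, Euc k) M.I ∞ p
    isPlotOn_univ := contMDiffOn_univ
    isPlot_const := fun _ => contMDiff_const
    isPlotOn_reparam := fun _ _ _ h hp hf => hp.comp hf.contMDiffOn h
    locality := fun _ _ h => fun x hxu => by
      obtain ⟨v, hv, hxv, hv'⟩ := h x hxu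
      exact ((hv' x hxv).contMDiffAt (hv.mem_nhds hxv)).contMDiffWithinAt }

/-- A span of smooth maps `src : R → A.base`, `tgt : R → B.base` on a compact Hausdorff
diffeological space `R`, with a relation between the fibres of `A` and `B` for each point
of `R`. A relation of this kind is a family of subsets of the fibres of the Whitney sum
`src^* A ⊕ tgt^* B`; it is given here by the pairs of points of the total spaces. -/
structure Span (A B : HermBundle) : Type 1 where
  R : Type
  [top : TopologicalSpace R]
  [compact : CompactSpace R]
  [t2 : T2Space R]
  [diffeology : DiffeologicalSpace R]
  plot_continuous : ∀ (k : ℕ) (p : Euc k → R), IsPlot p → Continuous p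
  src : R → A.base
  tgt : R → B.base
  src_continuous : Continuous src
  tgt_continuous : Continuous tgt
  src_smooth : DSmooth src
  tgt_smooth : DSmooth tgt
  rel : R → A.Tot → B.Tot → Prop
  proj_src : ∀ {r a b}, rel r a b → a.proj = src r
  proj_tgt : ∀ {r a b}, rel r a b → b.proj = tgt r

attribute [instance] Span.top Span.compact Span.t2 Span.diffeology

namespace Span

variable {A B C : HermBundle}

/-- `S` is a propagator: each fibre is a complex linear subspace of the fibre of the Whitney sum and
the graph of an isometry between subspaces of the two summands; and these
isometries are smooth in both directions, i.e. for a pair of sections along a plot which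
belongs to the relation, one of them is smooth if and only if the other one is. -/
structure IsPropagator (S : Span A B) : Prop where
  zero : ∀ r, S.rel r ⟨S.src r, 0⟩ ⟨S.tgt r, 0⟩
  add : ∀ {r x y v w v' w'}, S.rel r ⟨x, v⟩ ⟨y, w⟩ → S.rel r ⟨x, v'⟩ ⟨y, w'⟩ →
    S.rel r ⟨x, v + v'⟩ ⟨y, w + w'⟩
  smul : ∀ {r x y v w} (c : ℂ), S.rel r ⟨x, v⟩ ⟨y, w⟩ → S.rel r ⟨x, c • v⟩ ⟨y, c • w⟩
  isometric : ∀ {r x y v w}, S.rel r ⟨x, v⟩ ⟨y, w⟩ → A.bundle.herm x v v = B.bundle.herm y w w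
  smooth : ∀ {k : ℕ} (p : Euc k → S.R) (a : Euc k → A.Tot) (b : Euc k → B.Tot), IsPlot p →
    (∀ t, S.rel (p t) (a t) (b t)) → (A.IsSmoothPlot a ↔ B.IsSmoothPlot b)

/-- The propagator `S` is a locally trivial smooth subbundle of the Whitney sum: along each plot
it has local smooth frames. -/
def IsSmoothSubbundle (S : Span A B) : Prop :=
  ∀ (k : ℕ) (p : Euc k → S.R), IsPlot p → ∀ t₀, ∃ (d : ℕ)
    (a : Fin d → ∀ t, A.bundle.fiber (S.src (p t))) (b : Fin d → ∀ t, B.bundle.fiber (S.tgt (p t))),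
    (∀ i, ContMDiffAt 𝓘(ℝ, Euc k) A.bundle.TI ∞ (fun t => (⟨S.src (p t), a i t⟩ : A.Tot)) t₀) ∧
    (∀ i, ContMDiffAt 𝓘(ℝ, Euc k) B.bundle.TI ∞ (fun t => (⟨S.tgt (p t), b i t⟩ : B.Tot)) t₀) ∧
    ∀ᶠ t in 𝓝 t₀, LinearIndependent ℂ (fun i => (a i t, b i t)) ∧
      ∀ v w, S.rel (p t) ⟨S.src (p t), v⟩ ⟨S.tgt (p t), w⟩ ↔
        (v, w) ∈ Submodule.span ℂ (Set.range fun i => (a i t, b i t))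

/-- The family of fibrewise orthogonal complements of `S` in the Whitney sum. -/
def orthogonal (S : Span A B) (r : S.R) (a : A.Tot) (b : B.Tot) : Prop :=
  a.proj = S.src r ∧ b.proj = S.tgt r ∧ ∀ v w, S.rel r ⟨a.proj, v⟩ ⟨b.proj, w⟩ →
    A.bundle.herm a.proj v a.snd + B.bundle.herm b.proj w b.snd = 0

/-- The identity span. -/
@[simps! src tgt rel]
noncomputable def id (A : HermBundle) : Span A A where
  R := A.base
  plot_continuous _ _ hp := ContMDiff.continuous hp
  src := fun x => x
  tgt := fun x => x
  src_continuous := continuous_id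
  tgt_continuous := continuous_id
  src_smooth := dSmooth_id
  tgt_smooth := dSmooth_id
  rel x a b := a.proj = x ∧ a = b
  proj_src h := h.1
  proj_tgt h := h.2 ▸ h.1

/-- The fibre product of the apices of two spans. -/
abbrev FibProd (S : Span A B) (S' : Span B C) : Type := {p : S.R × S'.R // S.tgt p.1 = S'.src p.2}

/-- The subspace diffeology of the product diffeology. -/
instance (S : Span A B) (S' : Span B C) : DiffeologicalSpace (FibProd S S') where
  plots _ := {p | IsPlot (fun t => (p t).1.1) ∧ IsPlot (fun t => (p t).1.2)}
  constant_plots _ := ⟨isPlot_const, isPlot_const⟩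
  plot_reparam hp hf := ⟨isPlot_reparam hp.1 hf, isPlot_reparam hp.2 hf⟩
  locality h := by
    constructor
    · refine DiffeologicalSpace.locality fun x => ?_
      obtain ⟨u, hu, hx, h'⟩ := h x
      exact ⟨u, hu, hx, fun hf hs => (h' hf hs).1⟩
    · refine DiffeologicalSpace.locality fun x => ?_
      obtain ⟨u, hu, hx, h'⟩ := h x
      exact ⟨u, hu, hx, fun hf hs => (h' hf hs).2⟩

instance (S : Span A B) (S' : Span B C) : CompactSpace (FibProd S S') :=
  isCompact_iff_compactSpace.1 (IsClosed.isCompact (isClosed_eq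
    (S.tgt_continuous.comp continuous_fst) (S'.src_continuous.comp continuous_snd)))

/-- The composition of spans: the fibre product, with the composition of relations. -/
noncomputable def comp (S : Span A B) (S' : Span B C) : Span A C where
  R := FibProd S S'
  top := inferInstance
  compact := inferInstance
  t2 := inferInstance
  diffeology := inferInstance
  plot_continuous k p hp :=
    ((S.plot_continuous k _ hp.1).prodMk (S'.plot_continuous k _ hp.2)).subtype_mk _
  src r := S.src r.1.1
  tgt r := S'.tgt r.1.2
  src_continuous := S.src_continuous.comp (continuous_fst.comp continuous_subtype_val)
  tgt_continuous := S'.tgt_continuous.comp (continuous_snd.comp continuous_subtype_val)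
  src_smooth k p hp := S.src_smooth k _ hp.1
  tgt_smooth k p hp := S'.tgt_smooth k _ hp.2
  rel r a c := ∃ b, S.rel r.1.1 a b ∧ S'.rel r.1.2 b c
  proj_src := by rintro r a c ⟨b, h, -⟩; exact S.proj_src h
  proj_tgt := by rintro r a c ⟨b, -, h⟩; exact S'.proj_tgt h

lemma IsPropagator.id (A : HermBundle) : (Span.id A).IsPropagator where
  zero r := ⟨rfl, rfl⟩
  add := by
    rintro r x y v w v' w' ⟨rfl, h⟩ ⟨-, h'⟩
    obtain ⟨rfl, h⟩ := TotalSpace.mk.inj h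
    obtain rfl := eq_of_heq h
    obtain rfl := eq_of_heq (TotalSpace.mk.inj h').2
    exact ⟨rfl, rfl⟩
  smul := by
    rintro r x y v w c ⟨rfl, h⟩
    obtain ⟨rfl, h⟩ := TotalSpace.mk.inj h
    obtain rfl := eq_of_heq h
    exact ⟨rfl, rfl⟩
  isometric := by
    rintro r x y v w ⟨rfl, h⟩
    obtain ⟨rfl, h⟩ := TotalSpace.mk.inj h
    obtain rfl := eq_of_heq h
    rfl
  smooth p a b _ h := by
    obtain rfl : a = b := funext fun t => (h t).2
    rfl

lemma IsPropagator.comp {S : Span A B} {S' : Span B C} (hS : S.IsPropagator)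
    (hS' : S'.IsPropagator) : (S.comp S').IsPropagator where
  zero r := ⟨⟨S.tgt r.1.1, 0⟩, hS.zero _, by
    have h : (⟨S.tgt r.1.1, 0⟩ : B.Tot) = ⟨S'.src r.1.2, 0⟩ := by rw [r.2]
    rw [h]; exact hS'.zero _⟩
  add := by
    rintro r x y v w v' w' ⟨⟨z, u⟩, h1, h2⟩ ⟨⟨z', u'⟩, h1', h2'⟩
    obtain rfl : z = z' := (S.proj_tgt h1).trans (S.proj_tgt h1').symm
    exact ⟨⟨z, u + u'⟩, hS.add h1 h1', hS'.add h2 h2'⟩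
  smul := by
    rintro r x y v w c ⟨⟨z, u⟩, h1, h2⟩
    exact ⟨⟨z, c • u⟩, hS.smul c h1, hS'.smul c h2⟩
  isometric := by
    rintro r x y v w ⟨⟨z, u⟩, h1, h2⟩
    exact (hS.isometric h1).trans (hS'.isometric h2)
  smooth p a c hp h := by
    choose b h1 h2 using h
    exact (hS.smooth _ a b hp.1 h1).trans (hS'.smooth _ b c hp.2 h2)

/-- Isomorphisms of spans: homeomorphisms and diffeomorphisms of the apices compatible with the
legs and the relations. -/
structure Iso (S S' : Span A B) where
  e : S.R ≃ₜ S'.R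
  smooth : DSmooth e
  smooth_symm : DSmooth e.symm
  src_eq : ∀ r, S'.src (e r) = S.src r
  tgt_eq : ∀ r, S'.tgt (e r) = S.tgt r
  rel_iff : ∀ r a b, S'.rel (e r) a b ↔ S.rel r a b

namespace Iso

variable {S S' S'' : Span A B}

/-- The identity isomorphism. -/
def refl (S : Span A B) : Iso S S :=
  ⟨Homeomorph.refl _, dSmooth_id, dSmooth_id, fun _ => rfl, fun _ => rfl, fun _ _ _ => Iff.rfl⟩

/-- The inverse isomorphism. -/
def symm (i : Iso S S') : Iso S' S where
  e := i.e.symm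
  smooth := i.smooth_symm
  smooth_symm := i.smooth
  src_eq r := by rw [← i.src_eq, i.e.apply_symm_apply]
  tgt_eq r := by rw [← i.tgt_eq, i.e.apply_symm_apply]
  rel_iff r a b := by rw [← i.rel_iff, i.e.apply_symm_apply]

/-- The composition of isomorphisms. -/
def trans (i : Iso S S') (j : Iso S' S'') : Iso S S'' where
  e := i.e.trans j.e
  smooth := j.smooth.comp i.smooth
  smooth_symm := i.smooth_symm.comp j.smooth_symm
  src_eq r := (j.src_eq _).trans (i.src_eq r)
  tgt_eq r := (j.tgt_eq _).trans (i.tgt_eq r)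
  rel_iff r a b := (j.rel_iff _ a b).trans (i.rel_iff r a b)

/-- Composition of spans respects isomorphisms. -/
def comp {S S' : Span A B} {T T' : Span B C} (i : Iso S S') (j : Iso T T') :
    Iso (S.comp T) (S'.comp T') where
  e :=
    { toFun := fun r => ⟨(i.e r.1.1, j.e r.1.2), by
        rw [i.tgt_eq, j.src_eq]; exact r.2⟩
      invFun := fun r => ⟨(i.e.symm r.1.1, j.e.symm r.1.2), by
        exact (i.symm.tgt_eq r.1.1).trans (r.2.trans (j.symm.src_eq r.1.2).symm)⟩
      left_inv := fun r => by
        apply Subtype.ext; simp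
      right_inv := fun r => by
        apply Subtype.ext; simp
      continuous_toFun := by fun_prop
      continuous_invFun := by fun_prop }
  smooth k p hp := ⟨i.smooth k _ hp.1, j.smooth k _ hp.2⟩
  smooth_symm k p hp := ⟨i.smooth_symm k _ hp.1, j.smooth_symm k _ hp.2⟩
  src_eq r := i.src_eq _
  tgt_eq r := j.tgt_eq _
  rel_iff r a c := exists_congr fun b => and_congr (i.rel_iff _ a b) (j.rel_iff _ b c)

/-- The left unit law. -/
noncomputable def idComp (S : Span A B) : Iso ((Span.id A).comp S) S where
  e :=
    { toFun := fun r => r.1.2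
      invFun := fun r => ⟨(S.src r, r), rfl⟩
      left_inv := fun r => Subtype.ext (Prod.ext r.2.symm rfl)
      right_inv := fun r => rfl
      continuous_toFun := continuous_snd.comp continuous_subtype_val
      continuous_invFun := (S.src_continuous.prodMk continuous_id).subtype_mk _ }
  smooth k p hp := hp.2
  smooth_symm k p hp := ⟨S.src_smooth k p hp, hp⟩
  src_eq r := r.2.symm
  tgt_eq r := rfl
  rel_iff r a b := by
    constructor
    · intro h
      exact ⟨a, ⟨(S.proj_src h).trans r.2.symm, rfl⟩, h⟩
    · rintro ⟨a', ⟨-, rfl⟩, h⟩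
      exact h

/-- The right unit law. -/
noncomputable def compId (S : Span A B) : Iso (S.comp (Span.id B)) S where
  e :=
    { toFun := fun r => r.1.1
      invFun := fun r => ⟨(r, S.tgt r), rfl⟩
      left_inv := fun r => Subtype.ext (Prod.ext rfl r.2)
      right_inv := fun r => rfl
      continuous_toFun := continuous_fst.comp continuous_subtype_val
      continuous_invFun := (continuous_id.prodMk S.tgt_continuous).subtype_mk _ }
  smooth k p hp := hp.1
  smooth_symm k p hp := ⟨hp, S.tgt_smooth k p hp⟩
  src_eq r := rfl
  tgt_eq r := r.2
  rel_iff r a b := by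
    constructor
    · intro h
      exact ⟨b, h, (S.proj_tgt h).trans r.2, rfl⟩
    · rintro ⟨b', h, -, rfl⟩
      exact h

/-- The associativity of the composition. -/
noncomputable def assoc {D : HermBundle} (S : Span A B) (T : Span B C) (U : Span C D) :
    Iso ((S.comp T).comp U) (S.comp (T.comp U)) where
  e :=
    { toFun := fun r => ⟨(r.1.1.1.1, ⟨(r.1.1.1.2, r.1.2), r.2⟩), r.1.1.2⟩
      invFun := fun r => ⟨(⟨(r.1.1, r.1.2.1.1), r.2⟩, r.1.2.1.2), r.1.2.2⟩
      left_inv := fun r => rfl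
      right_inv := fun r => rfl
      continuous_toFun := by
        have h1 : Continuous (fun r : FibProd (S.comp T) U => (r.1.1 : FibProd S T)) :=
          continuous_fst.comp continuous_subtype_val
        have h2 : Continuous (fun r : FibProd (S.comp T) U => r.1.2) :=
          continuous_snd.comp continuous_subtype_val
        have h3 := continuous_subtype_val.comp h1
        exact ((continuous_fst.comp h3).prodMk
          (((continuous_snd.comp h3).prodMk h2).subtype_mk _)).subtype_mk _
      continuous_invFun := by
        have h1 : Continuous (fun r : FibProd S (T.comp U) => (r.1.2 : FibProd T U)) :=
          continuous_snd.comp continuous_subtype_val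
        have h2 : Continuous (fun r : FibProd S (T.comp U) => r.1.1) :=
          continuous_fst.comp continuous_subtype_val
        have h3 := continuous_subtype_val.comp h1
        exact ((((h2.prodMk (continuous_fst.comp h3)).subtype_mk _)).prodMk
          (continuous_snd.comp h3)).subtype_mk _ }
  smooth k p hp := ⟨hp.1.1, hp.1.2, hp.2⟩
  smooth_symm k p hp := ⟨⟨hp.1, hp.2.1⟩, hp.2.2⟩
  src_eq r := rfl
  tgt_eq r := rfl
  rel_iff r a d := by
    constructor
    · rintro ⟨b, h1, c, h2, h3⟩
      exact ⟨c, ⟨b, h1, h2⟩, h3⟩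
    · rintro ⟨c, ⟨b, h1, h2⟩, h3⟩
      exact ⟨b, h1, c, h2, h3⟩

end Iso

/-- Propagators up to isomorphism of spans. -/
instance setoid (A B : HermBundle) : Setoid {S : Span A B // S.IsPropagator} where
  r S S' := Nonempty (Iso S.1 S'.1)
  iseqv := ⟨fun S => ⟨Iso.refl S.1⟩, fun ⟨i⟩ => ⟨i.symm⟩, fun ⟨i⟩ ⟨j⟩ => ⟨i.trans j⟩⟩

end Span

/-- Propagators between two Hermitian bundles: isomorphism classes of spans with
fibrewise isometric relations. -/
def Propagator (A B : HermBundle) : Type 1 := Quotient (Span.setoid A B)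

/-- The propagator represented by a span. -/
def Propagator.mk {A B : HermBundle} (S : Span A B) (h : S.IsPropagator) : Propagator A B :=
  Quotient.mk _ ⟨S, h⟩

/-- The composition of propagators. -/
noncomputable def Propagator.comp {A B C : HermBundle} (p : Propagator A B) (q : Propagator B C) :
    Propagator A C :=
  Quotient.map₂ (fun S T => ⟨S.1.comp T.1, S.2.comp T.2⟩)
    (by rintro _ _ ⟨i⟩ _ _ ⟨j⟩; exact ⟨i.comp j⟩) p q

/-- The category of propagators has Hermitian bundles as objects. -/
structure PropagatorCat : Type 1 where
  obj : HermBundle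

noncomputable instance : Category PropagatorCat where
  Hom A B := Propagator A.obj B.obj
  id A := Propagator.mk (Span.id A.obj) (.id A.obj)
  comp p q := p.comp q
  id_comp := by
    rintro A B ⟨S⟩
    exact Quotient.sound ⟨Span.Iso.idComp S.1⟩
  comp_id := by
    rintro A B ⟨S⟩
    exact Quotient.sound ⟨Span.Iso.compId S.1⟩
  assoc := by
    rintro A B C D ⟨S⟩ ⟨T⟩ ⟨U⟩
    exact Quotient.sound ⟨Span.Iso.assoc S.1 T.1 U.1⟩

/-! ## Amplified propagators -/

/-- A Hermitian bundle `factor` together with a Hermitian bundle `amplifier` over the same manifold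
and their tensor product `product`. -/
structure AmplifiedBundle : Type 1 where
  base : RMfd
  factor : HermBundleOver base
  amplifier : HermBundleOver base
  product : HermBundleOver base
  tmul : ∀ x, factor.fiber x →ₗ[ℂ] amplifier.fiber x →ₗ[ℂ] product.fiber x
  tmul_bijective : ∀ x, Function.Bijective (TensorProduct.lift (tmul x))
  herm_tmul : ∀ x v w v' w', product.herm x (tmul x v w) (tmul x v' w') =
    factor.herm x v v' * amplifier.herm x w w'
  tmul_smooth : ∀ s t, factor.IsSmoothSection s → amplifier.IsSmoothSection t →
    product.IsSmoothSection (fun x => tmul x (s x) (t x))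

/-- The category of amplified propagators: propagators between the tensor products of the given
Hermitian bundles with amplifying Hermitian bundles. -/
structure AmplifiedCat : Type 1 where
  obj : AmplifiedBundle

noncomputable instance : Category AmplifiedCat :=
  inferInstanceAs (Category (InducedCategory PropagatorCat
    (fun A : AmplifiedCat => ⟨⟨A.obj.base, A.obj.product⟩⟩)))

/-- The trivial Hermitian line bundle. -/
noncomputable def trivialLine (M : RMfd) : HermBundleOver M where
  model := ℂ
  fiber := Bundle.Trivial M ℂ
  trivialization_smul e _ x _ c v := by
    obtain rfl := Bundle.Trivial.eq_trivialization M ℂ e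
    rfl
  herm _ := innerₛₗ ℂ (E := ℂ)
  herm_symm _ v w := (inner_conj_symm (𝕜 := ℂ) (E := ℂ) v w).symm
  herm_pos _ v hv := by
    have h := inner_self_eq_norm_sq (𝕜 := ℂ) (E := ℂ) v
    have h' : (0 : ℝ) < ‖(v : ℂ)‖ ^ 2 := by
      have : 0 < ‖(v : ℂ)‖ := norm_pos_iff.2 hv
      positivity
    rw [← h] at h'
    exact h'
  herm_smooth s t hs ht := by
    have hs' : ContMDiff M.I 𝓘(ℝ, ℂ) ∞ (fun x => (s x : ℂ)) := fun x =>
      (contMDiffAt_totalSpace.1 (hs x)).2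
    have ht' : ContMDiff M.I 𝓘(ℝ, ℂ) ∞ (fun x => (t x : ℂ)) := fun x =>
      (contMDiffAt_totalSpace.1 (ht x)).2
    have hc : ContMDiff M.I 𝓘(ℝ, ℂ) ∞ (fun x => starRingEnd ℂ (s x : ℂ)) :=
      (Complex.conjCLE : ℂ →L[ℝ] ℂ).contMDiff.comp hs'
    exact ((ContinuousLinearMap.mul ℝ ℂ).contMDiff.comp ht').clm_apply hc

lemma HermBundleOver.IsSmoothSection.smul {M : RMfd} (E : HermBundleOver M) {s : ∀ x, E.fiber x}
    (hs : E.IsSmoothSection s) {z : M → ℂ} (hz : (trivialLine M).IsSmoothSection z) :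
    E.IsSmoothSection (fun x => z x • s x) := by
  intro x
  have hz' : ContMDiffAt M.I 𝓘(ℝ, ℂ) ∞ (fun x => (z x : ℂ)) x :=
    (contMDiffAt_totalSpace.1 (hz x)).2
  have hs' := (contMDiffAt_totalSpace.1 (hs x)).2
  refine contMDiffAt_totalSpace.2 ⟨contMDiffAt_id, ?_⟩
  refine (((ContinuousLinearMap.lsmul ℝ ℂ : ℂ →L[ℝ] E.model →L[ℝ] E.model).contMDiff.contMDiffAt.comp x
    hz').clm_apply hs').congr_of_eventuallyEq ?_
  filter_upwards [(trivializationAt E.model E.fiber x).open_baseSet.mem_nhds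
    (FiberBundle.mem_baseSet_trivializationAt' x)] with y hy
  exact E.trivialization_smul _ y hy _ _

/-- The inclusion of the propagators into the amplified propagators, by means of trivial
amplifications. -/
noncomputable def amplify : PropagatorCat ⥤ AmplifiedCat where
  obj A := ⟨{
    base := A.obj.base
    factor := A.obj.bundle
    amplifier := trivialLine A.obj.base
    product := A.obj.bundle
    tmul := fun x => (LinearMap.lsmul ℂ (A.obj.bundle.fiber x)).flip
    tmul_bijective := fun x => by
      have h : (TensorProduct.lift (LinearMap.lsmul ℂ (A.obj.bundle.fiber x)).flip :
          A.obj.bundle.fiber x ⊗[ℂ] ℂ →ₗ[ℂ] A.obj.bundle.fiber x) =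
          (TensorProduct.rid ℂ (A.obj.bundle.fiber x)).toLinearMap := by
        ext v; simp
      change Function.Bijective (TensorProduct.lift
        (LinearMap.lsmul ℂ (A.obj.bundle.fiber x)).flip :
          A.obj.bundle.fiber x ⊗[ℂ] ℂ →ₗ[ℂ] A.obj.bundle.fiber x)
      rw [h]
      exact (TensorProduct.rid ℂ (A.obj.bundle.fiber x)).bijective
    herm_tmul := fun x v (w : ℂ) v' (w' : ℂ) => by
      change A.obj.bundle.herm x (w • v) (w' • v') = A.obj.bundle.herm x v v' * inner ℂ w w'
      rw [LinearMap.map_smulₛₗ₂, LinearMap.map_smul, RCLike.inner_apply, smul_eq_mul, smul_eq_mul]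
      ring
    tmul_smooth := fun s t hs ht => HermBundleOver.IsSmoothSection.smul _ hs ht }⟩
  map f := ⟨f⟩
  map_id _ := rfl
  map_comp _ _ := rfl

/-! ## The Grassmann and the Clifford functors on arrows -/

section Arrows

/-- A choice of a Hermitian bundle over each manifold, as objects of the category of bundles. -/
abbrev toHerm (L : ∀ M, DiracBundleOver M) (M : RMfd) : HermBundle := ⟨M, (L M).toHermBundleOver⟩

variable (L : ∀ M, DiracBundleOver M)
  (φ : ∀ (M : RMfd) (x : M), (L M).fiber x ≃ₗ[ℂ] Grassmann M x)
  (K : ∀ M, HermBundleOver M) (ψ : ∀ (M : RMfd) (x : M), (K M).fiber x ≃ₗ[ℂ] Clifford M x)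

/-- The second quantized differential as a linear map between the fibres of the bundles. -/
noncomputable def grassmannFib {M N : RMfd} (f : M ⟶ N) (x : M) :
    (L M).fiber x →ₗ[ℂ] (L N).fiber (f x) :=
  (φ N (f x)).symm.toLinearMap ∘ₗ (secondQuant f x).toLinearMap ∘ₗ (φ M x).toLinearMap

/-- The span `M ← M → N` with legs the identity and `f`, i.e. the graph of `f`, with the relation
over `x` given by a set of pairs. -/
noncomputable def graphSpan {A B : HermBundle} (f : A.base ⟶ B.base)
    (G : ∀ x, A.bundle.fiber x → B.bundle.fiber (f x) → Prop) : Span A B where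
  R := A.base
  plot_continuous _ _ hp := ContMDiff.continuous hp
  src := fun x => x
  tgt := f
  src_continuous := continuous_id
  tgt_continuous := f.smooth.continuous
  src_smooth := dSmooth_id
  tgt_smooth _ _ hp := f.smooth.comp hp
  rel x a b := ∃ v w, G x v w ∧ a = ⟨x, v⟩ ∧ b = ⟨f x, w⟩
  proj_src := by rintro x a b ⟨v, w, -, rfl, -⟩; rfl
  proj_tgt := by rintro x a b ⟨v, w, -, -, rfl⟩; rfl

/-- The Grassmann propagator of `f`: over `x` it is the graph of the restriction of
`Λ^ℂ(Df)` to the orthogonal complement of its kernel (which is the whole fibre if `f` is an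
immersion). -/
noncomputable def grassmannSpan {M N : RMfd} (f : M ⟶ N) : Span (toHerm L M) (toHerm L N) :=
  graphSpan (A := toHerm L M) (B := toHerm L N) f fun x v w =>
    (∀ u, grassmannFib L φ f x u = 0 → (L M).herm x u v = 0) ∧ w = grassmannFib L φ f x v

/-- The Clifford propagator of `f`. -/
noncomputable def cliffordSpan {M N : RMfd} (f : M ⟶ N) : Span ⟨M, K M⟩ ⟨N, K N⟩ :=
  graphSpan (A := ⟨M, K M⟩) (B := ⟨N, K N⟩) f fun x v w =>
    (ψ M x v, ψ N (f x) w) ∈ cliffordGraph f x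

end Arrows

/-- The propagator `S` between bundles of Clifford bimodules is stable under the left and right
actions of the propagator `C` between the Clifford bundles. -/
def IsCliffordStable {M N : RMfd} (f : M ⟶ N) (E : DiracBundleOver M) (E' : DiracBundleOver N)
    (rel : M → E.Tot → E'.Tot → Prop) : Prop :=
  ∀ x v w, rel x ⟨x, v⟩ ⟨f x, w⟩ → ∀ p ∈ cliffordGraph f x,
    rel x ⟨x, E.left x p.1 v⟩ ⟨f x, E'.left (f x) p.2 w⟩ ∧
    rel x ⟨x, (E.right x p.1).unop v⟩ ⟨f x, (E'.right (f x) p.2).unop w⟩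

/-- A family of relations over a diffeological space is parallel: it is preserved by the
pull-back of the direct sum of the connections to every plot. -/
def IsParallel {M N : RMfd} (E : DiracBundleOver M) (E' : DiracBundleOver N)
    {R : Type} [DiffeologicalSpace R] (rel : R → E.Tot → E'.Tot → Prop) : Prop :=
  ∀ (k : ℕ) (p : Euc k → R) (a : Euc k → E.Tot) (b : Euc k → E'.Tot), IsPlot p →
    ContMDiff 𝓘(ℝ, Euc k) E.TI ∞ a → ContMDiff 𝓘(ℝ, Euc k) E'.TI ∞ b →
    (∀ t, rel (p t) (a t) (b t)) →
    ∀ t u, rel (p t) ⟨(a t).proj, covAlong E.conn.toFun a t u⟩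
      ⟨(b t).proj, covAlong E'.conn.toFun b t u⟩

/-!
The tangent spaces of an `n`-manifold are copies of one Euclidean space `Euc n`, so that a single
algebra `Lam n` serves as the fibre of every Grassmann bundle. A linear map `A` induces the
homomorphism `Λ(A) = Lam.map A`, which is functorial, smooth in `A` (`Lam.contDiff_mapL`), and
turns adjoints into adjoints (`Lam.herm_map_left`). The Grassmann bundle is glued by `Λ` from the
coordinate changes of the tangent bundle, and naturality of the constructions under linear
isometries makes everything defined in charts independent of them. The Hermitian form is defined by
contractions; it is given by determinants (`Lam.herm_wedge`) and is positive (`Lam.herm_pos`). The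
symbol map turns Clifford multiplication by vectors into combinations of exterior multiplication
and contraction (`symb_cvec_mul`, `symb_mul_cvec`).

The Levi-Civita connection exists by the Christoffel symbols `Γ` of the Koszul formula
(`RMfd.isLeviCivita_lc`), and on differentiable fields it is given by them (`RMfd.nabla_eq_d`). The
derivative of `Λ` at the identity extends an endomorphism to a derivation (`Lam.der`), and the
connection of the Grassmann bundle is `d + Lam.der Γ`. That it is smooth, metric and a derivation
for both Clifford actions follows by differentiating the corresponding naturality statements
(`RMfd.contMDiffAt_nablaLam`, `RMfd.nablaLam_herm`, `RMfd.nablaLam_cliff`).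

For a smooth map `f` let `A` be its differential at a point and `A^*` the adjoint with respect to
the metrics. The central object is the relation `RMfd.MutualImage`: `w = Λ(A) v` and
`v = Λ(A^*) w`. It is symmetric in `A` and `A^*`, both of which are smooth in the point, so it is a
propagator for every smooth `f` (`RMfd.isPropagator_mutualSpan`). If `f` is a Riemannian embedding
or submersion, `A` is a partial isometry, and the relation is the graph of `Λ(A)` restricted to the
orthogonal complement of its kernel (`RMfd.grassmannSpan_eq`). It is stable under the pairs
`(u, A u)` of Clifford elements with `u` horizontal, hence under the algebra which they generate;
applied to the pair of units this shows that the symbol maps identify that algebra with the same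
relation (`RMfd.cliffordSpan_eq`). Thus functoriality, local triviality and stability need to be
proved only for this relation.

If `f` is totally geodesic, `A` is parallel (`RMfd.d_famCo_dE`), and so is `A^*`, because the
connections are metric (`RMfd.d_famCo_dEadj`). Then `Λ(A)` and `Λ(A^*)` commute with covariant
differentiation (`RMfd.covLam_map`). Since the relation and its orthogonal complement, which is
given by `Λ(A^*) Λ(A) v + Λ(A^*) w = 0`, are defined by equations in these maps, both are parallel.
-/

/-! ### Instances on spaces of bilinear forms -/

noncomputable instance (n m : ℕ) : NormedAddCommGroup (Euc n →L[ℝ] Euc m) :=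
  ContinuousLinearMap.toNormedAddCommGroup

noncomputable instance (n m : ℕ) : NormedSpace ℝ (Euc n →L[ℝ] Euc m) :=
  ContinuousLinearMap.toNormedSpace

noncomputable instance (n : ℕ) : NormedAddCommGroup (Euc n →L[ℝ] Euc n →L[ℝ] ℝ) :=
  ContinuousLinearMap.toNormedAddCommGroup

noncomputable instance (n : ℕ) : NormedSpace ℝ (Euc n →L[ℝ] Euc n →L[ℝ] ℝ) :=
  ContinuousLinearMap.toNormedSpace

/-! ### The complexified exterior algebra of a Euclidean space -/

/-- The complexified exterior algebra of Euclidean `n`-space. Since the tangent spaces of an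
`n`-manifold are copies of `Euc n`, it is both the model and the fibre of the Grassmann bundle. -/
def Lam (n : ℕ) : Type := ℂ ⊗[ℝ] ExteriorAlgebra ℝ (Euc n)

namespace Lam

variable {n m k : ℕ}

noncomputable instance : Ring (Lam n) := inferInstanceAs (Ring (ℂ ⊗[ℝ] ExteriorAlgebra ℝ (Euc n)))

noncomputable instance : Algebra ℂ (Lam n) :=
  inferInstanceAs (Algebra ℂ (ℂ ⊗[ℝ] ExteriorAlgebra ℝ (Euc n)))

instance : Module.Finite ℂ (Lam n) :=
  haveI := Module.Finite.of_basis (PiLp.basisFun 2 ℝ (Fin n)).ExteriorAlgebra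
  inferInstanceAs (Module.Finite ℂ (ℂ ⊗[ℝ] ExteriorAlgebra ℝ (Euc n)))

/-- The norm is the sup norm of the coordinates in some basis; only the topology matters. -/
noncomputable instance : NormedAddCommGroup (Lam n) :=
  NormedAddCommGroup.induced (Lam n) (Fin (Module.finrank ℂ (Lam n)) → ℂ)
    (Module.finBasis ℂ (Lam n)).equivFun (LinearEquiv.injective _)

noncomputable instance : NormedSpace ℂ (Lam n) :=
  NormedSpace.induced ℂ (Lam n) (Fin (Module.finrank ℂ (Lam n)) → ℂ)
    (Module.finBasis ℂ (Lam n)).equivFun.toLinearMap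

instance : FiniteDimensional ℝ (Lam n) := FiniteDimensional.complexToReal (Lam n)

/-- The pure tensor `c ⊗ x`. -/
noncomputable def mk (c : ℂ) (x : ExteriorAlgebra ℝ (Euc n)) : Lam n := c ⊗ₜ[ℝ] x

lemma mk_eq_smul (c : ℂ) (x : ExteriorAlgebra ℝ (Euc n)) : mk c x = c • mk 1 x := by
  change c ⊗ₜ[ℝ] x = c • ((1 : ℂ) ⊗ₜ[ℝ] x)
  rw [TensorProduct.smul_tmul', smul_eq_mul, mul_one]

lemma mk_mul (c d : ℂ) (x y : ExteriorAlgebra ℝ (Euc n)) : mk c x * mk d y = mk (c * d) (x * y) :=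
  Algebra.TensorProduct.tmul_mul_tmul _ _ _ _

lemma mk_add (c : ℂ) (x y : ExteriorAlgebra ℝ (Euc n)) : mk c (x + y) = mk c x + mk c y :=
  TensorProduct.tmul_add _ _ _

lemma mk_smul (r : ℝ) (x : ExteriorAlgebra ℝ (Euc n)) : mk 1 (r • x) = r • mk 1 x := by
  rw [← Complex.coe_smul, ← mk_eq_smul]
  change (1 : ℂ) ⊗ₜ[ℝ] (r • x) = (r : ℂ) ⊗ₜ[ℝ] x
  rw [TensorProduct.tmul_smul, TensorProduct.smul_tmul', Complex.real_smul, mul_one]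

lemma one_eq_mk : (1 : Lam n) = mk 1 1 := rfl

/-- A vector as an element of the complexified exterior algebra. -/
noncomputable def ι : Euc n →ₗ[ℝ] Lam n where
  toFun v := mk 1 (ExteriorAlgebra.ι ℝ v)
  map_add' v w := by rw [map_add, mk_add]
  map_smul' r v := by rw [map_smul, mk_smul]; rfl

lemma ι_apply (v : Euc n) : ι v = mk 1 (ExteriorAlgebra.ι ℝ v) := rfl

/-- The complexified exterior algebra is generated by the vectors: it suffices to treat the unit and
products with a vector on the left. Most identities below are proved in this way. -/
@[elab_as_elim]
lemma left_induction {P : Lam n → Prop} (one : P 1) (ι_mul : ∀ v x, P x → P (ι v * x))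
    (add : ∀ x y, P x → P y → P (x + y)) (smul : ∀ (c : ℂ) x, P x → P (c • x)) (x : Lam n) :
    P x := by
  have real : ∀ y : ExteriorAlgebra ℝ (Euc n), P (mk 1 y) := by
    intro y
    induction y using CliffordAlgebra.left_induction with
    | algebraMap r =>
      rw [Algebra.algebraMap_eq_smul_one, mk_smul, ← Complex.coe_smul]
      exact smul _ _ one
    | add x y hx hy => rw [mk_add]; exact add _ _ hx hy
    | ι_mul x v hx =>
      have := ι_mul v _ hx
      rwa [ι_apply, mk_mul, one_mul] at this
  refine TensorProduct.induction_on (R := ℝ) (M := ℂ) (N := ExteriorAlgebra ℝ (Euc n))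
    (motive := P) x ?_ ?_ ?_
  · have := smul 0 _ one
    rwa [zero_smul] at this
  · intro c y
    change P (mk c y)
    rw [mk_eq_smul]
    exact smul _ _ (real y)
  · exact fun x y hx hy => add x y hx hy

/-- Functoriality: the homomorphism of exterior algebras extending a linear map. -/
noncomputable def map (A : Euc n →L[ℝ] Euc m) : Lam n →ₐ[ℂ] Lam m :=
  Algebra.TensorProduct.map (AlgHom.id ℂ ℂ) (ExteriorAlgebra.map (A : Euc n →ₗ[ℝ] Euc m))

lemma map_mk (A : Euc n →L[ℝ] Euc m) (c : ℂ) (x : ExteriorAlgebra ℝ (Euc n)) :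
    map A (mk c x) = mk c (ExteriorAlgebra.map (A : Euc n →ₗ[ℝ] Euc m) x) :=
  Algebra.TensorProduct.map_tmul _ _ _ _

@[simp] lemma map_ι (A : Euc n →L[ℝ] Euc m) (v : Euc n) : map A (ι v) = ι (A v) := by
  rw [ι_apply, map_mk, ExteriorAlgebra.map_apply_ι]; rfl

@[simp] lemma map_id_apply (x : Lam n) : map (ContinuousLinearMap.id ℝ (Euc n)) x = x := by
  induction x using left_induction with
  | one => simp
  | ι_mul v x h => simp [h]
  | add x y hx hy => simp [hx, hy]
  | smul c x h => simp [h]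

lemma map_comp_apply (B : Euc m →L[ℝ] Euc k) (A : Euc n →L[ℝ] Euc m) (x : Lam n) :
    map (B ∘L A) x = map B (map A x) := by
  induction x using left_induction with
  | one => simp
  | ι_mul v x h => simp [h]
  | add x y hx hy => simp [hx, hy]
  | smul c x h => simp [h]

/-- The contraction with a covector. -/
noncomputable def contr (d : Euc n →L[ℝ] ℝ) : Lam n →ₗ[ℂ] Lam n :=
  LinearMap.baseChange ℂ (CliffordAlgebra.contractLeft (Q := (0 : QuadraticForm ℝ (Euc n)))
    (d : Euc n →ₗ[ℝ] ℝ))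

lemma contr_mk (d : Euc n →L[ℝ] ℝ) (c : ℂ) (x : ExteriorAlgebra ℝ (Euc n)) :
    contr d (mk c x) = mk c (CliffordAlgebra.contractLeft (d : Euc n →ₗ[ℝ] ℝ) x) := rfl

@[simp] lemma contr_one (d : Euc n →L[ℝ] ℝ) : contr d 1 = 0 := by
  rw [one_eq_mk, contr_mk, CliffordAlgebra.contractLeft_one]
  exact TensorProduct.tmul_zero _ _

lemma mk_induction {P : Lam n → Prop} (mk : ∀ c y, P (mk c y))
    (add : ∀ x y, P x → P y → P (x + y)) (x : Lam n) : P x :=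
  TensorProduct.induction_on (R := ℝ) (M := ℂ) (N := ExteriorAlgebra ℝ (Euc n)) (motive := P) x
    (by simpa [Lam.mk] using! mk 0 0) mk add

@[simp] lemma contr_ι_mul (d : Euc n →L[ℝ] ℝ) (v : Euc n) (x : Lam n) :
    contr d (ι v * x) = d v • x - ι v * contr d x := by
  induction x using mk_induction with
  | mk c y =>
    rw [ι_apply, mk_mul, contr_mk, contr_mk, mk_mul, one_mul]
    have := CliffordAlgebra.contractLeft_ι_mul (Q := (0 : QuadraticForm ℝ (Euc n)))
      (d : Euc n →ₗ[ℝ] ℝ) v y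
    refine (congrArg (mk c) this).trans ?_
    rw [mk_eq_smul c y, smul_comm, ← mk_smul, ← mk_eq_smul]
    exact TensorProduct.tmul_sub _ _ _
  | add x y hx hy =>
    rw [mul_add, map_add, hx, hy, map_add, smul_add, mul_add]
    abel

lemma contr_add (d e : Euc n →L[ℝ] ℝ) (x : Lam n) : contr (d + e) x = contr d x + contr e x := by
  induction x using left_induction with
  | one => simp
  | ι_mul v x h => simp only [contr_ι_mul, h, _root_.add_apply, add_smul, mul_add]; abel
  | add x y hx hy => simp only [map_add, hx, hy]; abel
  | smul c x h => simp only [map_smul, h, smul_add]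

lemma contr_smul (r : ℝ) (d : Euc n →L[ℝ] ℝ) (x : Lam n) : contr (r • d) x = r • contr d x := by
  induction x using left_induction with
  | one => simp
  | ι_mul v x h =>
    simp only [contr_ι_mul, h, _root_.smul_apply, smul_sub, smul_assoc, mul_smul_comm]
  | add x y hx hy => simp only [map_add, hx, hy, smul_add]
  | smul c x h => simp only [map_smul, h]; rw [smul_comm]

/-- The contraction is natural. -/
lemma contr_map (A : Euc n →L[ℝ] Euc m) (d : Euc m →L[ℝ] ℝ) (x : Lam n) :
    contr d (map A x) = map A (contr (d ∘L A) x) := by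
  induction x using left_induction with
  | one => simp
  | ι_mul v x h =>
    have e : ∀ (r : ℝ) (y : Lam n), map A (r • y) = r • map A y := fun r y => by
      rw [← Complex.coe_smul, map_smul, Complex.coe_smul]
    simp [h, e]
  | add x y hx hy => simp [hx, hy]
  | smul c x h => simp [h]

lemma ι_mul_ι_add (v w : Euc n) (x : Lam n) : ι v * (ι w * x) = -(ι w * (ι v * x)) := by
  have h : ι v * ι w + ι w * ι v = 0 := by
    rw [ι_apply, ι_apply, mk_mul, mk_mul, mul_one, ← mk_add, ExteriorAlgebra.ι_add_mul_swap]
    exact TensorProduct.tmul_zero _ _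
  rw [← mul_assoc, ← mul_assoc, eq_neg_iff_add_eq_zero, ← add_mul, h, zero_mul]

lemma contr_contr (d e : Euc n →L[ℝ] ℝ) (x : Lam n) :
    contr d (contr e x) = -contr e (contr d x) := by
  have hr : ∀ (d : Euc n →L[ℝ] ℝ) (r : ℝ) (y : Lam n), contr d (r • y) = r • contr d y :=
    fun d r y => by rw [← Complex.coe_smul, map_smul, Complex.coe_smul]
  induction x using left_induction with
  | one => simp
  | ι_mul v x h =>
    simp only [contr_ι_mul, map_sub, h, hr, mul_neg]
    abel
  | add x y hx hy => simp only [map_add, hx, hy]; abel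
  | smul c x h => simp only [map_smul, h, smul_neg]

/-- The scalar part of an element. -/
noncomputable def scalar : Lam n →ₐ[ℂ] ℂ :=
  Algebra.TensorProduct.lift (AlgHom.id ℂ ℂ)
    ((Algebra.ofId ℝ ℂ).comp (ExteriorAlgebra.algebraMapInv (R := ℝ) (M := Euc n)))
    (fun _ _ => mul_comm _ _)

@[simp] lemma scalar_ι (v : Euc n) : scalar (ι v) = 0 := by
  have h : ExteriorAlgebra.algebraMapInv (ExteriorAlgebra.ι ℝ v) = (0 : ℝ) := by
    simp [ExteriorAlgebra.algebraMapInv]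
  refine (Algebra.TensorProduct.lift_tmul _ _ _ _ _).trans ?_
  simp [h]

@[simp] lemma scalar_map (A : Euc n →L[ℝ] Euc m) (x : Lam n) : scalar (map A x) = scalar x := by
  induction x using left_induction with
  | one => simp
  | ι_mul v x h => simp
  | add x y hx hy => simp [hx, hy]
  | smul c x h => simp [h]

/-- Complex conjugation. -/
noncomputable def conj : Lam n →+* Lam n :=
  (Algebra.TensorProduct.map (R := ℝ) (S := ℝ) Complex.conjAe.toAlgHom
    (AlgHom.id ℝ (ExteriorAlgebra ℝ (Euc n)))).toRingHom

lemma conj_mk (c : ℂ) (x : ExteriorAlgebra ℝ (Euc n)) :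
    conj (mk c x) = mk (starRingEnd ℂ c) x := rfl

@[simp] lemma conj_ι (v : Euc n) : conj (ι v) = ι v := by
  rw [ι_apply, conj_mk, map_one]

@[simp] lemma conj_smul (c : ℂ) (x : Lam n) : conj (c • x) = starRingEnd ℂ c • conj x := by
  have h : conj (mk c (1 : ExteriorAlgebra ℝ (Euc n))) = mk (starRingEnd ℂ c) 1 := conj_mk _ _
  rw [mk_eq_smul, mk_eq_smul (starRingEnd ℂ c), ← one_eq_mk] at h
  rw [← one_mul x, ← smul_mul_assoc, map_mul, h, smul_mul_assoc, one_mul, one_mul]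

/-- Iterated contraction: `v₁ ∧ ⋯ ∧ vₖ` acts by the contraction with `g v₁`, followed by
the contraction with `g v₂`, and so on. -/
noncomputable def iterContr (g : Euc n →L[ℝ] Euc n →L[ℝ] ℝ) :
    Lam n →ₐ[ℂ] (Module.End ℂ (Lam n))ᵐᵒᵖ :=
  Algebra.TensorProduct.lift (Algebra.ofId ℂ _)
    (ExteriorAlgebra.lift ℝ ⟨{
      toFun := fun v => MulOpposite.op (contr (g v))
      map_add' := fun v w => by
        rw [← MulOpposite.op_add, map_add]; congr 1; ext x; exact contr_add _ _ x
      map_smul' := fun r v => by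
        rw [map_smul, RingHom.id_apply, ← MulOpposite.op_smul]; congr 1; ext x
        exact contr_smul _ _ x }, fun v => by
          change MulOpposite.op (contr (g v)) * MulOpposite.op (contr (g v)) = 0
          rw [← MulOpposite.op_mul, MulOpposite.op_eq_zero_iff]
          ext x
          have h := contr_contr (g v) (g v) x
          have h2 : (2 : ℂ) • contr (g v) (contr (g v) x) = 0 := by
            rw [two_smul]; nth_rewrite 2 [h]; exact add_neg_cancel _
          exact (smul_eq_zero.1 h2).resolve_left two_ne_zero⟩)
    (fun c y => Algebra.commutes c _)

lemma iterContr_ι (g : Euc n →L[ℝ] Euc n →L[ℝ] ℝ) (v : Euc n) :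
    iterContr g (ι v) = MulOpposite.op (contr (g v)) := by
  refine (Algebra.TensorProduct.lift_tmul _ _ _ _ _).trans ?_
  rw [map_one, one_mul, ExteriorAlgebra.lift_ι_apply]
  rfl

/-- The sesquilinear form on the complexified exterior algebra induced by a bilinear form `g`: on
exterior products of vectors it is the determinant of the matrix of the values of `g`. -/
noncomputable def herm (g : Euc n →L[ℝ] Euc n →L[ℝ] ℝ) : Lam n →ₗ⋆[ℂ] Lam n →ₗ[ℂ] ℂ :=
  LinearMap.mk₂'ₛₗ (starRingEnd ℂ) (RingHom.id ℂ)
    (fun a b => scalar ((iterContr g (conj a)).unop b))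
    (fun a a' b => by simp) (fun c a b => by simp) (fun a b b' => by simp) (fun c a b => by simp)

lemma herm_one (g : Euc n →L[ℝ] Euc n →L[ℝ] ℝ) (b : Lam n) : herm g 1 b = scalar b := by
  simp [herm]

lemma herm_ι_mul (g : Euc n →L[ℝ] Euc n →L[ℝ] ℝ) (v : Euc n) (a b : Lam n) :
    herm g (ι v * a) b = herm g a (contr (g v) b) := by
  simp [herm, iterContr_ι]

lemma herm_real_smul_right (g : Euc n →L[ℝ] Euc n →L[ℝ] ℝ) (r : ℝ) (a b : Lam n) :
    herm g a (r • b) = r * herm g a b := by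
  rw [← Complex.coe_smul, map_smul, smul_eq_mul]

/-- Wedging with a vector and contracting with it are adjoint to each other. -/
lemma herm_mul_ι (g : Euc n →L[ℝ] Euc n →L[ℝ] ℝ) (hg : ∀ v w, g v w = g w v) (v : Euc n)
    (a b : Lam n) : herm g a (ι v * b) = herm g (contr (g v) a) b := by
  induction a using left_induction generalizing b with
  | one => simp [herm_one]
  | ι_mul u a h =>
    rw [herm_ι_mul, contr_ι_mul, contr_ι_mul, map_sub, map_sub, LinearMap.sub_apply, herm_ι_mul,
      h, herm_real_smul_right, ← Complex.coe_smul, LinearMap.map_smulₛₗ₂, Complex.conj_ofReal,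
      hg u v, smul_eq_mul]
  | add x y hx hy => simp [hx, hy]
  | smul c x h => simp [h]

lemma herm_symm (g : Euc n →L[ℝ] Euc n →L[ℝ] ℝ) (hg : ∀ v w, g v w = g w v) (a b : Lam n) :
    herm g a b = starRingEnd ℂ (herm g b a) := by
  have one : ∀ b : Lam n, herm g b 1 = starRingEnd ℂ (scalar b) := by
    intro b
    induction b using left_induction with
    | one => simp [herm_one]
    | ι_mul u a h => simp [herm_ι_mul]
    | add x y hx hy => simp [hx, hy]
    | smul c x h => simp [h]
  induction a using left_induction generalizing b with
  | one => rw [one, herm_one, Complex.conj_conj]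
  | ι_mul u a h => rw [herm_ι_mul, herm_mul_ι g hg, h]
  | add x y hx hy => simp [hx, hy]
  | smul c x h => simp [h]

/-- If `B` is the adjoint of `A`, then `map B` is the adjoint of `map A`. -/
lemma herm_map_left (g : Euc n →L[ℝ] Euc n →L[ℝ] ℝ) (g' : Euc m →L[ℝ] Euc m →L[ℝ] ℝ)
    (A : Euc n →L[ℝ] Euc m) (B : Euc m →L[ℝ] Euc n) (h : ∀ v w, g' (A v) w = g v (B w))
    (a : Lam n) (b : Lam m) : herm g' (map A a) b = herm g a (map B b) := by
  induction a using left_induction generalizing b with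
  | one => simp [herm_one]
  | ι_mul u a ih =>
    have e : g' (A u) = g u ∘L B := ContinuousLinearMap.ext (h u)
    rw [map_mul, map_ι, herm_ι_mul, herm_ι_mul, ih, e, contr_map]
  | add x y hx hy => simp [hx, hy]
  | smul c x h => simp [h]

/-- The form is natural for the pull-back of bilinear forms. -/
lemma herm_map_map (g : Euc n →L[ℝ] Euc n →L[ℝ] ℝ) (g' : Euc m →L[ℝ] Euc m →L[ℝ] ℝ)
    (A : Euc n →L[ℝ] Euc m) (h : ∀ v w, g' (A v) (A w) = g v w) (a b : Lam n) :
    herm g' (map A a) (map A b) = herm g a b := by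
  induction a using left_induction generalizing b with
  | one => simp [herm_one]
  | ι_mul u a ih =>
    have e : g' (A u) ∘L A = g u := ContinuousLinearMap.ext (h u)
    rw [map_mul, map_ι, herm_ι_mul, herm_ι_mul, contr_map, ih, e]
  | add x y hx hy => simp [hx, hy]
  | smul c x h => simp [h]

/-- The product `v₁ ∧ ⋯ ∧ vₖ`. -/
noncomputable def wedge {k : ℕ} (v : Fin k → Euc n) : Lam n := mk 1 (ExteriorAlgebra.ιMulti ℝ k v)

lemma wedge_zero (v : Fin 0 → Euc n) : wedge v = 1 := by
  rw [wedge, ExteriorAlgebra.ιMulti_zero_apply, one_eq_mk]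

lemma wedge_succ {k : ℕ} (v : Fin (k + 1) → Euc n) :
    wedge v = ι (v 0) * wedge (fun i => v i.succ) := by
  rw [wedge, ExteriorAlgebra.ιMulti_succ_apply, wedge, ι_apply, mk_mul, one_mul]
  rfl

lemma contr_real_smul (d : Euc n →L[ℝ] ℝ) (r : ℝ) (y : Lam n) :
    contr d (r • y) = r • contr d y := by
  rw [← Complex.coe_smul, map_smul, Complex.coe_smul]

/-- The expansion of a contraction, which matches the Laplace expansion of a determinant along the
first row. -/
lemma contr_wedge {k : ℕ} (d : Euc n →L[ℝ] ℝ) (v : Fin (k + 1) → Euc n) :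
    contr d (wedge v) = ∑ j : Fin (k + 1),
      ((-1 : ℝ) ^ (j : ℕ) * d (v j)) • wedge (fun i => v (j.succAbove i)) := by
  induction k with
  | zero =>
    have h := contr_ι_mul d (v 0) 1
    rw [mul_one, contr_one, mul_zero, sub_zero] at h
    simp [wedge_succ, wedge_zero, h]
  | succ k ih =>
    rw [wedge_succ, contr_ι_mul, ih, Fin.sum_univ_succ (n := k + 1), Finset.mul_sum, sub_eq_add_neg,
      ← Finset.sum_neg_distrib]
    congr 1
    · simp
    · refine Finset.sum_congr rfl fun j _ => ?_
      rw [mul_smul_comm, wedge_succ (fun i => v (j.succ.succAbove i)), ← neg_smul]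
      simp only [Fin.val_succ, pow_succ, Fin.succ_succAbove_zero, Fin.succ_succAbove_succ]
      congr 1; ring

/-- The form `herm g` is the one prescribed by determinants. It is defined by contractions because
this makes its sesquilinearity and its adjunctions evident. -/
lemma herm_wedge {k : ℕ} (g : Euc n →L[ℝ] Euc n →L[ℝ] ℝ) (v w : Fin k → Euc n) :
    herm g (wedge v) (wedge w) = ((Matrix.of fun i j => g (v i) (w j)).det : ℝ) := by
  induction k with
  | zero => simp [wedge_zero, herm_one]
  | succ k ih =>
    rw [wedge_succ v, herm_ι_mul, contr_wedge, map_sum, Matrix.det_succ_row_zero,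
      Complex.ofReal_sum]
    refine Finset.sum_congr rfl fun j _ => ?_
    rw [herm_real_smul_right, ih]
    push_cast
    rfl

lemma herm_wedge_of_ne {k l : ℕ} (g : Euc n →L[ℝ] Euc n →L[ℝ] ℝ) (v : Fin k → Euc n)
    (w : Fin l → Euc n) (h : k ≠ l) : herm g (wedge v) (wedge w) = 0 := by
  induction k generalizing l with
  | zero =>
    obtain ⟨l, rfl⟩ := Nat.exists_eq_succ_of_ne_zero h.symm
    rw [wedge_zero, herm_one, wedge_succ, map_mul, scalar_ι, zero_mul]
  | succ k ih =>
    rw [wedge_succ v, herm_ι_mul]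
    cases l with
    | zero => rw [wedge_zero, contr_one, map_zero]
    | succ l =>
      rw [contr_wedge, map_sum]
      refine Finset.sum_eq_zero fun j _ => ?_
      rw [herm_real_smul_right, ih _ _ (by omega), mul_zero]

end Lam

/-! ### Positivity of the Hermitian form and Clifford multiplication -/

namespace Lam

variable {n m k : ℕ}

/-- The basis of the complexified exterior algebra given by a basis of the Euclidean space. -/
noncomputable def basis {κ : Type} [LinearOrder κ] (b : Module.Basis κ ℝ (Euc n)) :
    Module.Basis (Finset κ) ℂ (Lam n) :=
  Algebra.TensorProduct.basis ℂ b.ExteriorAlgebra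

lemma basis_eq_wedge {κ : Type} [LinearOrder κ] (b : Module.Basis κ ℝ (Euc n)) (s : Finset κ) :
    basis b s = wedge (b ∘ s.orderEmbOfFin rfl) := by
  refine (Algebra.TensorProduct.basis_apply _ _).trans ?_
  rw [ExteriorAlgebra.basis_apply]
  rfl

/-- The exterior products of the vectors of a `g`-orthogonal basis are orthogonal to each other. -/
lemma herm_basis_of_ne {κ : Type} [LinearOrder κ] (b : Module.Basis κ ℝ (Euc n))
    (g : Euc n →L[ℝ] Euc n →L[ℝ] ℝ) (hb : ∀ i j, i ≠ j → g (b i) (b j) = 0) {s t : Finset κ}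
    (h : s ≠ t) : herm g (basis b s) (basis b t) = 0 := by
  rw [basis_eq_wedge, basis_eq_wedge]
  by_cases hc : s.card = t.card
  · obtain ⟨i, hi, hit⟩ : ∃ i ∈ s, i ∉ t := by
      by_contra! h'
      exact h (Finset.eq_of_subset_of_card_le h' hc.ge)
    have key : ∀ {l : ℕ} (hl : t.card = l) (hs : s.card = l),
        herm g (wedge (b ∘ s.orderEmbOfFin hs)) (wedge (b ∘ t.orderEmbOfFin hl)) = 0 := by
      intro l hl hs
      obtain ⟨r, hr⟩ : ∃ r, s.orderEmbOfFin hs r = i := by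
        have : i ∈ Set.range (s.orderEmbOfFin hs) := by simpa using! hi
        exact this
      rw [herm_wedge, Matrix.det_eq_zero_of_row_eq_zero r, Complex.ofReal_zero]
      intro j
      refine hb _ _ fun e => hit ?_
      rw [← hr, e]
      exact t.orderEmbOfFin_mem hl j
    have h2 : wedge (b ∘ t.orderEmbOfFin rfl) = wedge (b ∘ t.orderEmbOfFin hc.symm) := by
      have : ∀ {l : ℕ} (hl : t.card = l),
          wedge (b ∘ t.orderEmbOfFin rfl) = wedge (b ∘ t.orderEmbOfFin hl) := by
        rintro l rfl; rfl
      exact this _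
    rw [h2]
    exact key hc.symm rfl
  · exact herm_wedge_of_ne _ _ _ hc

lemma herm_basis_self {κ : Type} [LinearOrder κ] (b : Module.Basis κ ℝ (Euc n))
    (g : Euc n →L[ℝ] Euc n →L[ℝ] ℝ) (hb : ∀ i j, i ≠ j → g (b i) (b j) = 0)
    (hpos : ∀ i, 0 < g (b i) (b i)) (s : Finset κ) :
    ∃ r : ℝ, 0 < r ∧ herm g (basis b s) (basis b s) = r := by
  refine ⟨_, ?_, by rw [basis_eq_wedge, herm_wedge]⟩
  have : (Matrix.of fun i j => g ((b ∘ s.orderEmbOfFin rfl) i) ((b ∘ s.orderEmbOfFin rfl) j)) =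
      Matrix.diagonal fun i => g (b (s.orderEmbOfFin rfl i)) (b (s.orderEmbOfFin rfl i)) := by
    ext i j
    rcases eq_or_ne i j with rfl | h
    · simp
    · rw [Matrix.diagonal_apply_ne _ h]
      exact hb _ _ fun e => h ((s.orderEmbOfFin rfl).injective e)
  rw [this, Matrix.det_diagonal]
  exact Finset.prod_pos fun i _ => hpos _

/-- In the basis given by a `g`-orthogonal basis, the form is diagonal with positive entries. -/
lemma herm_pos (g : Euc n →L[ℝ] Euc n →L[ℝ] ℝ) (hg : ∀ v w, g v w = g w v)
    (hpos : ∀ v, v ≠ 0 → 0 < g v v) (a : Lam n) (ha : a ≠ 0) : 0 < (herm g a a).re := by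
  obtain ⟨b, hb⟩ := LinearMap.BilinForm.exists_orthogonal_basis (K := ℝ) (V := Euc n)
    (B := LinearMap.mk₂ ℝ (fun v w => g v w) (by simp) (by simp) (by simp) (by simp))
    ⟨fun v w => hg v w⟩
  have hb' : ∀ i j, i ≠ j → g (b i) (b j) = 0 := fun i j h => hb h
  choose d hd hd' using herm_basis_self b g hb' fun i => hpos _ (b.ne_zero i)
  set c := (basis b).repr a with hc
  have hsum : ∑ s, c s • basis b s = a := (basis b).sum_repr a
  have h1 : herm g a a = ∑ s, ((Complex.normSq (c s) * d s : ℝ) : ℂ) := by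
    conv_lhs => rw [← hsum]
    rw [map_sum]
    refine Finset.sum_congr rfl fun s _ => ?_
    rw [map_sum, LinearMap.sum_apply, Finset.sum_eq_single s]
    · rw [map_smul, LinearMap.map_smulₛₗ₂, hd', Complex.ofReal_mul, Complex.normSq_eq_conj_mul_self]
      simp only [smul_eq_mul]; ring
    · intro t _ hst
      rw [map_smul, LinearMap.map_smulₛₗ₂, herm_basis_of_ne b g hb' hst]
      simp
    · simp
  rw [h1, ← Complex.ofReal_sum, Complex.ofReal_re]
  obtain ⟨s, hs⟩ : ∃ s, c s ≠ 0 := by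
    by_contra! h
    apply ha
    rw [← hsum]
    exact Finset.sum_eq_zero fun s _ => by rw [h s, zero_smul]
  exact Finset.sum_pos' (fun t _ => mul_nonneg (Complex.normSq_nonneg _) (hd t).le)
    ⟨s, Finset.mem_univ _, mul_pos (Complex.normSq_pos.2 hs) (hd s)⟩

/-- The grade involution. -/
noncomputable def invol : Lam n →ₐ[ℂ] Lam n := map (-ContinuousLinearMap.id ℝ (Euc n))

@[simp] lemma invol_ι (v : Euc n) : invol (ι v) = -ι v := by
  rw [invol, map_ι, ← map_neg]; rfl

lemma map_invol (A : Euc n →L[ℝ] Euc m) (x : Lam n) : map A (invol x) = invol (map A x) := by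
  rw [invol, invol, ← map_comp_apply, ← map_comp_apply]
  congr 2; ext v; simp

lemma contr_invol (d : Euc n →L[ℝ] ℝ) (x : Lam n) : contr d (invol x) = -invol (contr d x) := by
  rw [invol, contr_map]
  have : d ∘L (-ContinuousLinearMap.id ℝ (Euc n)) = (-1 : ℝ) • d := by ext; simp
  rw [this, contr_smul, neg_one_smul, map_neg]

lemma herm_invol (g : Euc n →L[ℝ] Euc n →L[ℝ] ℝ) (a b : Lam n) :
    herm g (invol a) b = herm g a (invol b) :=
  herm_map_left g g _ _ (fun v w => by simp) a b

/-- Left Clifford multiplication by a vector, with `v² = -g(v, v)`. -/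
noncomputable def cleft (g : Euc n →L[ℝ] Euc n →L[ℝ] ℝ) (v : Euc n) (x : Lam n) : Lam n :=
  ι v * x - contr (g v) x

/-- Right Clifford multiplication by a vector, with `v² = -g(v, v)`. -/
noncomputable def cright (g : Euc n →L[ℝ] Euc n →L[ℝ] ℝ) (v : Euc n) (x : Lam n) : Lam n :=
  ι v * invol x + contr (g v) (invol x)

variable (g : Euc n →L[ℝ] Euc n →L[ℝ] ℝ)

lemma cright_add (v : Euc n) (x y : Lam n) : cright g v (x + y) = cright g v x + cright g v y := by
  simp only [cright, map_add, mul_add]; abel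

lemma cright_smul (v : Euc n) (c : ℂ) (x : Lam n) : cright g v (c • x) = c • cright g v x := by
  simp [cright]

/-- Left and right Clifford multiplication commute. With the associativity of the Clifford algebra
this identifies right multiplication under the symbol map, see `symb_mul_cvec`. -/
lemma cleft_cright (hg : ∀ v w, g v w = g w v) (u v : Euc n) (x : Lam n) :
    cright g v (cleft g u x) = cleft g u (cright g v x) := by
  simp only [cleft, cright, map_sub, map_add, map_mul, invol_ι, mul_sub, mul_add, neg_mul, map_neg,
    contr_ι_mul, contr_invol, hg u v, mul_neg]
  rw [ι_mul_ι_add v u, contr_contr (g v) (g u)]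
  simp only [map_neg]
  abel

lemma herm_cleft (hg : ∀ v w, g v w = g w v) (u : Euc n) (a b : Lam n) :
    herm g (cleft g u a) b = -herm g a (cleft g u b) := by
  rw [cleft, cleft, map_sub, map_sub, LinearMap.sub_apply, herm_ι_mul, herm_mul_ι g hg]
  ring

lemma herm_cright (hg : ∀ v w, g v w = g w v) (u : Euc n) (a b : Lam n) :
    herm g (cright g u a) b = -herm g a (cright g u b) := by
  have e1 : invol (contr (g u) b) = -contr (g u) (invol b) := by rw [contr_invol, neg_neg]
  have e2 : invol (ι u * b) = -(ι u * invol b) := by rw [map_mul, invol_ι, neg_mul]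
  rw [cright, cright, map_add, map_add, LinearMap.add_apply, herm_ι_mul, ← herm_mul_ι g hg,
    herm_invol, herm_invol, e1, e2, map_neg, map_neg]
  ring

end Lam

/-! ### The symbol map -/

section Symbol

variable (M : RMfd) (x : M)

/-- The symbol map with values in the standard fibre. -/
noncomputable def symb : Clifford M x ≃ₗ[ℂ] Lam M.dim := symbolMap M x

/-- `cvec` for a vector of the standard fibre of the tangent bundle. -/
noncomputable def cvecE (v : Euc M.dim) : Clifford M x := cvec (x := x) v

lemma cvecE_mul_tmul (v : Euc M.dim) (c : ℂ) (y : CliffordAlgebra (cliffordForm M x)) :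
    cvecE M x v * (c ⊗ₜ[ℝ] y : Clifford M x) =
      c ⊗ₜ[ℝ] (CliffordAlgebra.ι (cliffordForm M x) v * y) :=
  (Algebra.TensorProduct.tmul_mul_tmul _ _ _ _).trans (by rw [one_mul])

/-- The complexified Clifford algebra is generated by the tangent vectors. -/
@[elab_as_elim]
lemma Clifford.left_induction {M : RMfd} {x : M} {P : Clifford M x → Prop} (one : P 1)
    (cvec_mul : ∀ v a, P a → P (cvecE M x v * a)) (add : ∀ a b, P a → P b → P (a + b))
    (smul : ∀ (c : ℂ) a, P a → P (c • a)) (a : Clifford M x) : P a := by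
  have hs : ∀ (c : ℂ) (y : CliffordAlgebra (cliffordForm M x)),
      c ⊗ₜ[ℝ] y = c • ((1 : ℂ) ⊗ₜ[ℝ] y : Clifford M x) := fun c y => by
    rw [TensorProduct.smul_tmul', smul_eq_mul, mul_one]
  have real : ∀ y : CliffordAlgebra (cliffordForm M x), P ((1 : ℂ) ⊗ₜ[ℝ] y) := by
    intro y
    induction y using CliffordAlgebra.left_induction with
    | algebraMap r =>
      rw [Algebra.algebraMap_eq_smul_one, ← TensorProduct.smul_tmul, hs]
      exact smul _ _ one
    | add x y hx hy => rw [TensorProduct.tmul_add]; exact add _ _ hx hy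
    | ι_mul y v hy =>
      exact (congrArg P (cvecE_mul_tmul M x v 1 y)).mp (cvec_mul v _ hy)
  induction a using TensorProduct.induction_on with
  | zero => have := smul 0 _ one; rwa [zero_smul] at this
  | tmul c y => rw [hs]; exact smul _ _ (real y)
  | add a b ha hb => exact add _ _ ha hb

/-- The metric at `x` as a bilinear form on the standard fibre of the tangent bundle. -/
noncomputable def RMfd.gE : Euc M.dim →L[ℝ] Euc M.dim →L[ℝ] ℝ := M.g x

lemma RMfd.gE_symm (v w : Euc M.dim) : M.gE x v w = M.gE x w v := M.metric.symm x v w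

lemma RMfd.gE_pos (v : Euc M.dim) (hv : v ≠ 0) : 0 < M.gE x v v := M.metric.pos x v hv

lemma symb_one : symb M x 1 = 1 :=
  congrArg (Lam.mk 1) (CliffordAlgebra.changeForm_one
    (CliffordAlgebra.changeForm.associated_neg_proof (Q := cliffordForm M x)))

/-- The symbol map turns left Clifford multiplication into exterior multiplication minus
contraction; this is the recursion which defines `CliffordAlgebra.changeForm`. -/
lemma symb_cvec_mul (v : Euc M.dim) (a : Clifford M x) :
    symb M x (cvecE M x v * a) = Lam.cleft (M.gE x) v (symb M x a) := by
  induction a using TensorProduct.induction_on with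
  | zero => simp [Lam.cleft]
  | tmul c y =>
    have h := CliffordAlgebra.changeForm_ι_mul
      (CliffordAlgebra.changeForm.associated_neg_proof (Q := cliffordForm M x)) v y
    have hB : (QuadraticMap.associated (R := ℝ) (M := M.T x) (-cliffordForm M x)) v =
        (M.g x v : M.T x →ₗ[ℝ] ℝ) := by
      rw [cliffordForm, neg_neg]
      exact LinearMap.congr_fun (QuadraticMap.associated_left_inverse ℝ
        (fun v w => M.metric.symm x v w)) v
    rw [hB] at h
    rw [cvecE_mul_tmul]
    refine (congrArg (Lam.mk c) h).trans ?_
    refine (TensorProduct.tmul_sub (R := ℝ) c _ _).trans ?_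
    have e : ∀ z : ExteriorAlgebra ℝ (Euc M.dim),
        Lam.mk c (ExteriorAlgebra.ι ℝ v * z) = Lam.ι v * Lam.mk c z := fun z => by
      rw [Lam.ι_apply, Lam.mk_mul, one_mul]
    exact congrArg₂ (fun p q : Lam M.dim => p - q) (e _) rfl
  | add a b ha hb =>
    rw [mul_add, map_add, ha, hb, map_add]
    simp only [Lam.cleft, mul_add, map_add]
    abel

lemma symb_mul_cvec (v : Euc M.dim) (a : Clifford M x) :
    symb M x (a * cvecE M x v) = Lam.cright (M.gE x) v (symb M x a) := by
  induction a using Clifford.left_induction with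
  | one =>
    have := symb_cvec_mul M x v 1
    rw [mul_one] at this
    rw [one_mul, this, symb_one]
    simp [Lam.cleft, Lam.cright]
  | cvec_mul u a h =>
    rw [mul_assoc, symb_cvec_mul, h, symb_cvec_mul, Lam.cleft_cright _ (M.gE_symm x)]
  | add a b ha hb => rw [add_mul, map_add, ha, hb, map_add, Lam.cright_add]
  | smul c a h => rw [smul_mul_assoc, map_smul, h, map_smul, Lam.cright_smul]

end Symbol

/-! ### Smooth dependence of the exterior algebra functor -/

namespace Lam

variable {n m k : ℕ}

noncomputable instance : NormedAddCommGroup (Lam n →L[ℝ] Lam m) :=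
  ContinuousLinearMap.toNormedAddCommGroup

noncomputable instance : NormedSpace ℝ (Lam n →L[ℝ] Lam m) := ContinuousLinearMap.toNormedSpace

noncomputable instance : NormedAddCommGroup (Lam n →L[ℝ] ℂ) :=
  ContinuousLinearMap.toNormedAddCommGroup

noncomputable instance : NormedSpace ℝ (Lam n →L[ℝ] ℂ) := ContinuousLinearMap.toNormedSpace

noncomputable instance : NormedAddCommGroup (Lam n →L[ℝ] Lam m →L[ℝ] ℂ) :=
  ContinuousLinearMap.toNormedAddCommGroup

noncomputable instance : NormedSpace ℝ (Lam n →L[ℝ] Lam m →L[ℝ] ℂ) :=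
  ContinuousLinearMap.toNormedSpace

noncomputable instance : AddCommGroup (Lam n →L[ℝ] Lam m →L[ℝ] ℂ) := inferInstance

/-- Multiplication as a continuous bilinear map. -/
noncomputable def mulL : Lam n →L[ℝ] Lam n →L[ℝ] Lam n :=
  (LinearMap.mk₂ ℝ (fun x y : Lam n => x * y) add_mul (fun c x y => by simp) mul_add
    (fun c x y => by simp)).toContinuousBilinearMap

@[simp] lemma mulL_apply (x y : Lam n) : mulL x y = x * y := rfl

/-- The inclusion of the vectors as a continuous linear map. -/
noncomputable def ιL : Euc n →L[ℝ] Lam n := ι.toContinuousLinearMap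

@[simp] lemma ιL_apply (v : Euc n) : ιL v = ι v := rfl

/-- The contraction as a continuous bilinear map. -/
noncomputable def contrL : (Euc n →L[ℝ] ℝ) →L[ℝ] Lam n →L[ℝ] Lam n :=
  (LinearMap.mk₂ ℝ (fun (d : Euc n →L[ℝ] ℝ) (x : Lam n) => contr d x) contr_add contr_smul
    (fun d x y => by simp) (fun r d x => contr_real_smul d r x)).toContinuousBilinearMap

@[simp] lemma contrL_apply (d : Euc n →L[ℝ] ℝ) (x : Lam n) : contrL d x = contr d x := rfl

/-- A complex linear map as a continuous real linear map. -/
noncomputable def toRealL {V W : Type*} [NormedAddCommGroup V] [NormedSpace ℂ V]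
    [FiniteDimensional ℂ V] [NormedAddCommGroup W] [NormedSpace ℂ W] (f : V →ₗ[ℂ] W) : V →L[ℝ] W :=
  f.toContinuousLinearMap.restrictScalars ℝ

/-- The homomorphism `map A` as a continuous real linear map. -/
noncomputable def mapL (A : Euc n →L[ℝ] Euc m) : Lam n →L[ℝ] Lam m := toRealL (map A).toLinearMap

@[simp] lemma mapL_apply (A : Euc n →L[ℝ] Euc m) (x : Lam n) : mapL A x = map A x := rfl

lemma mapL_comp (B : Euc m →L[ℝ] Euc k) (A : Euc n →L[ℝ] Euc m) :
    mapL (B ∘L A) = mapL B ∘L mapL A := ContinuousLinearMap.ext fun x => map_comp_apply B A x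

lemma mapL_id : mapL (ContinuousLinearMap.id ℝ (Euc n)) = ContinuousLinearMap.id ℝ (Lam n) :=
  ContinuousLinearMap.ext map_id_apply

/-- On a fixed element, `mapL A` is a polynomial in `A`. -/
lemma contDiff_mapL : ContDiff ℝ ∞ (mapL : (Euc n →L[ℝ] Euc m) → Lam n →L[ℝ] Lam m) := by
  refine contDiff_clm_apply_iff.2 fun x => ?_
  simp only [mapL_apply]
  induction x using left_induction with
  | one => simpa using contDiff_const
  | ι_mul v x h =>
    simp only [map_mul, map_ι]
    exact (mulL.contDiff.comp (ιL.contDiff.comp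
      (ContinuousLinearMap.apply ℝ (Euc m) v).contDiff)).clm_apply h
  | add x y hx hy => simpa using hx.add hy
  | smul c x h => simpa using h.const_smul c

/-- The sesquilinear form `herm g` as a continuous real bilinear map. -/
noncomputable def hermL (g : Euc n →L[ℝ] Euc n →L[ℝ] ℝ) : Lam n →L[ℝ] Lam n →L[ℝ] ℂ :=
  (LinearMap.mk₂ ℝ (fun a b => herm g a b) (by simp)
    (fun r a b => by
      rw [← Complex.coe_smul, LinearMap.map_smulₛₗ₂, Complex.conj_ofReal, Complex.coe_smul])
    (by simp) (fun r a b => by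
      rw [← Complex.coe_smul, map_smul, Complex.coe_smul])).toContinuousBilinearMap

@[simp] lemma hermL_apply (g : Euc n →L[ℝ] Euc n →L[ℝ] ℝ) (a b : Lam n) :
    hermL g a b = herm g a b := rfl

lemma contDiff_hermL :
    ContDiff ℝ ∞ (hermL : (Euc n →L[ℝ] Euc n →L[ℝ] ℝ) → Lam n →L[ℝ] Lam n →L[ℝ] ℂ) := by
  refine contDiff_clm_apply_iff.2 fun a => contDiff_clm_apply_iff.2 fun b => ?_
  simp only [hermL_apply]
  induction a using left_induction generalizing b with
  | one => simpa [herm_one] using contDiff_const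
  | ι_mul v a h =>
    -- the covector `g v` is expanded in the coordinates of the standard basis
    have e : ∀ g : Euc n →L[ℝ] Euc n →L[ℝ] ℝ, herm g (ι v * a) b = ∑ i : Fin n,
        hermL g a (contr (EuclideanSpace.proj i) b) * (g v (EuclideanSpace.single i 1) : ℝ) := by
      intro g
      have hg : g v = ∑ i : Fin n, g v (EuclideanSpace.single i 1) •
          (EuclideanSpace.proj i : Euc n →L[ℝ] ℝ) := by
        ext w
        conv_lhs => rw [← (EuclideanSpace.basisFun (Fin n) ℝ).sum_repr w, map_sum]
        simp [mul_comm]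
      rw [herm_ι_mul, ← contrL_apply]
      conv_lhs => rw [hg]
      simp only [map_sum, map_smul, _root_.sum_apply, _root_.smul_apply, contrL_apply,
        herm_real_smul_right, hermL_apply]
      exact Finset.sum_congr rfl fun i _ => mul_comm _ _
    simp only [e]
    refine ContDiff.sum fun i _ => ?_
    have h1 := h (contr (EuclideanSpace.proj i) b)
    refine h1.mul ?_
    exact Complex.ofRealCLM.contDiff.comp
      ((ContinuousLinearMap.apply ℝ ℝ (EuclideanSpace.single i (1 : ℝ))).comp
      (ContinuousLinearMap.apply ℝ (Euc n →L[ℝ] ℝ) v)).contDiff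
  | add x y hx hy => simpa using (hx b).add (hy b)
  | smul c x h => simpa using (h b).const_smul (starRingEnd ℂ c)

/-! ### Infinitesimal functoriality -/

/-- The derivation of the exterior algebra extending an endomorphism `Γ`: the derivative of the
functor `mapL` at the identity. -/
noncomputable def der : (Euc n →L[ℝ] Euc n) →L[ℝ] Lam n →L[ℝ] Lam n :=
  fderiv ℝ mapL (ContinuousLinearMap.id ℝ (Euc n))

lemma hasFDerivAt_mapL (A : Euc n →L[ℝ] Euc m) : HasFDerivAt mapL (fderiv ℝ mapL A) A :=
  (contDiff_mapL.differentiable (by simp) A).hasFDerivAt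

/-- Functoriality, differentiated at the identity on the left. -/
lemma fderiv_mapL_comp_left (A : Euc n →L[ℝ] Euc m) (Γ : Euc m →L[ℝ] Euc m) (x : Lam n) :
    fderiv ℝ mapL A (Γ ∘L A) x = der Γ (map A x) := by
  have h1 : HasFDerivAt (fun B : Euc m →L[ℝ] Euc m => mapL (B ∘L A) x)
      (((ContinuousLinearMap.apply ℝ (Lam m) x).comp (fderiv ℝ mapL A)).comp
        ((ContinuousLinearMap.compL ℝ (Euc n) (Euc m) (Euc m)).flip A))
      (ContinuousLinearMap.id ℝ (Euc m)) := by
    have h0 : HasFDerivAt (fun B : Euc m →L[ℝ] Euc m => B ∘L A)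
        ((ContinuousLinearMap.compL ℝ (Euc n) (Euc m) (Euc m)).flip A)
        (ContinuousLinearMap.id ℝ (Euc m)) :=
      ((ContinuousLinearMap.compL ℝ (Euc n) (Euc m) (Euc m)).flip A).hasFDerivAt
    exact (ContinuousLinearMap.apply ℝ (Lam m) x).hasFDerivAt.comp _
      (HasFDerivAt.comp (g := mapL) _ (hasFDerivAt_mapL A) h0)
  have h2 : HasFDerivAt (fun B : Euc m →L[ℝ] Euc m => mapL (B ∘L A) x)
      ((ContinuousLinearMap.apply ℝ (Lam m) (map A x)).comp der)
      (ContinuousLinearMap.id ℝ (Euc m)) := by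
    simp only [mapL_comp]
    exact (ContinuousLinearMap.apply ℝ (Lam m) (map A x)).hasFDerivAt.comp _ (hasFDerivAt_mapL _)
  exact congrArg (fun T : (Euc m →L[ℝ] Euc m) →L[ℝ] Lam m => T Γ) (h1.unique h2)

/-- Functoriality, differentiated at the identity on the right. -/
lemma fderiv_mapL_comp_right (A : Euc n →L[ℝ] Euc m) (Γ : Euc n →L[ℝ] Euc n) (x : Lam n) :
    fderiv ℝ mapL A (A ∘L Γ) x = map A (der Γ x) := by
  have h1 : HasFDerivAt (fun B : Euc n →L[ℝ] Euc n => mapL (A ∘L B) x)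
      (((ContinuousLinearMap.apply ℝ (Lam m) x).comp (fderiv ℝ mapL A)).comp
        (ContinuousLinearMap.compL ℝ (Euc n) (Euc n) (Euc m) A))
      (ContinuousLinearMap.id ℝ (Euc n)) := by
    have h0 : HasFDerivAt (fun B : Euc n →L[ℝ] Euc n => A ∘L B)
        (ContinuousLinearMap.compL ℝ (Euc n) (Euc n) (Euc m) A)
        (ContinuousLinearMap.id ℝ (Euc n)) :=
      (ContinuousLinearMap.compL ℝ (Euc n) (Euc n) (Euc m) A).hasFDerivAt
    exact (ContinuousLinearMap.apply ℝ (Lam m) x).hasFDerivAt.comp _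
      (HasFDerivAt.comp (g := mapL) _ (hasFDerivAt_mapL A) h0)
  have h2 : HasFDerivAt (fun B : Euc n →L[ℝ] Euc n => mapL (A ∘L B) x)
      ((mapL A).comp ((ContinuousLinearMap.apply ℝ (Lam n) x).comp der))
      (ContinuousLinearMap.id ℝ (Euc n)) := by
    simp only [mapL_comp]
    exact (mapL A).hasFDerivAt.comp _
      ((ContinuousLinearMap.apply ℝ (Lam n) x).hasFDerivAt.comp _ (hasFDerivAt_mapL _))
  exact congrArg (fun T : (Euc n →L[ℝ] Euc n) →L[ℝ] Lam m => T Γ) (h1.unique h2)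

lemma hasFDerivAt_mapL_id_apply (x : Lam n) :
    HasFDerivAt (fun B : Euc n →L[ℝ] Euc n => map B x)
      ((ContinuousLinearMap.apply ℝ (Lam n) x).comp der) (ContinuousLinearMap.id ℝ (Euc n)) :=
  (ContinuousLinearMap.apply ℝ (Lam n) x).hasFDerivAt.comp _ (hasFDerivAt_mapL _)

lemma der_one (Γ : Euc n →L[ℝ] Euc n) : der Γ 1 = 0 := by
  have h := hasFDerivAt_mapL_id_apply (1 : Lam n)
  simp only [map_one] at h
  exact congrArg (fun T : (Euc n →L[ℝ] Euc n) →L[ℝ] Lam n => T Γ)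
    (h.unique (hasFDerivAt_const _ _))

lemma der_smul (Γ : Euc n →L[ℝ] Euc n) (c : ℂ) (x : Lam n) : der Γ (c • x) = c • der Γ x := by
  have h := hasFDerivAt_mapL_id_apply (c • x)
  simp only [map_smul] at h
  exact congrArg (fun T : (Euc n →L[ℝ] Euc n) →L[ℝ] Lam n => T Γ)
    (h.unique ((hasFDerivAt_mapL_id_apply x).const_smul c))

/-- `der Γ` is a derivation which extends `Γ`. -/
lemma der_ι_mul (Γ : Euc n →L[ℝ] Euc n) (v : Euc n) (x : Lam n) :
    der Γ (ι v * x) = ι (Γ v) * x + ι v * der Γ x := by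
  have h := hasFDerivAt_mapL_id_apply (ι v * x)
  simp only [map_mul, map_ι] at h
  have h1 : HasFDerivAt (fun B : Euc n →L[ℝ] Euc n => mulL (ι (B v)))
      (mulL.comp (ιL.comp (ContinuousLinearMap.apply ℝ (Euc n) v)))
      (ContinuousLinearMap.id ℝ (Euc n)) :=
    (mulL.comp (ιL.comp (ContinuousLinearMap.apply ℝ (Euc n) v))).hasFDerivAt
  have h2 := h1.clm_apply (hasFDerivAt_mapL_id_apply x)
  have := congrArg (fun T : (Euc n →L[ℝ] Euc n) →L[ℝ] Lam n => T Γ) (h.unique h2)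
  simp at this
  rw [this, add_comm]

lemma der_invol (Γ : Euc n →L[ℝ] Euc n) (x : Lam n) : der Γ (invol x) = invol (der Γ x) := by
  have h1 := fderiv_mapL_comp_left (-ContinuousLinearMap.id ℝ (Euc n)) Γ x
  have h2 := fderiv_mapL_comp_right (-ContinuousLinearMap.id ℝ (Euc n)) Γ x
  have e : Γ ∘L (-ContinuousLinearMap.id ℝ (Euc n)) = (-ContinuousLinearMap.id ℝ (Euc n)) ∘L Γ := by
    ext; simp
  rw [e, h2] at h1
  exact h1.symm

/-- The naturality of contractions, differentiated at the identity. -/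
lemma der_contr (Γ : Euc n →L[ℝ] Euc n) (d : Euc n →L[ℝ] ℝ) (x : Lam n) :
    der Γ (contr d x) = contr d (der Γ x) - contr (d ∘L Γ) x := by
  have h := (contrL d).hasFDerivAt.comp _ (hasFDerivAt_mapL_id_apply x)
  have h1 : HasFDerivAt (fun B : Euc n →L[ℝ] Euc n => (contrL (d ∘L B) x : Lam n))
      (((ContinuousLinearMap.apply ℝ (Lam n) x).comp contrL).comp
        (ContinuousLinearMap.compL ℝ (Euc n) (Euc n) ℝ d)) (ContinuousLinearMap.id ℝ (Euc n)) :=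
    (((ContinuousLinearMap.apply ℝ (Lam n) x).comp contrL).comp
        (ContinuousLinearMap.compL ℝ (Euc n) (Euc n) ℝ d)).hasFDerivAt
  have h2 := (hasFDerivAt_mapL (ContinuousLinearMap.id ℝ (Euc n))).clm_apply h1
  have e : (fun B : Euc n →L[ℝ] Euc n => mapL B (contrL (d ∘L B) x)) =
      (contrL d) ∘ fun B : Euc n →L[ℝ] Euc n => map B x :=
    funext fun B => (contr_map B d x).symm
  rw [e] at h2
  have := congrArg (fun T : (Euc n →L[ℝ] Euc n) →L[ℝ] Lam n => T Γ) (h.unique h2)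
  simp [der] at this
  rw [der, eq_sub_iff_add_eq, add_comm, this]

lemma hasDerivAt_quadratic {V : Type*} [NormedAddCommGroup V] [NormedSpace ℝ V] (a b c : V) :
    HasDerivAt (fun t : ℝ => a + t • b + t ^ 2 • c) b 0 := by
  have h2 : HasDerivAt (fun t : ℝ => t ^ 2) 0 0 := by simpa using hasDerivAt_pow 2 (0 : ℝ)
  simpa using! (((hasDerivAt_id (0 : ℝ)).smul_const b).const_add a).add (h2.smul_const c)

lemma quadratic_zero {V : Type*} [AddCommGroup V] [Module ℝ V] (a b c : V) :
    a + (0 : ℝ) • b + (0 : ℝ) ^ 2 • c = a := by simp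

/-- If `g'` is the derivative of the metric for which `Γ` is metric, the derivative of the Hermitian
form in the direction of `g'` is given by the derivation extending `Γ`. -/
lemma fderiv_hermL (g g' : Euc n →L[ℝ] Euc n →L[ℝ] ℝ) (Γ : Euc n →L[ℝ] Euc n)
    (h : ∀ v w, g' v w = g (Γ v) w + g v (Γ w)) (a b : Lam n) :
    fderiv ℝ hermL g g' a b = herm g (der Γ a) b + herm g a (der Γ b) := by
  set B : ℝ → Euc n →L[ℝ] Euc n :=
    fun t => ContinuousLinearMap.id ℝ (Euc n) + t • Γ + t ^ 2 • 0 with hB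
  set q : ℝ → Euc n →L[ℝ] Euc n →L[ℝ] ℝ := fun t => g + t • g' + t ^ 2 • g.bilinearComp Γ Γ with hq
  have key : ∀ t, herm (q t) a b = herm g (map (B t) a) (map (B t) b) := fun t => by
    refine (herm_map_map (q t) g (B t) (fun v w => ?_) a b).symm
    simp [hB, hq, h]
    ring
  have dB : HasDerivAt B Γ 0 := hasDerivAt_quadratic _ _ _
  have dq : HasDerivAt q g' 0 := hasDerivAt_quadratic _ _ _
  have q0 : q 0 = g := quadratic_zero g g' _
  have B0 : B 0 = ContinuousLinearMap.id ℝ (Euc n) := quadratic_zero _ _ _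
  have d1 : HasDerivAt (fun t => hermL (q t) a b) (fderiv ℝ hermL g g' a b) 0 := by
    have h1 : HasFDerivAt (hermL (n := n)) (fderiv ℝ hermL g) (q 0) := by
      rw [q0]; exact (contDiff_hermL.differentiable (by simp) g).hasFDerivAt
    have h2 : HasDerivAt (fun t => hermL (q t)) (fderiv ℝ hermL g g') 0 :=
      HasFDerivAt.comp_hasDerivAt (l := hermL (n := n)) (0 : ℝ) h1 dq
    have T : HasDerivAt (fun t => hermL (q t) a) (fderiv ℝ hermL g g' a) 0 := by
      simpa using h2.clm_apply (hasDerivAt_const (0 : ℝ) a)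
    simpa using T.clm_apply (hasDerivAt_const (0 : ℝ) b)
  have dm : ∀ x : Lam n, HasDerivAt (fun t => map (B t) x) (der Γ x) 0 := fun x => by
    have h1 := hasFDerivAt_mapL_id_apply x
    rw [← B0] at h1
    exact h1.comp_hasDerivAt (0 : ℝ) dB
  have d2 : HasDerivAt (fun t => hermL g (map (B t) a) (map (B t) b))
      (herm g (der Γ a) b + herm g a (der Γ b)) 0 := by
    simpa [B0] using ((hermL g).hasFDerivAt.comp_hasDerivAt (0 : ℝ) (dm a)).clm_apply (dm b)
  have e : (fun t => hermL (q t) a b) = fun t => hermL g (map (B t) a) (map (B t) b) :=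
    funext key
  rw [e] at d1
  exact d1.unique d2

end Lam

/-! ### Functions on a manifold with values in a normed space -/

namespace RMfd

variable (M : RMfd) {F F₁ F₂ F₃ : Type*} [NormedAddCommGroup F] [NormedSpace ℝ F]
  [NormedAddCommGroup F₁] [NormedSpace ℝ F₁] [NormedAddCommGroup F₂] [NormedSpace ℝ F₂]
  [NormedAddCommGroup F₃] [NormedSpace ℝ F₃]

/-- The differential of a vector valued function; a tangent vector at `x` is a vector
of `Euc M.dim`, namely of its coordinates in the preferred chart at `x`. -/
noncomputable def d (f : M → F) (x : M) : Euc M.dim →L[ℝ] F := mvfderiv M.I f x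

variable {M} {x : M}

/-- `f` has the differential `f'` at `x`, expressed in the preferred chart at `x`. -/
def HasD (f : M → F) (f' : Euc M.dim →L[ℝ] F) (x : M) : Prop :=
  ContinuousAt f x ∧ HasFDerivAt (f ∘ (extChartAt M.I x).symm) f' (extChartAt M.I x x)

lemma hasD_d {f : M → F} (hf : MDifferentiableAt M.I 𝓘(ℝ, F) f x) : HasD f (M.d f x) x := by
  have h := hf.hasMFDerivAt
  refine ⟨h.1, ?_⟩
  have h2 := h.2
  simp only [ModelWithCorners.Boundaryless.range_eq_univ] at h2
  exact hasFDerivWithinAt_univ.1 h2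

lemma HasD.mdiff {f : M → F} {f' : Euc M.dim →L[ℝ] F} (h : HasD f f' x) :
    MDifferentiableAt M.I 𝓘(ℝ, F) f x := by
  refine mdifferentiableAt_iff _ _ |>.2 ⟨h.1, ?_⟩
  exact h.2.differentiableAt.differentiableWithinAt

lemma HasD.d_eq {f : M → F} {f' : Euc M.dim →L[ℝ] F} (h : HasD f f' x) : M.d f x = f' :=
  (hasD_d h.mdiff).2.unique h.2

lemma d_congr {f h : M → F} (e : f =ᶠ[𝓝 x] h) : M.d f x = M.d h x := by
  have := Filter.EventuallyEq.mfderiv_eq (I := M.I) (I' := 𝓘(ℝ, F)) e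
  exact this

lemma d_const (c : F) : M.d (fun _ => c) x = 0 :=
  HasD.d_eq ⟨continuousAt_const, hasFDerivAt_const _ _⟩

lemma d_add {f h : M → F} (hf : MDifferentiableAt M.I 𝓘(ℝ, F) f x)
    (hh : MDifferentiableAt M.I 𝓘(ℝ, F) h x) :
    M.d (fun y => f y + h y) x = M.d f x + M.d h x :=
  HasD.d_eq ⟨(hasD_d hf).1.add (hasD_d hh).1, (hasD_d hf).2.add (hasD_d hh).2⟩

lemma HasD.comp {f : M → F₁} {f' : Euc M.dim →L[ℝ] F₁} (hf : HasD f f' x) {Φ : F₁ → F}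
    {Φ' : F₁ →L[ℝ] F} (hΦ : HasFDerivAt Φ Φ' (f x)) : HasD (fun y => Φ (f y)) (Φ' ∘L f') x := by
  refine ⟨hΦ.continuousAt.comp hf.1, HasFDerivAt.comp _ ?_ hf.2⟩
  simpa using hΦ

lemma HasD.prodMk {f : M → F₁} {f' : Euc M.dim →L[ℝ] F₁} (hf : HasD f f' x) {h : M → F₂}
    {h' : Euc M.dim →L[ℝ] F₂} (hh : HasD h h' x) : HasD (fun y => (f y, h y)) (f'.prod h') x :=
  ⟨hf.1.prodMk hh.1, hf.2.prodMk hh.2⟩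

lemma HasD.bilin {f : M → F₁} {f' : Euc M.dim →L[ℝ] F₁} (hf : HasD f f' x) {h : M → F₂}
    {h' : Euc M.dim →L[ℝ] F₂} (hh : HasD h h' x) (B : F₁ →L[ℝ] F₂ →L[ℝ] F) :
    HasD (fun y => B (f y) (h y)) (B (f x) ∘L h' + (B.flip (h x)) ∘L f') x := by
  have hB := B.hasFDerivAt_of_bilinear (hasFDerivAt_fst (p := (f x, h x)))
    (hasFDerivAt_snd (p := (f x, h x)))
  have h0 := (hf.prodMk hh).comp hB
  refine ⟨h0.1, h0.2.congr_fderiv ?_⟩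
  ext u
  simp

lemma d_comp {f : M → F₁} (hf : MDifferentiableAt M.I 𝓘(ℝ, F₁) f x) {Φ : F₁ → F}
    {Φ' : F₁ →L[ℝ] F} (hΦ : HasFDerivAt Φ Φ' (f x)) (u : Euc M.dim) :
    M.d (fun y => Φ (f y)) x u = Φ' (M.d f x u) := by
  rw [((hasD_d hf).comp hΦ).d_eq]
  rfl

lemma d_bilin {f : M → F₁} {h : M → F₂} (hf : MDifferentiableAt M.I 𝓘(ℝ, F₁) f x)
    (hh : MDifferentiableAt M.I 𝓘(ℝ, F₂) h x) (B : F₁ →L[ℝ] F₂ →L[ℝ] F) (u : Euc M.dim) :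
    M.d (fun y => B (f y) (h y)) x u = B (M.d f x u) (h x) + B (f x) (M.d h x u) := by
  rw [((hasD_d hf).bilin (hasD_d hh) B).d_eq, add_comm]
  rfl

lemma mdiff_comp {f : M → F₁} (hf : MDifferentiableAt M.I 𝓘(ℝ, F₁) f x) {Φ : F₁ → F}
    (hΦ : DifferentiableAt ℝ Φ (f x)) : MDifferentiableAt M.I 𝓘(ℝ, F) (fun y => Φ (f y)) x :=
  ((hasD_d hf).comp hΦ.hasFDerivAt).mdiff

lemma mdiff_bilin {f : M → F₁} {h : M → F₂} (hf : MDifferentiableAt M.I 𝓘(ℝ, F₁) f x)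
    (hh : MDifferentiableAt M.I 𝓘(ℝ, F₂) h x) (B : F₁ →L[ℝ] F₂ →L[ℝ] F) :
    MDifferentiableAt M.I 𝓘(ℝ, F) (fun y => B (f y) (h y)) x :=
  ((hasD_d hf).bilin (hasD_d hh) B).mdiff

lemma d_clm_apply {A : M → F₁ →L[ℝ] F} {h : M → F₁}
    (hA : MDifferentiableAt M.I 𝓘(ℝ, F₁ →L[ℝ] F) A x)
    (hh : MDifferentiableAt M.I 𝓘(ℝ, F₁) h x) (u : Euc M.dim) :
    M.d (fun y => A y (h y)) x u = M.d A x u (h x) + A x (M.d h x u) :=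
  d_bilin hA hh (ContinuousLinearMap.id ℝ (F₁ →L[ℝ] F)) u

lemma mdiff_clm_apply {A : M → F₁ →L[ℝ] F} {h : M → F₁}
    (hA : MDifferentiableAt M.I 𝓘(ℝ, F₁ →L[ℝ] F) A x)
    (hh : MDifferentiableAt M.I 𝓘(ℝ, F₁) h x) :
    MDifferentiableAt M.I 𝓘(ℝ, F) (fun y => A y (h y)) x :=
  mdiff_bilin hA hh (ContinuousLinearMap.id ℝ (F₁ →L[ℝ] F))

/-- The velocity in direction `u` of a map from a normed space to a manifold. -/
noncomputable def vel {P : Type*} [NormedAddCommGroup P] [NormedSpace ℝ P] (p : P → M) (t : P) :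
    P →L[ℝ] Euc M.dim := (mfderiv 𝓘(ℝ, P) M.I p t : TangentSpace 𝓘(ℝ, P) t →L[ℝ] M.T (p t))

lemma fderiv_comp_vel {P : Type*} [NormedAddCommGroup P] [NormedSpace ℝ P] {p : P → M} {t : P}
    {f : M → F} (hf : MDifferentiableAt M.I 𝓘(ℝ, F) f (p t))
    (hp : MDifferentiableAt 𝓘(ℝ, P) M.I p t) (u : P) :
    fderiv ℝ (fun s => f (p s)) t u = M.d f (p t) (vel p t u) := by
  have h := mfderiv_comp (I'' := 𝓘(ℝ, F)) t hf hp
  rw [mfderiv_eq_fderiv] at h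
  exact congrArg (fun T : P →L[ℝ] F => T u) h

end RMfd

section Smooth

variable {EQ HQ Q : Type*} [NormedAddCommGroup EQ] [NormedSpace ℝ EQ] [TopologicalSpace HQ]
  {J : ModelWithCorners ℝ EQ HQ} [TopologicalSpace Q] [ChartedSpace HQ Q] {q : Q}
  {V W : Type*} [NormedAddCommGroup V] [NormedSpace ℝ V] [FiniteDimensional ℝ V]
  [NormedAddCommGroup W] [NormedSpace ℝ W] {k : ℕ∞ω}

/-- A family of linear maps on a finite dimensional space is smooth if its values are. -/
lemma contMDiffAt_clm_of_apply {A : Q → V →L[ℝ] W}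
    (h : ∀ v, ContMDiffAt J 𝓘(ℝ, W) k (fun y => A y v) q) :
    ContMDiffAt J 𝓘(ℝ, V →L[ℝ] W) k A q := by
  let b := Module.finBasis ℝ V
  have e : A = fun y => ∑ i, ContinuousLinearMap.smulRightL ℝ V W
      (b.coord i).toContinuousLinearMap (A y (b i)) := by
    funext y
    ext v
    conv_lhs => rw [← b.sum_repr v, map_sum]
    simp
  rw [e]
  refine contMDiffAt_finsetSum fun i _ => ?_
  exact (ContinuousLinearMap.contMDiff _).contMDiffAt.comp q (h (b i))

end Smooth

/-! ### Tangent vectors in coordinates -/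

namespace RMfd

variable {M : RMfd}

/-- The domain of the preferred chart at `x₀`. -/
def src (x₀ : M) : Set M := (chartAt (Euc M.dim) x₀).source

/-- The components in the preferred chart at `x₀` of tangent vectors at `y`. -/
noncomputable def co (x₀ y : M) : Euc M.dim →L[ℝ] Euc M.dim := tangentCoordChange M.I y x₀ y

/-- The tangent vector at `y` with given components in the preferred chart at `x₀`. -/
noncomputable def oc (x₀ y : M) : Euc M.dim →L[ℝ] Euc M.dim := tangentCoordChange M.I x₀ y y

lemma mem_src (x₀ : M) : x₀ ∈ src x₀ := mem_chart_source _ x₀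

lemma isOpen_src (x₀ : M) : IsOpen (src x₀) := (chartAt (Euc M.dim) x₀).open_source

lemma src_mem_nhds {x₀ y : M} (h : y ∈ src x₀) : src x₀ ∈ 𝓝 y := (isOpen_src x₀).mem_nhds h

lemma co_oc_apply {x₀ y : M} (h : y ∈ src x₀) (v : Euc M.dim) : co x₀ y (oc x₀ y v) = v := by
  have hx : y ∈ (extChartAt M.I x₀).source := by rwa [extChartAt_source]
  exact (tangentCoordChange_comp ⟨⟨hx, mem_extChartAt_source y⟩, hx⟩).trans
    (tangentCoordChange_self hx)

lemma oc_co_apply {x₀ y : M} (h : y ∈ src x₀) (v : Euc M.dim) : oc x₀ y (co x₀ y v) = v := by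
  have hx : y ∈ (extChartAt M.I x₀).source := by rwa [extChartAt_source]
  exact (tangentCoordChange_comp ⟨⟨mem_extChartAt_source y, hx⟩, mem_extChartAt_source y⟩).trans
    (tangentCoordChange_self (mem_extChartAt_source y))

lemma co_oc {x₀ y : M} (h : y ∈ src x₀) : co x₀ y ∘L oc x₀ y = ContinuousLinearMap.id ℝ _ :=
  ContinuousLinearMap.ext (co_oc_apply h)

lemma oc_co {x₀ y : M} (h : y ∈ src x₀) : oc x₀ y ∘L co x₀ y = ContinuousLinearMap.id ℝ _ :=
  ContinuousLinearMap.ext (oc_co_apply h)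

@[simp] lemma co_self (x : M) : co x x = ContinuousLinearMap.id ℝ _ :=
  ContinuousLinearMap.ext fun _ => tangentCoordChange_self (mem_extChartAt_source x)

@[simp] lemma oc_self (x : M) : oc x x = ContinuousLinearMap.id ℝ _ :=
  ContinuousLinearMap.ext fun _ => tangentCoordChange_self (mem_extChartAt_source x)

lemma trivializationAt_symm {x₀ y : M} (h : y ∈ src x₀) (v : Euc M.dim) :
    (trivializationAt (Euc M.dim) (TangentSpace M.I : M → Type) x₀).symm y v = oc x₀ y v := by
  have hb : y ∈ (trivializationAt (Euc M.dim) (TangentSpace M.I : M → Type) x₀).baseSet := h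
  have h1 := (trivializationAt (Euc M.dim) (TangentSpace M.I : M → Type) x₀).apply_mk_symm hb v
  have h2 :
      co x₀ y ((trivializationAt (Euc M.dim) (TangentSpace M.I : M → Type) x₀).symm y v) = v :=
    congrArg Prod.snd h1
  have h3 := congrArg (oc x₀ y) h2
  exact (oc_co_apply h _).symm.trans h3

/-- The differential of the extended chart at `x₀` is the map to components. -/
lemma mfderiv_extChartAt {x₀ y : M} (h : y ∈ src x₀) :
    (mfderiv M.I 𝓘(ℝ, Euc M.dim) (extChartAt M.I x₀) y : M.T y →L[ℝ] _) = co x₀ y :=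
  (TangentBundle.continuousLinearMapAt_trivializationAt h).symm.trans
    (TangentBundle.continuousLinearMapAt_trivializationAt_eq_core h)

section

variable {EQ HQ Q : Type*} [NormedAddCommGroup EQ] [NormedSpace ℝ EQ] [TopologicalSpace HQ]
  {J : ModelWithCorners ℝ EQ HQ} [TopologicalSpace Q] [ChartedSpace HQ Q] {q : Q} {k : ℕ∞ω}

lemma contMDiffAt_tangent_iff {a : Q → TangentBundle M.I M} :
    ContMDiffAt J M.I.tangent ∞ a q ↔ ContMDiffAt J M.I ∞ (fun t => (a t).proj) q ∧
      ContMDiffAt J 𝓘(ℝ, Euc M.dim) ∞ (fun t => co (a q).proj (a t).proj (a t).2) q :=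
  contMDiffAt_totalSpace

/-- A vector field along a map is smooth if its components are. -/
lemma contMDiffAt_tangent_iff_of_mem {a : Q → TangentBundle M.I M} {x₀ : M}
    (h : (a q).proj ∈ src x₀) :
    ContMDiffAt J M.I.tangent ∞ a q ↔ ContMDiffAt J M.I ∞ (fun t => (a t).proj) q ∧
      ContMDiffAt J 𝓘(ℝ, Euc M.dim) ∞ (fun t => co x₀ (a t).proj (a t).2) q :=
  (trivializationAt (Euc M.dim) (TangentSpace M.I : M → Type) x₀).contMDiffAt_iff
    ((trivializationAt (Euc M.dim) (TangentSpace M.I : M → Type) x₀).mem_source.2 h)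

end

lemma mdiffAt_vf_iff {X : M → Euc M.dim} {x : M} :
    MDifferentiableAt M.I M.I.tangent (fun y => (⟨y, X y⟩ : TangentBundle M.I M)) x ↔
      MDifferentiableAt M.I 𝓘(ℝ, Euc M.dim) (fun y => co x y (X y)) x :=
  mdifferentiableAt_section (IB := M.I) (E := (TangentSpace M.I : M → Type)) (𝕜 := ℝ) X

/-- The vector fields with constant components. -/
lemma contMDiffAt_oc {x₀ y : M} (h : y ∈ src x₀) (v : Euc M.dim) :
    ContMDiffAt M.I M.I.tangent ∞ (fun z => (⟨z, oc x₀ z v⟩ : TangentBundle M.I M)) y := by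
  refine (contMDiffAt_tangent_iff_of_mem h).2 ⟨contMDiffAt_id, ?_⟩
  refine (contMDiffAt_const (c := v)).congr_of_eventuallyEq ?_
  filter_upwards [src_mem_nhds h] with z hz using co_oc_apply hz v

/-- The constant vector field on Euclidean space. -/
noncomputable def constVF {n : ℕ} (v : Euc n) : Π z : Euc n, TangentSpace 𝓘(ℝ, Euc n) z :=
  fun _ => v

lemma mdiffAt_constVF {n : ℕ} (v z : Euc n) :
    MDifferentiableAt 𝓘(ℝ, Euc n) 𝓘(ℝ, Euc n).tangent
      (fun z => (⟨z, constVF v z⟩ : TangentBundle 𝓘(ℝ, Euc n) (Euc n))) z :=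
  (contMDiffAt_vectorSpace_iff_contDiffAt (V := constVF v) (n := 1) |>.2
    contDiffAt_const).mdifferentiableAt one_ne_zero

lemma mlieBracket_constVF {n : ℕ} (v w : Euc n) :
    VectorField.mlieBracket 𝓘(ℝ, Euc n) (constVF v) (constVF w) = 0 := by
  rw [← VectorField.mlieBracketWithin_univ, VectorField.mlieBracketWithin_eq_lieBracketWithin]
  funext z
  have h : VectorField.lieBracket ℝ (fun _ : Euc n => v) (fun _ => w) z = 0 := by
    simp [VectorField.lieBracket]
  exact (congrFun VectorField.lieBracketWithin_univ z).trans h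

/-- The vector field with constant components `v` in the chart at `x₀`. -/
noncomputable def ocVF (x₀ : M) (v : Euc M.dim) : Π z : M, M.T z := fun z => oc x₀ z v

/-- Vector fields with constant components commute, since they are related by a chart
to constant vector fields. -/
lemma mlieBracket_oc {x₀ y : M} (h : y ∈ src x₀) (v w : Euc M.dim) :
    VectorField.mlieBracket M.I (ocVF x₀ v) (ocVF x₀ w) y = 0 := by
  have key : ∀ v : Euc M.dim, ocVF x₀ v =ᶠ[𝓝 y]
      VectorField.mpullback M.I 𝓘(ℝ, Euc M.dim) (extChartAt M.I x₀) (constVF v) := by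
    intro v
    filter_upwards [src_mem_nhds h] with z hz
    refine Eq.trans ?_ (congrArg (fun T : Euc M.dim →L[ℝ] Euc M.dim => T.inverse v)
      (mfderiv_extChartAt hz)).symm
    have : (co x₀ z).inverse = oc x₀ z :=
      ContinuousLinearMap.inverse_eq (co_oc hz) (oc_co hz)
    exact (congrArg (fun T : Euc M.dim →L[ℝ] Euc M.dim => T v) this).symm
  rw [Filter.EventuallyEq.mlieBracket_vectorField_eq (key v) (key w)]
  have : IsManifold M.I (minSmoothness ℝ 2) M := by
    rw [minSmoothness_of_isRCLikeNormedField]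
    exact IsManifold.of_le (n := ∞) (by exact ENat.LEInfty.out)
  refine (VectorField.mpullback_mlieBracket (n := ∞) (mdiffAt_constVF v _) (mdiffAt_constVF w _)
    (contMDiffAt_extChartAt' h)
    (by rw [minSmoothness_of_isRCLikeNormedField]; exact ENat.LEInfty.out)).symm.trans ?_
  rw [mlieBracket_constVF, VectorField.mpullback_zero]
  rfl

end RMfd

/-! ### Differentials of smooth maps -/

namespace RMfd

variable {M N : RMfd}

/-- The differential of a smooth map as a linear map between Euclidean spaces. -/
noncomputable def dE (f : M ⟶ N) (x : M) : Euc M.dim →L[ℝ] Euc N.dim := differential f x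

/-- The differential of a smooth map in components is smooth. -/
lemma contMDiffAt_dE (f : M ⟶ N) (x₀ : M) :
    ContMDiffAt M.I 𝓘(ℝ, Euc M.dim →L[ℝ] Euc N.dim) ∞
      (fun y => co (f x₀) (f y) ∘L dE f y ∘L oc x₀ y) x₀ := by
  have h := ContMDiffAt.mfderiv_const (m := ∞) (n := ∞) (f.smooth x₀) (by simp)
  refine h.congr_of_eventuallyEq ?_
  have hc : ∀ᶠ y in 𝓝 x₀, f y ∈ src (f x₀) :=
    (f.smooth x₀).continuousAt.eventually (src_mem_nhds (mem_src (f x₀)))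
  filter_upwards [src_mem_nhds (mem_src x₀), hc] with y hy hfy
  exact (inTangentCoordinates_eq (I := M.I) (I' := N.I) id f.toFun
    (fun x => dE f x) hy hfy).symm

section

variable {F : Type*} [NormedAddCommGroup F] [NormedSpace ℝ F]

/-- The differential of a smooth vector valued function in components is smooth. -/
lemma contMDiffAt_d {f : M → F} {x₀ : M} (hf : ContMDiffAt M.I 𝓘(ℝ, F) ∞ f x₀) :
    ContMDiffAt M.I 𝓘(ℝ, Euc M.dim →L[ℝ] F) ∞ (fun y => M.d f y ∘L oc x₀ y) x₀ := by
  have h := ContMDiffAt.mfderiv_const (m := ∞) (n := ∞) hf (by simp)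
  refine h.congr_of_eventuallyEq ?_
  filter_upwards [src_mem_nhds (mem_src x₀)] with y hy
  refine ((inTangentCoordinates_eq (I := M.I) (I' := 𝓘(ℝ, F)) id f
    (fun x => M.d f x) (x₀ := x₀) (x := y) hy (Set.mem_univ _)).trans ?_).symm
  ext u
  have := congrArg (fun T : F →L[ℝ] F => T (M.d f y (oc x₀ y u)))
    (tangentBundleCore_coordChange_model_space (𝕜 := ℝ) (I := 𝓘(ℝ, F)) (f y) (f x₀) (f y))
  exact this

/-- A function which is smooth at a point is differentiable near this point. -/
lemma eventually_mdiff {f : M → F} {x₀ : M} (hf : ContMDiffAt M.I 𝓘(ℝ, F) ∞ f x₀) :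
    ∀ᶠ y in 𝓝 x₀, MDifferentiableAt M.I 𝓘(ℝ, F) f y := by
  have h1 : ContMDiffAt M.I 𝓘(ℝ, F) 1 f x₀ := hf.of_le (by exact ENat.LEInfty.out)
  filter_upwards [(contMDiffAt_iff_contMDiffAt_nhds (by simp)).1 h1] with y hy
  exact hy.mdifferentiableAt one_ne_zero

end

/-! ### The metric in coordinates -/

/-- The metric at `y` in the coordinates of the chart at `x₀`. -/
noncomputable def gco (x₀ y : M) : Euc M.dim →L[ℝ] Euc M.dim →L[ℝ] ℝ :=
  (M.gE y).bilinearComp (oc x₀ y) (oc x₀ y)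

lemma gco_apply (x₀ y : M) (v w : Euc M.dim) :
    gco x₀ y v w = M.gE y (oc x₀ y v) (oc x₀ y w) := rfl

lemma gco_co {x₀ y : M} (h : y ∈ src x₀) (v w : Euc M.dim) :
    gco x₀ y (co x₀ y v) (co x₀ y w) = M.gE y v w := by
  rw [gco_apply, oc_co_apply h, oc_co_apply h]

lemma contMDiffAt_gco (x₀ : M) :
    ContMDiffAt M.I 𝓘(ℝ, Euc M.dim →L[ℝ] Euc M.dim →L[ℝ] ℝ) ∞ (gco x₀) x₀ := by
  refine contMDiffAt_clm_of_apply fun v => contMDiffAt_clm_of_apply fun w => ?_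
  have h := ContMDiffAt.clm_bundle_apply₂ (F₁ := Euc M.dim) (F₂ := Euc M.dim) (F₃ := ℝ)
    (E₁ := (TangentSpace M.I : M → Type)) (E₂ := (TangentSpace M.I : M → Type))
    (E₃ := Bundle.Trivial M ℝ) (b := fun y => y) (M.metric.contMDiff x₀)
    (contMDiffAt_oc (mem_src x₀) v) (contMDiffAt_oc (mem_src x₀) w)
  exact (contMDiffAt_totalSpace.1 h).2

lemma gE_injective (x : M) : Function.Injective (M.gE x) := by
  refine (injective_iff_map_eq_zero _).2 fun v hv => ?_
  by_contra h
  have := M.gE_pos x v h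
  rw [hv] at this
  exact lt_irrefl _ this

end RMfd

/-! ### The Christoffel symbols -/

section Christoffel

variable {n : ℕ}

/-- A positive definite form is an isomorphism to the dual space. -/
lemma isInvertible_of_pos {g : Euc n →L[ℝ] Euc n →L[ℝ] ℝ} (hg : ∀ v, v ≠ 0 → 0 < g v v) :
    g.IsInvertible := by
  have hi : Function.Injective g := by
    refine (injective_iff_map_eq_zero _).2 fun v hv => ?_
    by_contra h
    have := hg v h
    rw [hv] at this
    exact lt_irrefl _ this
  have hd : Module.finrank ℝ (Euc n) = Module.finrank ℝ (Euc n →L[ℝ] ℝ) := by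
    rw [(LinearMap.toContinuousLinearMap (𝕜 := ℝ) (E := Euc n) (F' := ℝ)).finrank_eq.symm]
    exact (Subspace.dual_finrank_eq (K := ℝ) (V := Euc n)).symm
  let e := LinearEquiv.ofInjectiveOfFinrankEq (g : Euc n →ₗ[ℝ] (Euc n →L[ℝ] ℝ)) hi hd
  exact ⟨e.toContinuousLinearEquiv, rfl⟩

/-- The Koszul functional: half of `∂_u g(v, ·) + ∂_v g(u, ·) - ∂_(·) g(u, v)`, where `G` is the
derivative of the components of the metric. -/
noncomputable def koszul (G : Euc n →L[ℝ] Euc n →L[ℝ] Euc n →L[ℝ] ℝ) (v u : Euc n) :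
    Euc n →L[ℝ] ℝ :=
  (1 / 2 : ℝ) • (G u v + G v u - (G.flip u).flip v)

lemma koszul_apply (G : Euc n →L[ℝ] Euc n →L[ℝ] Euc n →L[ℝ] ℝ) (v u w : Euc n) :
    koszul G v u w = (G u v w + G v u w - G w u v) / 2 := by
  simp only [koszul, _root_.smul_apply, _root_.sub_apply, _root_.add_apply,
    ContinuousLinearMap.flip_apply, smul_eq_mul]
  ring

/-- The Christoffel symbols, as a bilinear map; the second argument is the direction. -/
noncomputable def christoffel (g : Euc n →L[ℝ] Euc n →L[ℝ] ℝ)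
    (G : Euc n →L[ℝ] Euc n →L[ℝ] Euc n →L[ℝ] ℝ) : Euc n →L[ℝ] Euc n →L[ℝ] Euc n :=
  (LinearMap.mk₂ ℝ (fun v u => g.inverse (koszul G v u))
    (fun v v' u => by rw [← map_add]; congr 1; ext w; simp [koszul_apply]; ring)
    (fun c v u => by rw [← map_smul]; congr 1; ext w; simp [koszul_apply]; ring)
    (fun v u u' => by rw [← map_add]; congr 1; ext w; simp [koszul_apply]; ring)
    (fun c v u => by rw [← map_smul]; congr 1; ext w; simp [koszul_apply]; ring)
    ).toContinuousBilinearMap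

/-- The equation which determines the Christoffel symbols. -/
lemma apply_christoffel {g : Euc n →L[ℝ] Euc n →L[ℝ] ℝ} (hg : ∀ v, v ≠ 0 → 0 < g v v)
    (G : Euc n →L[ℝ] Euc n →L[ℝ] Euc n →L[ℝ] ℝ) (v u w : Euc n) :
    g (christoffel g G v u) w = (G u v w + G v u w - G w u v) / 2 := by
  rw [← koszul_apply]
  obtain ⟨e, rfl⟩ := isInvertible_of_pos hg
  change e ((e : Euc n →L[ℝ] Euc n →L[ℝ] ℝ).inverse (koszul G v u)) w = _
  rw [ContinuousLinearMap.inverse_equiv]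
  exact congrArg (fun T : Euc n →L[ℝ] ℝ => T w) (e.apply_symm_apply _)

end Christoffel

namespace RMfd

variable {M : RMfd}

lemma gco_pos {x₀ y : M} (h : y ∈ src x₀) (v : Euc M.dim) (hv : v ≠ 0) : 0 < gco x₀ y v v := by
  refine M.gE_pos y _ fun h0 => hv ?_
  exact (co_oc_apply h v).symm.trans ((congrArg (co x₀ y) h0).trans (map_zero _))

lemma gco_self (x : M) : gco x x = M.gE x := by
  ext v w
  simp [gco_apply]

lemma gco_symm (x₀ y : M) (v w : Euc M.dim) : gco x₀ y v w = gco x₀ y w v := M.gE_symm _ _ _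

/-- The metric paired with two differentiable vector fields is differentiable, and obeys the
product rule in components. -/
lemma d_metric {X Y : M → Euc M.dim} {x : M}
    (hX : MDifferentiableAt M.I 𝓘(ℝ, Euc M.dim) (fun y => co x y (X y)) x)
    (hY : MDifferentiableAt M.I 𝓘(ℝ, Euc M.dim) (fun y => co x y (Y y)) x) (u : Euc M.dim) :
    M.d (fun y => M.gE y (X y) (Y y)) x u = M.d (gco x) x u (X x) (Y x) +
      M.gE x (M.d (fun y => co x y (X y)) x u) (Y x) +
      M.gE x (X x) (M.d (fun y => co x y (Y y)) x u) := by
  have hg := (contMDiffAt_gco x).mdifferentiableAt (by simp)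
  have e : (fun y => M.gE y (X y) (Y y)) =ᶠ[𝓝 x]
      fun y => gco x y (co x y (X y)) (co x y (Y y)) := by
    filter_upwards [src_mem_nhds (mem_src x)] with y hy using (gco_co hy _ _).symm
  rw [d_congr e, d_clm_apply (mdiff_clm_apply hg hX) hY, d_clm_apply hg hX]
  simp [gco_self]

/-- A vector field is differentiable at `x`. -/
def MDiffVF (X : M → Euc M.dim) (x : M) : Prop :=
  MDifferentiableAt M.I M.I.tangent (fun y => (⟨y, X y⟩ : TangentBundle M.I M)) x

lemma MDiffVF.co {X : M → Euc M.dim} {x : M} (h : MDiffVF X x) :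
    MDifferentiableAt M.I 𝓘(ℝ, Euc M.dim) (fun y => co x y (X y)) x := mdiffAt_vf_iff.1 h

lemma mdiffVF_oc {x₀ y : M} (h : y ∈ src x₀) (v : Euc M.dim) : MDiffVF (fun z => oc x₀ z v) y :=
  (contMDiffAt_oc h v).mdifferentiableAt (by simp)

/-- The explicit Levi-Civita connection, given at each point by the Christoffel symbols of the
preferred chart at this point. -/
noncomputable def lcE (M : RMfd) (X : M → Euc M.dim) (x : M) : Euc M.dim →L[ℝ] Euc M.dim :=
  M.d (fun y => co x y (X y)) x + christoffel (M.gE x) (M.d (gco x) x) (X x)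

lemma lcE_add {X X' : M → Euc M.dim} {x : M} (hX : MDiffVF X x) (hX' : MDiffVF X' x) :
    lcE M (fun y => X y + X' y) x = lcE M X x + lcE M X' x := by
  have h := d_add hX.co hX'.co
  simp only [lcE, map_add]
  rw [h]
  abel

lemma lcE_smul {X : M → Euc M.dim} {f : M → ℝ} {x : M} (hX : MDiffVF X x)
    (hf : MDifferentiableAt M.I 𝓘(ℝ, ℝ) f x) :
    lcE M (fun y => f y • X y) x = f x • lcE M X x + (M.d f x).smulRight (X x) := by
  ext1 u
  have h := d_bilin hf hX.co (ContinuousLinearMap.lsmul ℝ ℝ) u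
  simp only [ContinuousLinearMap.lsmul_apply, co_self, ContinuousLinearMap.id_apply] at h
  simp only [lcE, map_smul, _root_.add_apply, _root_.smul_apply, h, smul_add,
    ContinuousLinearMap.smulRight_apply]
  abel

lemma lcE_oc (x : M) (v : Euc M.dim) :
    lcE M (fun y => oc x y v) x = christoffel (M.gE x) (M.d (gco x) x) v := by
  have c : M.d (fun y => co x y (oc x y v)) x = 0 := by
    rw [← d_const (M := M) (x := x) v]
    refine d_congr ?_
    filter_upwards [src_mem_nhds (mem_src x)] with y hy using co_oc_apply hy v
  rw [lcE, c]
  simp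

lemma d_gco_symm (x : M) (w u v : Euc M.dim) :
    M.d (gco x) x w u v = M.d (gco x) x w v u := by
  have hg := (contMDiffAt_gco x).mdifferentiableAt (by simp : (∞ : ℕ∞ω) ≠ 0)
  have key : ∀ a b : Euc M.dim, M.d (fun y => gco x y a b) x w = M.d (gco x) x w a b := by
    intro a b
    have ha : MDifferentiableAt M.I 𝓘(ℝ, Euc M.dim) (fun _ : M => a) x := mdifferentiableAt_const
    have hb : MDifferentiableAt M.I 𝓘(ℝ, Euc M.dim) (fun _ : M => b) x := mdifferentiableAt_const
    rw [d_clm_apply (mdiff_clm_apply hg ha) hb, d_clm_apply hg ha]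
    simp [d_const]
  rw [← key, ← key]
  simp only [gco_symm x _ u v]

/-- The Christoffel symbols are symmetric. -/
lemma christoffel_symm (x : M) (u v : Euc M.dim) :
    christoffel (M.gE x) (M.d (gco x) x) v u = christoffel (M.gE x) (M.d (gco x) x) u v := by
  refine gE_injective x (ContinuousLinearMap.ext fun w => ?_)
  rw [apply_christoffel (M.gE_pos x), apply_christoffel (M.gE_pos x), d_gco_symm x w u v]
  ring

/-- The explicit connection is metric. -/
lemma lcE_metric {X Y : M → Euc M.dim} {x : M} (hX : MDiffVF X x) (hY : MDiffVF Y x)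
    (u : Euc M.dim) : M.d (fun y => M.gE y (X y) (Y y)) x u =
      M.gE x (lcE M X x u) (Y x) + M.gE x (X x) (lcE M Y x u) := by
  rw [d_metric hX.co hY.co]
  simp only [lcE, _root_.add_apply, map_add]
  rw [M.gE_symm x (X x) (christoffel _ _ _ _), apply_christoffel (M.gE_pos x),
    apply_christoffel (M.gE_pos x)]
  rw [d_gco_symm x u (X x) (Y x)]
  ring

/-- The explicit Levi-Civita connection as a covariant derivative. -/
noncomputable def lc (M : RMfd) :
    CovariantDerivative M.I (Euc M.dim) (TangentSpace M.I : M → Type) where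
  toFun X x := lcE M X x
  isCovariantDerivativeOnUniv :=
    { add := fun hX hX' _ => lcE_add hX hX'
      leibniz := fun hX hf _ => lcE_smul hX hf }

/-- The torsion of a connection in a chart. -/
lemma torsion_oc (D : CovariantDerivative M.I (Euc M.dim) (TangentSpace M.I : M → Type))
    {x₀ y : M} (h : y ∈ src x₀) (u v : Euc M.dim) :
    (D.torsion y (oc x₀ y u) (oc x₀ y v) : Euc M.dim) =
      (D (ocVF x₀ v) y (oc x₀ y u) : Euc M.dim) - (D (ocVF x₀ u) y (oc x₀ y v) : Euc M.dim) := by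
  refine (D.torsion_apply (X := ocVF x₀ u) (Y := ocVF x₀ v) (mdiffVF_oc h u)
    (mdiffVF_oc h v)).trans ?_
  rw [mlieBracket_oc h]
  exact sub_zero _

/-- Existence of the Levi-Civita connection. Metricity and the vanishing of the torsion are
pointwise conditions, so that each can be checked in the preferred chart of the point. -/
theorem isLeviCivita_lc (M : RMfd) : IsLeviCivita M (lc M) := by
  refine ⟨?_, fun X Y x hX hY u => lcE_metric hX hY u⟩
  have key : ∀ (x : M) (u v : Euc M.dim), ((lc M).torsion x u v : Euc M.dim) = 0 := by
    intro x u v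
    have h := torsion_oc (lc M) (mem_src x) u v
    have h1 : lcE M (fun y => oc x y v) x u - lcE M (fun y => oc x y u) x v = 0 := by
      rw [lcE_oc, lcE_oc, christoffel_symm, sub_self]
    rw [oc_self] at h
    exact h.trans h1
  ext1 x
  exact ContinuousLinearMap.ext fun u => ContinuousLinearMap.ext fun v => key x u v

/-- The covariant derivative chosen in the definition of `leviCivita`. It need not agree with `lc`
on vector fields which are not differentiable. -/
noncomputable def LC (M : RMfd) :
    CovariantDerivative M.I (Euc M.dim) (TangentSpace M.I : M → Type) :=
  Classical.choose (⟨lc M, isLeviCivita_lc M⟩ : ∃ D, IsLeviCivita M D)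

lemma isLeviCivita_LC (M : RMfd) : IsLeviCivita M (LC M) :=
  Classical.choose_spec (⟨lc M, isLeviCivita_lc M⟩ : ∃ D, IsLeviCivita M D)

lemma leviCivita_eq (M : RMfd) : leviCivita M = (LC M).toFun :=
  dif_pos (⟨lc M, isLeviCivita_lc M⟩ : ∃ D, IsLeviCivita M D)

/-- The Levi-Civita connection `leviCivita`, on tangent vectors viewed as elements of `Euc M.dim`.
Since `leviCivita` is a choice, only the conditions of `IsLeviCivita` are available. -/
noncomputable def nabla (M : RMfd) (X : M → Euc M.dim) (x : M) : Euc M.dim →L[ℝ] Euc M.dim :=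
  leviCivita M X x

lemma nabla_eq (X : M → Euc M.dim) (x : M) : nabla M X x = LC M X x :=
  congrArg (fun D : (Π x : M, M.T x) → (Π x : M, M.T x →L[ℝ] M.T x) =>
    (D X x : Euc M.dim →L[ℝ] Euc M.dim)) (leviCivita_eq M)

lemma nabla_metric {X Y : M → Euc M.dim} {x : M} (hX : MDiffVF X x) (hY : MDiffVF Y x)
    (u : Euc M.dim) : M.d (fun y => M.gE y (X y) (Y y)) x u =
      M.gE x (nabla M X x u) (Y x) + M.gE x (X x) (nabla M Y x u) := by
  rw [nabla_eq, nabla_eq]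
  exact (isLeviCivita_LC M).2 X Y x hX hY u

lemma nabla_symm {x₀ y : M} (h : y ∈ src x₀) (u v : Euc M.dim) :
    nabla M (fun z => oc x₀ z v) y (oc x₀ y u) = nabla M (fun z => oc x₀ z u) y (oc x₀ y v) := by
  have h1 := torsion_oc (LC M) h u v
  rw [(isLeviCivita_LC M).1] at h1
  rw [nabla_eq, nabla_eq]
  exact (sub_eq_zero.1 h1.symm)

lemma nabla_congr {X X' : M → Euc M.dim} {x : M} (hX : MDiffVF X x) (hX' : MDiffVF X' x)
    (h : X =ᶠ[𝓝 x] X') : nabla M X x = nabla M X' x := by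
  rw [nabla_eq, nabla_eq]
  exact (LC M).isCovariantDerivativeOnUniv.congr_of_eventuallyEq hX hX' Filter.univ_mem h

/-- The Koszul formula in the chart at `x₀`. -/
lemma koszul_formula {x₀ y : M} (h : y ∈ src x₀)
    (hg : MDifferentiableAt M.I 𝓘(ℝ, Euc M.dim →L[ℝ] Euc M.dim →L[ℝ] ℝ) (gco x₀) y)
    (u v w : Euc M.dim) :
    M.gE y (nabla M (fun z => oc x₀ z v) y (oc x₀ y u)) (oc x₀ y w) =
      (M.d (gco x₀) y (oc x₀ y u) v w + M.d (gco x₀) y (oc x₀ y v) u w -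
        M.d (gco x₀) y (oc x₀ y w) u v) / 2 := by
  have key : ∀ a b c : Euc M.dim, M.d (gco x₀) y (oc x₀ y c) a b =
      M.gE y (nabla M (fun z => oc x₀ z a) y (oc x₀ y c)) (oc x₀ y b) +
      M.gE y (nabla M (fun z => oc x₀ z b) y (oc x₀ y c)) (oc x₀ y a) := by
    intro a b c
    have ha : MDifferentiableAt M.I 𝓘(ℝ, Euc M.dim) (fun _ : M => a) y := mdifferentiableAt_const
    have hb : MDifferentiableAt M.I 𝓘(ℝ, Euc M.dim) (fun _ : M => b) y := mdifferentiableAt_const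
    have h1 := nabla_metric (mdiffVF_oc h a) (mdiffVF_oc h b) (oc x₀ y c)
    rw [M.gE_symm y (oc x₀ y a)] at h1
    rw [← h1]
    change _ = M.d (fun z => gco x₀ z a b) y (oc x₀ y c)
    rw [d_clm_apply (mdiff_clm_apply hg ha) hb, d_clm_apply hg ha]
    simp [d_const]
  rw [key, key, key, nabla_symm h w v, nabla_symm h w u, nabla_symm h v u]
  ring

/-- The Christoffel symbols at `y` of the chart at `x₀`; the first argument is the direction. -/
noncomputable def Γco (x₀ y : M) : Euc M.dim →L[ℝ] Euc M.dim →L[ℝ] Euc M.dim :=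
  (christoffel (gco x₀ y) (M.d (gco x₀) y ∘L oc x₀ y)).flip

/-- The Koszul formula determines the connection on the vector fields with constant components. -/
lemma nabla_oc {x₀ y : M} (h : y ∈ src x₀)
    (hg : MDifferentiableAt M.I 𝓘(ℝ, Euc M.dim →L[ℝ] Euc M.dim →L[ℝ] ℝ) (gco x₀) y)
    (u v : Euc M.dim) :
    nabla M (fun z => oc x₀ z v) y (oc x₀ y u) = oc x₀ y (Γco x₀ y u v) := by
  have e : co x₀ y (nabla M (fun z => oc x₀ z v) y (oc x₀ y u)) = Γco x₀ y u v := by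
    have hi : Function.Injective (gco x₀ y) := (injective_iff_map_eq_zero _).2 fun a ha => by
      by_contra h0
      have h1 := gco_pos h a h0
      rw [ha] at h1
      exact lt_irrefl _ h1
    refine hi (ContinuousLinearMap.ext fun w => ?_)
    have h1 := apply_christoffel (gco_pos h) (M.d (gco x₀) y ∘L oc x₀ y) v u w
    rw [gco_apply, oc_co_apply h, koszul_formula h hg]
    exact h1.symm
  rw [← e, oc_co_apply h]

/-- The Christoffel symbols at `x` of the chart at `x`; the first argument is the direction. -/
noncomputable def Γ (x : M) : Euc M.dim →L[ℝ] Euc M.dim →L[ℝ] Euc M.dim := Γco x x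

lemma nabla_oc_self (x : M) (u v : Euc M.dim) :
    nabla M (fun z => oc x z v) x u = Γ x u v := by
  have h := nabla_oc (mem_src x) ((contMDiffAt_gco x).mdifferentiableAt (by simp)) u v
  simpa [Γ] using h

/-- The Levi-Civita connection in components. -/
lemma nabla_eq_d {X : M → Euc M.dim} {x : M} (hX : MDiffVF X x) (u : Euc M.dim) :
    nabla M X x u = M.d (fun y => co x y (X y)) x u + Γ x u (X x) := by
  -- two covariant derivatives differ by a tensor
  obtain ⟨Δ, hΔ⟩ : ∃ Δ : Euc M.dim →L[ℝ] Euc M.dim →L[ℝ] Euc M.dim, ∀ X : M → Euc M.dim,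
      MDiffVF X x → Δ (X x) = nabla M X x - lcE M X x := by
    refine ⟨(LC M).isCovariantDerivativeOnUniv.difference (lc M).isCovariantDerivativeOnUniv x,
      fun X hX => ?_⟩
    rw [nabla_eq]
    exact IsCovariantDerivativeOn.difference_apply (LC M).isCovariantDerivativeOnUniv
      (lc M).isCovariantDerivativeOnUniv (hx := Set.mem_univ x) hX
  have h1 := congrArg (fun T : Euc M.dim →L[ℝ] Euc M.dim => T u) (hΔ X hX)
  have h2 := congrArg (fun T : Euc M.dim →L[ℝ] Euc M.dim => T u)
    (hΔ _ (mdiffVF_oc (mem_src x) (X x)))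
  simp only [oc_self, ContinuousLinearMap.id_apply, lcE_oc, _root_.sub_apply] at h1 h2
  rw [nabla_oc_self, h1] at h2
  simp only [lcE, _root_.add_apply] at h2
  have h3 := sub_eq_sub_iff_add_eq_add.1 h2
  have h4 : nabla M X x u + christoffel (M.gE x) (M.d (gco x) x) (X x) u =
      (M.d (fun y => co x y (X y)) x u + Γ x u (X x)) +
        christoffel (M.gE x) (M.d (gco x) x) (X x) u := by
    rw [h3]; abel
  exact add_right_cancel h4

/-- The Levi-Civita connection is metric, in coordinates. -/
lemma d_gco_eq (x : M) (u v w : Euc M.dim) :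
    M.d (gco x) x u v w = M.gE x (Γ x u v) w + M.gE x v (Γ x u w) := by
  have hg := (contMDiffAt_gco x).mdifferentiableAt (by simp : (∞ : ℕ∞ω) ≠ 0)
  have h1 := nabla_metric (mdiffVF_oc (mem_src x) v) (mdiffVF_oc (mem_src x) w) u
  have ha : MDifferentiableAt M.I 𝓘(ℝ, Euc M.dim) (fun _ : M => v) x := mdifferentiableAt_const
  have hb : MDifferentiableAt M.I 𝓘(ℝ, Euc M.dim) (fun _ : M => w) x := mdifferentiableAt_const
  rw [nabla_oc_self, nabla_oc_self, oc_self] at h1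
  change M.d (fun z => gco x z v w) x u = _ at h1
  rw [d_clm_apply (mdiff_clm_apply hg ha) hb, d_clm_apply hg ha] at h1
  simpa [d_const] using h1

section

variable {EQ HQ Q : Type*} [NormedAddCommGroup EQ] [NormedSpace ℝ EQ] [TopologicalSpace HQ]
  {J : ModelWithCorners ℝ EQ HQ} [TopologicalSpace Q] [ChartedSpace HQ Q] {q : Q} {n : ℕ}

lemma contMDiffAt_inverse {g : Q → Euc n →L[ℝ] Euc n →L[ℝ] ℝ}
    (hg : ContMDiffAt J 𝓘(ℝ, Euc n →L[ℝ] Euc n →L[ℝ] ℝ) ∞ g q) (hp : ∀ v, v ≠ 0 → 0 < g q v v) :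
    ContMDiffAt J 𝓘(ℝ, (Euc n →L[ℝ] ℝ) →L[ℝ] Euc n) ∞ (fun y => (g y).inverse) q :=
  ContMDiffAt.comp (I' := 𝓘(ℝ, Euc n →L[ℝ] Euc n →L[ℝ] ℝ)) q
    (ContinuousLinearMap.IsInvertible.contDiffAt_map_inverse
      (isInvertible_of_pos hp)).contMDiffAt hg

lemma contMDiffAt_christoffel {g : Q → Euc n →L[ℝ] Euc n →L[ℝ] ℝ}
    {G : Q → Euc n →L[ℝ] Euc n →L[ℝ] Euc n →L[ℝ] ℝ}
    (hg : ContMDiffAt J 𝓘(ℝ, Euc n →L[ℝ] Euc n →L[ℝ] ℝ) ∞ g q) (hp : ∀ v, v ≠ 0 → 0 < g q v v)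
    (hG : ContMDiffAt J 𝓘(ℝ, Euc n →L[ℝ] Euc n →L[ℝ] Euc n →L[ℝ] ℝ) ∞ G q) :
    ContMDiffAt J 𝓘(ℝ, Euc n →L[ℝ] Euc n →L[ℝ] Euc n) ∞ (fun y => (christoffel (g y) (G y)).flip)
      q := by
  have hG' : ∀ a b c : Euc n, ContMDiffAt J 𝓘(ℝ, ℝ) ∞ (fun y => G y a b c) q := fun a b c =>
    ((hG.clm_apply contMDiffAt_const).clm_apply contMDiffAt_const).clm_apply contMDiffAt_const
  refine contMDiffAt_clm_of_apply fun u => contMDiffAt_clm_of_apply fun v => ?_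
  have hk : ContMDiffAt J 𝓘(ℝ, Euc n →L[ℝ] ℝ) ∞ (fun y => koszul (G y) v u) q := by
    refine contMDiffAt_clm_of_apply fun w => ?_
    simp only [koszul_apply, div_eq_mul_inv]
    exact (((hG' u v w).add (hG' v u w)).sub (hG' w u v)).mul contMDiffAt_const
  exact (contMDiffAt_inverse hg hp).clm_apply hk

end

/-- The Christoffel symbols are smooth. -/
lemma contMDiffAt_Γco (x₀ : M) :
    ContMDiffAt M.I 𝓘(ℝ, Euc M.dim →L[ℝ] Euc M.dim →L[ℝ] Euc M.dim) ∞ (Γco x₀) x₀ :=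
  contMDiffAt_christoffel (contMDiffAt_gco x₀) (gco_pos (mem_src x₀))
    (contMDiffAt_d (contMDiffAt_gco x₀))

end RMfd

namespace RMfd

variable {M : RMfd}

/-! ### Change of charts -/

/-- The change of coordinates from the chart at `x₀` to the chart at `y`. -/
noncomputable def trans (x₀ y z : M) : Euc M.dim →L[ℝ] Euc M.dim := co y z ∘L oc x₀ z

lemma mdiff_trans {x₀ y : M} (h : y ∈ src x₀) :
    MDifferentiableAt M.I 𝓘(ℝ, Euc M.dim →L[ℝ] Euc M.dim) (trans x₀ y) y := by
  have h1 : ContMDiffAt M.I 𝓘(ℝ, Euc M.dim →L[ℝ] Euc M.dim) ∞ (trans x₀ y) y :=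
    contMDiffAt_clm_of_apply fun v => (contMDiffAt_tangent_iff.1 (contMDiffAt_oc h v)).2
  exact h1.mdifferentiableAt (by simp)

/-- The transformation law of the Christoffel symbols. -/
lemma d_trans {x₀ y : M} (h : y ∈ src x₀)
    (hg : MDifferentiableAt M.I 𝓘(ℝ, Euc M.dim →L[ℝ] Euc M.dim →L[ℝ] ℝ) (gco x₀) y)
    (u : Euc M.dim) :
    M.d (trans x₀ y) y (oc x₀ y u) =
      oc x₀ y ∘L Γco x₀ y u - Γ y (oc x₀ y u) ∘L oc x₀ y := by
  ext1 v
  have h1 := nabla_eq_d (mdiffVF_oc h v) (oc x₀ y u)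
  rw [nabla_oc h hg] at h1
  have h2 : M.d (fun z => trans x₀ y z v) y (oc x₀ y u) = M.d (trans x₀ y) y (oc x₀ y u) v := by
    rw [d_clm_apply (mdiff_trans h) mdifferentiableAt_const, d_const]
    simp
  rw [← h2]
  exact (sub_eq_of_eq_add h1).symm

/-! ### The Grassmann bundle -/

/-- The bundle of complexified exterior algebras, glued by the functor `Lam.mapL` from the
coordinate changes of the tangent bundle. -/
noncomputable def lamCore (M : RMfd) :
    VectorBundleCore ℝ M (Lam M.dim) (atlas (Euc M.dim) M) where
  baseSet i := i.1.source
  isOpen_baseSet i := i.1.open_source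
  indexAt := achart (Euc M.dim)
  mem_baseSet_at := mem_chart_source (Euc M.dim)
  coordChange i j x := Lam.mapL ((tangentBundleCore M.I M).coordChange i j x)
  coordChange_self i x hx v := by
    have h : (tangentBundleCore M.I M).coordChange i i x = ContinuousLinearMap.id ℝ _ :=
      ContinuousLinearMap.ext fun w => (tangentBundleCore M.I M).coordChange_self i x hx w
    rw [h, Lam.mapL_id]
    rfl
  continuousOn_coordChange i j :=
    Lam.contDiff_mapL.continuous.comp_continuousOn
      ((tangentBundleCore M.I M).continuousOn_coordChange i j)
  coordChange_comp i j k x hx v := by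
    have h : (tangentBundleCore M.I M).coordChange j k x ∘L
        (tangentBundleCore M.I M).coordChange i j x = (tangentBundleCore M.I M).coordChange i k x :=
      ContinuousLinearMap.ext fun w => (tangentBundleCore M.I M).coordChange_comp i j k x hx w
    rw [← h, Lam.mapL_comp]
    rfl

instance (M : RMfd) : (lamCore M).IsContMDiff M.I ∞ where
  contMDiffOn_coordChange i j :=
    haveI : IsManifold M.I (∞ + 1) M := M.manifold
    Lam.contDiff_mapL.contMDiff.comp_contMDiffOn
      ((tangentBundleCore.isContMDiff (I := M.I) (M := M) (n := ∞)).contMDiffOn_coordChange i j)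

/-- The complexified exterior algebra of the tangent space at `x`. -/
def LamFiber (M : RMfd) (_ : M) : Type := Lam M.dim

noncomputable instance (x : M) : AddCommGroup (LamFiber M x) :=
  inferInstanceAs (AddCommGroup (Lam M.dim))

noncomputable instance (x : M) : Module ℂ (LamFiber M x) :=
  inferInstanceAs (Module ℂ (Lam M.dim))

noncomputable instance (x : M) : TopologicalSpace (LamFiber M x) :=
  inferInstanceAs (TopologicalSpace (Lam M.dim))

instance (x : M) : IsTopologicalAddGroup (LamFiber M x) :=
  inferInstanceAs (IsTopologicalAddGroup (Lam M.dim))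

instance (x : M) : ContinuousSMul ℝ (LamFiber M x) :=
  inferInstanceAs (ContinuousSMul ℝ (Lam M.dim))

noncomputable instance : TopologicalSpace (TotalSpace (Lam M.dim) (LamFiber M)) :=
  inferInstanceAs (TopologicalSpace (TotalSpace (Lam M.dim) (lamCore M).Fiber))

noncomputable instance : FiberBundle (Lam M.dim) (LamFiber M) :=
  inferInstanceAs (FiberBundle (Lam M.dim) (lamCore M).Fiber)

instance : VectorBundle ℝ (Lam M.dim) (LamFiber M) :=
  inferInstanceAs (VectorBundle ℝ (Lam M.dim) (lamCore M).Fiber)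

instance : ContMDiffVectorBundle ∞ (Lam M.dim) (LamFiber M) M.I :=
  inferInstanceAs (ContMDiffVectorBundle ∞ (Lam M.dim) (lamCore M).Fiber M.I)

/-- A bundle valued map is smooth if its components are. -/
lemma contMDiffAt_lam_iff_of_mem {EQ HQ Q : Type*} [NormedAddCommGroup EQ] [NormedSpace ℝ EQ]
    [TopologicalSpace HQ] {J : ModelWithCorners ℝ EQ HQ} [TopologicalSpace Q] [ChartedSpace HQ Q]
    {q : Q} {a : Q → TotalSpace (Lam M.dim) (LamFiber M)} {x₀ : M} (h : (a q).proj ∈ src x₀) :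
    ContMDiffAt J (M.I.prod 𝓘(ℝ, Lam M.dim)) ∞ a q ↔
      ContMDiffAt J M.I ∞ (fun t => (a t).proj) q ∧
      ContMDiffAt J 𝓘(ℝ, Lam M.dim) ∞ (fun t => Lam.map (co x₀ (a t).proj) (a t).2) q :=
  (trivializationAt (Lam M.dim) (LamFiber M) x₀).contMDiffAt_iff
    ((trivializationAt (Lam M.dim) (LamFiber M) x₀).mem_source.2 h)

lemma herm_co {x₀ y : M} (h : y ∈ src x₀) (a b : Lam M.dim) :
    Lam.herm (gco x₀ y) (Lam.map (co x₀ y) a) (Lam.map (co x₀ y) b) = Lam.herm (M.gE y) a b :=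
  Lam.herm_map_map _ _ _ (gco_co h) a b

lemma map_co_oc {x₀ y : M} (h : y ∈ src x₀) (a : Lam M.dim) :
    Lam.map (co x₀ y) (Lam.map (oc x₀ y) a) = a := by
  rw [← Lam.map_comp_apply, co_oc h, Lam.map_id_apply]

lemma map_oc_co {x₀ y : M} (h : y ∈ src x₀) (a : Lam M.dim) :
    Lam.map (oc x₀ y) (Lam.map (co x₀ y) a) = a := by
  rw [← Lam.map_comp_apply, oc_co h, Lam.map_id_apply]

/-- The section `s` is smooth at `x`. -/
def SmoothLam (s : M → Lam M.dim) (x : M) : Prop :=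
  ContMDiffAt M.I 𝓘(ℝ, Lam M.dim) ∞ (fun y => Lam.map (co x y) (s y)) x

lemma smoothLam_iff {s : M → Lam M.dim} {x : M} :
    ContMDiffAt M.I (M.I.prod 𝓘(ℝ, Lam M.dim)) ∞
      (fun y => (⟨y, s y⟩ : TotalSpace (Lam M.dim) (LamFiber M))) x ↔ SmoothLam s x :=
  (contMDiffAt_lam_iff_of_mem (a := fun y => (⟨y, s y⟩ : TotalSpace (Lam M.dim) (LamFiber M)))
    (mem_src x)).trans (and_iff_right contMDiffAt_id)

/-- The section `s` is differentiable at `x`. -/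
def MDiffLam (s : M → Lam M.dim) (x : M) : Prop :=
  MDifferentiableAt M.I 𝓘(ℝ, Lam M.dim) (fun y => Lam.map (co x y) (s y)) x

lemma SmoothLam.mdiff {s : M → Lam M.dim} {x : M} (h : SmoothLam s x) : MDiffLam s x :=
  h.mdifferentiableAt (by simp)

lemma mdiffLam_iff {s : M → Lam M.dim} {x : M} :
    MDifferentiableAt M.I (M.I.prod 𝓘(ℝ, Lam M.dim))
      (fun y => (⟨y, s y⟩ : TotalSpace (Lam M.dim) (LamFiber M))) x ↔ MDiffLam s x :=
  mdifferentiableAt_section (IB := M.I) (E := LamFiber M) (𝕜 := ℝ) s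

/-- The Grassmann bundle as a Hermitian bundle. -/
noncomputable def lamHerm (M : RMfd) : HermBundleOver M where
  model := Lam M.dim
  fiber := LamFiber M
  trivialization_smul e he x _ c v := by
    obtain ⟨i, rfl⟩ := he.1
    exact map_smul (Lam.map ((tangentBundleCore M.I M).coordChange _ i x)) c v
  herm x := Lam.herm (M.gE x)
  herm_symm x v w := (Lam.herm_symm _ (M.gE_symm x) v w)
  herm_pos x v hv := Lam.herm_pos _ (M.gE_symm x) (M.gE_pos x) v hv
  herm_smooth s t hs ht x := by
    have h := ((Lam.contDiff_hermL.contMDiff.contMDiffAt.comp x (contMDiffAt_gco x)).clm_apply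
      (smoothLam_iff.1 (hs x))).clm_apply (smoothLam_iff.1 (ht x))
    refine h.congr_of_eventuallyEq ?_
    filter_upwards [src_mem_nhds (mem_src x)] with y hy
    exact (herm_co hy (s y) (t y)).symm

end RMfd

/-! ### Exterior and Clifford multiplication as one family -/

namespace Lam

variable {n m : ℕ}

/-- Exterior multiplication by `v` plus `ε` times the contraction with `v`. For `ε = 0, -1` this is
left exterior and Clifford multiplication, and for `ε = 1` right Clifford multiplication up to the
grade involution. -/
noncomputable def cliff (ε : ℝ) (g : Euc n →L[ℝ] Euc n →L[ℝ] ℝ) (v : Euc n) (x : Lam n) : Lam n :=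
  ι v * x + ε • contr (g v) x

lemma cleft_eq (g : Euc n →L[ℝ] Euc n →L[ℝ] ℝ) (v : Euc n) (x : Lam n) :
    cleft g v x = cliff (-1) g v x := by
  rw [cleft, cliff, neg_one_smul, sub_eq_add_neg]

lemma cright_eq (g : Euc n →L[ℝ] Euc n →L[ℝ] ℝ) (v : Euc n) (x : Lam n) :
    cright g v x = cliff 1 g v (invol x) := by
  rw [cright, cliff, one_smul]

lemma ι_mul_eq (g : Euc n →L[ℝ] Euc n →L[ℝ] ℝ) (v : Euc n) (x : Lam n) :
    ι v * x = cliff 0 g v x := by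
  rw [cliff, zero_smul, add_zero]

lemma map_real_smul (A : Euc n →L[ℝ] Euc m) (r : ℝ) (x : Lam n) : map A (r • x) = r • map A x :=
  map_smul (mapL A) r x

/-- Clifford multiplication with a vector on which `A` is isometric. -/
lemma map_cliff (ε : ℝ) {g : Euc n →L[ℝ] Euc n →L[ℝ] ℝ} {g' : Euc m →L[ℝ] Euc m →L[ℝ] ℝ}
    {A : Euc n →L[ℝ] Euc m} {u : Euc n} (h : ∀ w, g' (A u) (A w) = g u w) (x : Lam n) :
    map A (cliff ε g u x) = cliff ε g' (A u) (map A x) := by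
  have e : g' (A u) ∘L A = g u := ContinuousLinearMap.ext h
  rw [cliff, cliff, contr_map, e, map_add, map_mul, map_ι, map_real_smul]

end Lam

namespace RMfd

variable {M : RMfd}

/-! ### The connection of the Grassmann bundle -/

/-- The connection of the Grassmann bundle: the extension of the Levi-Civita connection as a
derivation, expressed at each point in the preferred chart. -/
noncomputable def nablaLam (M : RMfd) (s : M → Lam M.dim) (x : M) : Euc M.dim →L[ℝ] Lam M.dim :=
  M.d (fun y => Lam.map (co x y) (s y)) x +
    (ContinuousLinearMap.apply ℝ (Lam M.dim) (s x)) ∘L Lam.der ∘L Γ x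

lemma nablaLam_apply (s : M → Lam M.dim) (x : M) (u : Euc M.dim) :
    nablaLam M s x u = M.d (fun y => Lam.map (co x y) (s y)) x u + Lam.der (Γ x u) (s x) := rfl

lemma nablaLam_add {s t : M → Lam M.dim} {x : M} (hs : MDiffLam s x) (ht : MDiffLam t x) :
    nablaLam M (fun y => s y + t y) x = nablaLam M s x + nablaLam M t x := by
  ext1 u
  have h := d_add hs ht
  simp only [nablaLam_apply, map_add, _root_.add_apply]
  rw [h, _root_.add_apply]
  abel

lemma nablaLam_smul {s : M → Lam M.dim} {f : M → ℝ} {x : M} (hs : MDiffLam s x)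
    (hf : MDifferentiableAt M.I 𝓘(ℝ, ℝ) f x) :
    nablaLam M (fun y => f y • s y) x = f x • nablaLam M s x + (M.d f x).smulRight (s x) := by
  ext1 u
  have h := d_bilin hf hs (ContinuousLinearMap.lsmul ℝ ℝ) u
  simp only [ContinuousLinearMap.lsmul_apply, co_self, Lam.map_id_apply] at h
  simp only [nablaLam_apply, Lam.map_real_smul, map_smul, _root_.add_apply, _root_.smul_apply, h,
    smul_add, ContinuousLinearMap.smulRight_apply]
  abel

lemma nablaLam_complex_smul {s : M → Lam M.dim} {x : M} (hs : MDiffLam s x) (c : ℂ)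
    (u : Euc M.dim) : nablaLam M (fun y => c • s y) x u = c • nablaLam M s x u := by
  have h := d_comp hs ((hasFDerivAt_id (𝕜 := ℝ) _).const_smul c) u
  simp only [nablaLam_apply, map_smul, Lam.der_smul, smul_add]
  exact congrArg (· + c • Lam.der (Γ x u) (s x)) h

lemma nablaLam_one (x : M) (u : Euc M.dim) : nablaLam M (fun _ => 1) x u = 0 := by
  simp only [nablaLam_apply, map_one, d_const, Lam.der_one]
  simp

/-- The connection in the trivialization over the chart at `x₀`. -/
lemma map_co_nablaLam {s : M → Lam M.dim} {x₀ y : M} (h : y ∈ src x₀)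
    (hg : MDifferentiableAt M.I 𝓘(ℝ, Euc M.dim →L[ℝ] Euc M.dim →L[ℝ] ℝ) (gco x₀) y)
    (hs : MDifferentiableAt M.I 𝓘(ℝ, Lam M.dim) (fun z => Lam.map (co x₀ z) (s z)) y)
    (u : Euc M.dim) :
    Lam.map (co x₀ y) (nablaLam M s y (oc x₀ y u)) =
      M.d (fun z => Lam.map (co x₀ z) (s z)) y (oc x₀ y u) +
        Lam.der (Γco x₀ y u) (Lam.map (co x₀ y) (s y)) := by
  have ht : trans x₀ y y = oc x₀ y := by ext; simp [trans]
  have e : (fun z => Lam.map (co y z) (s z)) =ᶠ[𝓝 y]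
      fun z => Lam.mapL (trans x₀ y z) (Lam.map (co x₀ z) (s z)) := by
    filter_upwards [src_mem_nhds h] with z hz
    rw [Lam.mapL_apply, trans, Lam.map_comp_apply, map_oc_co hz]
  have hm := mdiff_comp (mdiff_trans h)
    (Lam.contDiff_mapL.differentiable (by simp) (trans x₀ y y))
  rw [nablaLam_apply, d_congr e, d_clm_apply hm hs, d_comp (mdiff_trans h) (Lam.hasFDerivAt_mapL _),
    d_trans h hg, ht, map_sub, _root_.sub_apply, Lam.fderiv_mapL_comp_left,
    Lam.fderiv_mapL_comp_right, map_oc_co h, Lam.mapL_apply]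
  simp only [map_add, map_sub, map_co_oc h]
  abel

/-- The connection maps smooth sections to smooth sections. -/
lemma contMDiffAt_nablaLam {s : M → Lam M.dim} {x₀ : M} (hs : SmoothLam s x₀) :
    ContMDiffAt M.I 𝓘(ℝ, Euc M.dim →L[ℝ] Lam M.dim) ∞
      (fun y => Lam.mapL (co x₀ y) ∘L nablaLam M s y ∘L oc x₀ y) x₀ := by
  have h1 := contMDiffAt_d hs
  have h2 : ContMDiffAt M.I 𝓘(ℝ, Euc M.dim →L[ℝ] Lam M.dim) ∞
      (fun y => (ContinuousLinearMap.apply ℝ (Lam M.dim) (Lam.map (co x₀ y) (s y))) ∘L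
        Lam.der ∘L Γco x₀ y) x₀ := by
    refine contMDiffAt_clm_of_apply fun u => ?_
    have h3 : ContMDiffAt M.I 𝓘(ℝ, Lam M.dim →L[ℝ] Lam M.dim) ∞
        (fun y => Lam.der (Γco x₀ y u)) x₀ :=
      Lam.der.contMDiff.contMDiffAt.comp x₀ ((contMDiffAt_Γco x₀).clm_apply contMDiffAt_const)
    exact h3.clm_apply hs
  refine (h1.add h2).congr_of_eventuallyEq ?_
  filter_upwards [src_mem_nhds (mem_src x₀), eventually_mdiff (contMDiffAt_gco x₀),
    eventually_mdiff hs] with y hy hg hsy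
  ext1 u
  exact map_co_nablaLam hy hg hsy u

/-- The connection is metric. -/
lemma nablaLam_herm {s t : M → Lam M.dim} {x : M} (hs : MDiffLam s x) (ht : MDiffLam t x)
    (u : Euc M.dim) : M.d (fun y => Lam.herm (M.gE y) (s y) (t y)) x u =
      Lam.herm (M.gE x) (nablaLam M s x u) (t x) + Lam.herm (M.gE x) (s x) (nablaLam M t x u) := by
  have hg := (contMDiffAt_gco x).mdifferentiableAt (by simp : (∞ : ℕ∞ω) ≠ 0)
  have hd := (Lam.contDiff_hermL (n := M.dim)).differentiable (by simp) (gco x x)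
  have e : (fun y => Lam.herm (M.gE y) (s y) (t y)) =ᶠ[𝓝 x]
      fun y => Lam.hermL (gco x y) (Lam.map (co x y) (s y)) (Lam.map (co x y) (t y)) := by
    filter_upwards [src_mem_nhds (mem_src x)] with y hy using (herm_co hy _ _).symm
  have hm := mdiff_comp hg hd
  rw [d_congr e, d_clm_apply (mdiff_clm_apply hm hs) ht, d_clm_apply hm hs,
    d_comp hg hd.hasFDerivAt, gco_self, co_self, Lam.map_id_apply, Lam.map_id_apply,
    _root_.add_apply, Lam.fderiv_hermL _ _ _ (d_gco_eq x u)]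
  simp only [nablaLam_apply, Lam.hermL_apply, map_add, LinearMap.add_apply]
  abel

/-! ### Clifford multiplication of sections -/

/-- Clifford multiplication is natural for coordinate changes, which are isometric. -/
lemma map_co_cliff {x₀ y : M} (h : y ∈ src x₀) (ε : ℝ) (v : Euc M.dim) (a : Lam M.dim) :
    Lam.map (co x₀ y) (Lam.cliff ε (M.gE y) v a) =
      Lam.cliff ε (gco x₀ y) (co x₀ y v) (Lam.map (co x₀ y) a) :=
  Lam.map_cliff ε (gco_co h v) a

lemma smoothLam_cliff (ε : ℝ) {X : M → Euc M.dim} {s : M → Lam M.dim} {x : M}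
    (hX : ContMDiffAt M.I 𝓘(ℝ, Euc M.dim) ∞ (fun y => co x y (X y)) x) (hs : SmoothLam s x) :
    SmoothLam (fun y => Lam.cliff ε (M.gE y) (X y) (s y)) x := by
  have h1 := ((Lam.mulL.comp Lam.ιL).contMDiff.contMDiffAt.comp x hX).clm_apply hs
  have h2 := ((ε • Lam.contrL).contMDiff.contMDiffAt.comp x
    ((contMDiffAt_gco x).clm_apply hX)).clm_apply hs
  refine (h1.add h2).congr_of_eventuallyEq ?_
  filter_upwards [src_mem_nhds (mem_src x)] with y hy
  exact map_co_cliff hy ε _ _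

lemma smoothLam_invol {s : M → Lam M.dim} {x : M} (hs : SmoothLam s x) :
    SmoothLam (fun y => Lam.invol (s y)) x := by
  have h := (Lam.mapL (-ContinuousLinearMap.id ℝ (Euc M.dim))).contMDiff.contMDiffAt.comp x hs
  refine h.congr_of_eventuallyEq (Filter.Eventually.of_forall fun y => ?_)
  exact Lam.map_invol _ _

lemma nablaLam_invol {s : M → Lam M.dim} {x : M} (hs : MDiffLam s x) (u : Euc M.dim) :
    nablaLam M (fun y => Lam.invol (s y)) x u = Lam.invol (nablaLam M s x u) := by
  have h := d_comp hs (Lam.mapL (-ContinuousLinearMap.id ℝ (Euc M.dim))).hasFDerivAt u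
  simp only [nablaLam_apply, Lam.map_invol, Lam.der_invol, map_add]
  exact congrArg (· + Lam.invol (Lam.der (Γ x u) (s x))) h

/-- The Leibniz rule for exterior and Clifford multiplication. -/
lemma nablaLam_cliff (ε : ℝ) {X : M → Euc M.dim} {s : M → Lam M.dim} {x : M}
    (hX : MDiffVF X x) (hs : MDiffLam s x) (u : Euc M.dim) :
    nablaLam M (fun y => Lam.cliff ε (M.gE y) (X y) (s y)) x u =
      Lam.cliff ε (M.gE x) (nabla M X x u) (s x) +
        Lam.cliff ε (M.gE x) (X x) (nablaLam M s x u) := by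
  have hg := (contMDiffAt_gco x).mdifferentiableAt (by simp : (∞ : ℕ∞ω) ≠ 0)
  have e : (fun y => Lam.map (co x y) (Lam.cliff ε (M.gE y) (X y) (s y))) =ᶠ[𝓝 x]
      fun y => (Lam.mulL.comp Lam.ιL) (co x y (X y)) (Lam.map (co x y) (s y)) +
        (ε • Lam.contrL) (gco x y (co x y (X y))) (Lam.map (co x y) (s y)) := by
    filter_upwards [src_mem_nhds (mem_src x)] with y hy using map_co_cliff hy ε _ _
  have hgX := mdiff_clm_apply hg hX.co
  have hc : M.d (gco x) x u (X x) = M.gE x (Γ x u (X x)) + M.gE x (X x) ∘L Γ x u := by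
    ext w
    simp [d_gco_eq]
  rw [nablaLam_apply, d_congr e, d_add (mdiff_bilin hX.co hs _) (mdiff_bilin hgX hs _),
    _root_.add_apply, d_bilin hX.co hs, d_bilin hgX hs, d_clm_apply hg hX.co, nabla_eq_d hX,
    nablaLam_apply]
  simp only [gco_self, co_self, Lam.map_id_apply, ContinuousLinearMap.id_apply]
  simp only [Lam.cliff, map_add, map_smul, Lam.der_ι_mul, Lam.der_contr, hc, Lam.contrL_apply,
    _root_.smul_apply, _root_.add_apply, ContinuousLinearMap.comp_apply, Lam.mulL_apply,
    Lam.ιL_apply, Lam.contr_add, add_mul, mul_add]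
  module

end RMfd

/-! ### The Clifford bimodule structure of the Grassmann bundle -/

section Regular

variable {C V : Type*} [Ring C] [Algebra ℂ C] [AddCommGroup V] [Module ℂ V]

/-- The left regular representation of an algebra, transported along a linear isomorphism. -/
noncomputable def leftReg (e : C ≃ₗ[ℂ] V) : C →ₐ[ℂ] Module.End ℂ V where
  toFun a := e.toLinearMap ∘ₗ LinearMap.mulLeft ℂ a ∘ₗ e.symm.toLinearMap
  map_one' := by ext v; simp
  map_mul' a b := by ext v; simp
  map_zero' := by ext v; simp
  map_add' a b := by ext v; simp [add_mul]
  commutes' c := by ext v; simp [Algebra.algebraMap_eq_smul_one]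

/-- The right regular representation of an algebra, transported along a linear isomorphism. -/
noncomputable def rightReg (e : C ≃ₗ[ℂ] V) : C →ₐ[ℂ] (Module.End ℂ V)ᵐᵒᵖ where
  toFun a := MulOpposite.op (e.toLinearMap ∘ₗ LinearMap.mulRight ℂ a ∘ₗ e.symm.toLinearMap)
  map_one' := by apply MulOpposite.unop_injective; ext v; simp
  map_mul' a b := by apply MulOpposite.unop_injective; ext v; simp [mul_assoc]
  map_zero' := by apply MulOpposite.unop_injective; ext v; simp
  map_add' a b := by apply MulOpposite.unop_injective; ext v; simp [mul_add]
  commutes' c := by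
    apply MulOpposite.unop_injective; ext v; simp [Algebra.algebraMap_eq_smul_one]

end Regular

namespace RMfd

variable {M : RMfd}

/-- The symbol map with values in the fibre of the Grassmann bundle. -/
noncomputable def symbFib (M : RMfd) (x : M) : Clifford M x ≃ₗ[ℂ] LamFiber M x := symb M x

/-- Left Clifford multiplication on the exterior algebra of the tangent space at `x`. -/
noncomputable def lmulC (x : M) (a : Clifford M x) (v : Lam M.dim) : Lam M.dim :=
  symb M x (a * (symb M x).symm v)

/-- Right Clifford multiplication on the exterior algebra of the tangent space at `x`. -/
noncomputable def rmulC (x : M) (a : Clifford M x) (v : Lam M.dim) : Lam M.dim :=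
  symb M x ((symb M x).symm v * a)

lemma lmulC_cvec (x : M) (u : Euc M.dim) (v : Lam M.dim) :
    lmulC x (cvecE M x u) v = Lam.cliff (-1) (M.gE x) u v := by
  rw [lmulC, symb_cvec_mul, LinearEquiv.apply_symm_apply, Lam.cleft_eq]

lemma rmulC_cvec (x : M) (u : Euc M.dim) (v : Lam M.dim) :
    rmulC x (cvecE M x u) v = Lam.cliff 1 (M.gE x) u (Lam.invol v) := by
  rw [rmulC, symb_mul_cvec, LinearEquiv.apply_symm_apply, Lam.cright_eq]

lemma lmulC_rmulC (x : M) (a b : Clifford M x) (v : Lam M.dim) :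
    lmulC x a (rmulC x b v) = rmulC x b (lmulC x a v) := by
  simp only [lmulC, rmulC, LinearEquiv.symm_apply_apply, mul_assoc]

lemma herm_lmulC (x : M) (u : Euc M.dim) (v w : Lam M.dim) :
    Lam.herm (M.gE x) (lmulC x (cvecE M x u) v) w =
      -Lam.herm (M.gE x) v (lmulC x (cvecE M x u) w) := by
  rw [lmulC_cvec, lmulC_cvec, ← Lam.cleft_eq, ← Lam.cleft_eq, Lam.herm_cleft _ (M.gE_symm x)]

lemma herm_rmulC (x : M) (u : Euc M.dim) (v w : Lam M.dim) :
    Lam.herm (M.gE x) (rmulC x (cvecE M x u) v) w =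
      -Lam.herm (M.gE x) v (rmulC x (cvecE M x u) w) := by
  rw [rmulC_cvec, rmulC_cvec, ← Lam.cright_eq, ← Lam.cright_eq, Lam.herm_cright _ (M.gE_symm x)]

lemma smoothLam_lmulC {X : M → Euc M.dim} {s : M → Lam M.dim} {x : M}
    (hX : ContMDiffAt M.I 𝓘(ℝ, Euc M.dim) ∞ (fun y => co x y (X y)) x) (hs : SmoothLam s x) :
    SmoothLam (fun y => lmulC y (cvecE M y (X y)) (s y)) x := by
  simp only [lmulC_cvec]
  exact smoothLam_cliff _ hX hs

lemma smoothLam_rmulC {X : M → Euc M.dim} {s : M → Lam M.dim} {x : M}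
    (hX : ContMDiffAt M.I 𝓘(ℝ, Euc M.dim) ∞ (fun y => co x y (X y)) x) (hs : SmoothLam s x) :
    SmoothLam (fun y => rmulC y (cvecE M y (X y)) (s y)) x := by
  simp only [rmulC_cvec]
  exact smoothLam_cliff _ hX (smoothLam_invol hs)

lemma nablaLam_lmulC {X : M → Euc M.dim} {s : M → Lam M.dim} {x : M} (hX : MDiffVF X x)
    (hs : MDiffLam s x) (u : Euc M.dim) :
    nablaLam M (fun y => lmulC y (cvecE M y (X y)) (s y)) x u =
      lmulC x (cvecE M x (nabla M X x u)) (s x) + lmulC x (cvecE M x (X x)) (nablaLam M s x u) := by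
  simp only [lmulC_cvec]
  exact nablaLam_cliff _ hX hs u

lemma nablaLam_rmulC {X : M → Euc M.dim} {s : M → Lam M.dim} {x : M} (hX : MDiffVF X x)
    (hs : SmoothLam s x) (u : Euc M.dim) :
    nablaLam M (fun y => rmulC y (cvecE M y (X y)) (s y)) x u =
      rmulC x (cvecE M x (nabla M X x u)) (s x) + rmulC x (cvecE M x (X x)) (nablaLam M s x u) := by
  simp only [rmulC_cvec]
  rw [nablaLam_cliff _ hX (smoothLam_invol hs).mdiff, nablaLam_invol hs.mdiff]

lemma smoothLam_one (x : M) : SmoothLam (fun _ : M => (1 : Lam M.dim)) x := by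
  simp only [SmoothLam, map_one]
  exact contMDiffAt_const

lemma smoothLam_wedge {X : M → Euc M.dim} {s : M → Lam M.dim} {x : M}
    (hX : ContMDiffAt M.I 𝓘(ℝ, Euc M.dim) ∞ (fun y => co x y (X y)) x) (hs : SmoothLam s x) :
    SmoothLam (fun y => Lam.ι (X y) * s y) x := by
  have h := smoothLam_cliff 0 hX hs
  simpa only [← Lam.ι_mul_eq] using h

lemma nablaLam_wedge {X : M → Euc M.dim} {s : M → Lam M.dim} {x : M} (hX : MDiffVF X x)
    (hs : MDiffLam s x) (u : Euc M.dim) :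
    nablaLam M (fun y => Lam.ι (X y) * s y) x u =
      Lam.ι (nabla M X x u) * s x + Lam.ι (X x) * nablaLam M s x u := by
  have h := nablaLam_cliff 0 hX hs u
  simpa only [← Lam.ι_mul_eq] using h

/-- The connection of the Grassmann bundle as a covariant derivative. -/
noncomputable def lamConn (M : RMfd) : CovariantDerivative M.I (Lam M.dim) (LamFiber M) where
  toFun s x := nablaLam M s x
  isCovariantDerivativeOnUniv :=
    { add := fun hs ht _ => nablaLam_add (mdiffLam_iff.1 hs) (mdiffLam_iff.1 ht)
      leibniz := fun hs hf _ => nablaLam_smul (mdiffLam_iff.1 hs) hf }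

lemma contMDiff_lamConn (M : RMfd) : (lamConn M).ContMDiffCovariantDerivative ∞ where
  contMDiff :=
    { contMDiff := by
        intro s hs
        refine contMDiffOn_univ.2 fun x₀ => ?_
        have hs' : SmoothLam s x₀ := smoothLam_iff.1 ((contMDiffOn_univ.1 hs) x₀)
        refine (contMDiffAt_hom_bundle _).2 ⟨contMDiffAt_id, ?_⟩
        refine (contMDiffAt_nablaLam hs').congr_of_eventuallyEq ?_
        filter_upwards [src_mem_nhds (mem_src x₀)] with y hy
        exact VectorBundleCore.inCoordinates_eq (tangentBundleCore M.I M) (lamCore M)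
          (nablaLam M s y) hy hy }

lemma smooth_vf {X : Π x : M, M.T x} (hX : M.IsSmoothVF X) (x : M) :
    ContMDiffAt M.I 𝓘(ℝ, Euc M.dim) ∞ (fun y => co x y (X y)) x :=
  (contMDiffAt_tangent_iff.1 (hX x)).2

lemma mdiff_vf {X : Π x : M, M.T x} (hX : M.IsSmoothVF X) (x : M) : MDiffVF X x :=
  (hX x).mdifferentiableAt (by simp)

lemma isSmoothSection_iff {s : M → Lam M.dim} :
    (lamHerm M).IsSmoothSection s ↔ ∀ x, SmoothLam s x := forall_congr' fun _ => smoothLam_iff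

/-- The Grassmann bundle as a bundle of Clifford bimodules. -/
noncomputable def lamDirac (M : RMfd) : DiracBundleOver M where
  toHermBundleOver := lamHerm M
  left x := leftReg (symbFib M x)
  right x := rightReg (symbFib M x)
  left_right x a b v := lmulC_rmulC x a b v
  left_skew x u v w := herm_lmulC x u v w
  right_skew x u v w := herm_rmulC x u v w
  left_smooth _ _ hX hs := isSmoothSection_iff.2 fun x =>
    smoothLam_lmulC (smooth_vf hX x) (isSmoothSection_iff.1 hs x)
  right_smooth _ _ hX hs := isSmoothSection_iff.2 fun x =>
    smoothLam_rmulC (smooth_vf hX x) (isSmoothSection_iff.1 hs x)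
  conn := lamConn M
  conn_smooth := contMDiff_lamConn M
  conn_complex c _ hs x u := nablaLam_complex_smul (isSmoothSection_iff.1 hs x).mdiff c u
  conn_herm _ _ hs ht x u :=
    nablaLam_herm (isSmoothSection_iff.1 hs x).mdiff (isSmoothSection_iff.1 ht x).mdiff u
  conn_left _ _ hX hs x u := nablaLam_lmulC (mdiff_vf hX x) (isSmoothSection_iff.1 hs x).mdiff u
  conn_right _ _ hX hs x u := nablaLam_rmulC (mdiff_vf hX x) (isSmoothSection_iff.1 hs x) u

/-- The identification of the fibres of the Grassmann bundle with the exterior algebras. -/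
noncomputable def lamEquiv (M : RMfd) (x : M) : (lamDirac M).fiber x ≃ₗ[ℂ] Grassmann M x :=
  LinearEquiv.refl ℂ (Grassmann M x)

lemma isGrassmannBundle (M : RMfd) : IsGrassmannBundle M (lamDirac M) (lamEquiv M) where
  one_smooth := isSmoothSection_iff.2 smoothLam_one
  wedge_smooth _ _ hX hs := isSmoothSection_iff.2 fun x =>
    smoothLam_wedge (smooth_vf hX x) (isSmoothSection_iff.1 hs x)
  herm_wedge x _ v w := Lam.herm_wedge (M.gE x) v w
  herm_wedge_ne x _ _ v w h := Lam.herm_wedge_of_ne (M.gE x) v w h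
  left_eq _ _ _ := rfl
  right_eq _ _ _ := rfl
  conn_one x u := nablaLam_one x u
  conn_wedge _ _ hX hs x u := nablaLam_wedge (mdiff_vf hX x) (isSmoothSection_iff.1 hs x).mdiff u

/-- The identification of the fibres of the Grassmann bundle with the Clifford algebras. -/
noncomputable def cliffEquiv (M : RMfd) (x : M) : (lamHerm M).fiber x ≃ₗ[ℂ] Clifford M x :=
  (symbolMap M x).symm

lemma isCliffordBundle (M : RMfd) :
    IsCliffordBundle M (lamDirac M) (lamEquiv M) (lamHerm M) (cliffEquiv M) where
  one_smooth := isSmoothSection_iff.2 fun x => by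
    have h := smoothLam_one x
    have e : (fun _ : M => (1 : Lam M.dim)) = fun y => symb M y 1 :=
      funext fun y => (symb_one M y).symm
    rw [e] at h
    exact h
  mul_smooth _ _ hX hs := isSmoothSection_iff.2 fun x =>
    smoothLam_lmulC (smooth_vf hX x) (isSmoothSection_iff.1 hs x)
  herm_eq x a b := by
    have h : ∀ a : Lam M.dim, symb M x ((symb M x).symm a) = a := fun a =>
      (symb M x).apply_symm_apply a
    exact (congrArg₂ (fun a b => Lam.herm (M.gE x) a b) (h a) (h b)).symm

end RMfd

/-! ### Adjoints and partial isometries -/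

section Adjoint

variable {n m : ℕ}

/-- The adjoint of `A` with respect to bilinear forms `g` and `g'`. -/
noncomputable def adj (g : Euc n →L[ℝ] Euc n →L[ℝ] ℝ) (g' : Euc m →L[ℝ] Euc m →L[ℝ] ℝ)
    (A : Euc n →L[ℝ] Euc m) : Euc m →L[ℝ] Euc n :=
  g.inverse ∘L ((ContinuousLinearMap.compL ℝ (Euc n) (Euc m) ℝ).flip A) ∘L g'

variable {g : Euc n →L[ℝ] Euc n →L[ℝ] ℝ} {g' : Euc m →L[ℝ] Euc m →L[ℝ] ℝ}

lemma apply_adj (hg : ∀ v, v ≠ 0 → 0 < g v v) (A : Euc n →L[ℝ] Euc m) (w : Euc m) (v : Euc n) :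
    g (adj g g' A w) v = g' w (A v) := by
  obtain ⟨e, he⟩ := isInvertible_of_pos hg
  subst he
  rw [adj, ContinuousLinearMap.inverse_equiv]
  simp

lemma eq_of_forall_apply_eq (hg : ∀ v, v ≠ 0 → 0 < g v v) {v w : Euc n}
    (h : ∀ u, g v u = g w u) : v = w := by
  by_contra hne
  have := hg (v - w) (sub_ne_zero.2 hne)
  have e : g (v - w) = 0 := by
    rw [map_sub, sub_eq_zero]
    exact ContinuousLinearMap.ext h
  rw [e] at this
  exact lt_irrefl _ this

/-- `A` is a partial isometry, that is, isometric on the orthogonal complement of its kernel. This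
is encoded as `A A^* A = A`. -/
def IsPartialIsometry (g : Euc n →L[ℝ] Euc n →L[ℝ] ℝ) (g' : Euc m →L[ℝ] Euc m →L[ℝ] ℝ)
    (A : Euc n →L[ℝ] Euc m) : Prop := ∀ v, A (adj g g' A (A v)) = A v

namespace Lam

variable (A : Euc n →L[ℝ] Euc m)

lemma herm_map_adj (hg : ∀ v, v ≠ 0 → 0 < g v v) (hs : ∀ v w, g v w = g w v)
    (hs' : ∀ v w, g' v w = g' w v) (a : Lam n) (b : Lam m) :
    herm g' (map A a) b = herm g a (map (adj g g' A) b) :=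
  herm_map_left g g' A (adj g g' A) (fun v w => by rw [hs v, apply_adj hg, hs']) a b

/-- The pairs in the graph of `Λ(A)` restricted to the orthogonal complement of the kernel
are those which `Λ(A)` and `Λ(A^*)` map to each other: `Λ(A^*) Λ(A)` is the orthogonal projection to
this complement. -/
lemma graph_iff (hg : ∀ v, v ≠ 0 → 0 < g v v) (hs : ∀ v w, g v w = g w v)
    (hs' : ∀ v w, g' v w = g' w v) (hA : IsPartialIsometry g g' A) (a : Lam n) (b : Lam m) :
    ((∀ u, map A u = 0 → herm g u a = 0) ∧ b = map A a) ↔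
      b = map A a ∧ a = map (adj g g' A) b := by
  have hAA : ∀ c, map A (map (adj g g' A) (map A c)) = map A c := fun c => by
    rw [← map_comp_apply, ← map_comp_apply]
    exact congrArg (fun B : Euc n →L[ℝ] Euc m => map B c) (ContinuousLinearMap.ext hA)
  constructor
  · rintro ⟨h, rfl⟩
    refine ⟨rfl, ?_⟩
    have hk : map A (a - map (adj g g' A) (map A a)) = 0 := by rw [map_sub, hAA, sub_self]
    by_contra hne
    have hpos := herm_pos g hs hg _ (sub_ne_zero.2 hne)
    rw [map_sub (herm g (a - _)), h _ hk, ← herm_map_adj A hg hs hs', hk] at hpos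
    simp at hpos
  · rintro ⟨hb, ha⟩
    refine ⟨fun u hu => ?_, hb⟩
    rw [ha, ← herm_map_adj A hg hs hs', hu]
    simp

/-- The orthogonal complement of the graph of a partial isometry, as the kernel of an operator made
of `Λ(A)` and `Λ(A^*)`. -/
lemma orthogonal_graph_iff (hg : ∀ v, v ≠ 0 → 0 < g v v) (hs : ∀ v w, g v w = g w v)
    (hs' : ∀ v w, g' v w = g' w v) (hA : IsPartialIsometry g g' A) (a : Lam n) (b : Lam m) :
    (∀ v w, w = map A v → v = map (adj g g' A) w → herm g v a + herm g' w b = 0) ↔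
      map (adj g g' A) (map A a) + map (adj g g' A) b = 0 := by
  have hAA : ∀ c, map A (map (adj g g' A) (map A c)) = map A c := fun c => by
    rw [← map_comp_apply, ← map_comp_apply]
    exact congrArg (fun B : Euc n →L[ℝ] Euc m => map B c) (ContinuousLinearMap.ext hA)
  have hP : ∀ c, herm g (map (adj g g' A) (map A c)) a = herm g c (map (adj g g' A) (map A a)) := by
    intro c
    rw [← herm_map_adj A hg hs hs', herm_symm g hs, ← herm_map_adj A hg hs hs',
      ← herm_symm g' hs']
  constructor
  · intro h
    by_contra hne
    have hpos := herm_pos g hs hg _ hne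
    have h1 := h (map (adj g g' A) (map A (map (adj g g' A) (map A a) + map (adj g g' A) b)))
      (map A (map (adj g g' A) (map A a) + map (adj g g' A) b)) (hAA _).symm rfl
    rw [hP, herm_map_adj A hg hs hs', ← map_add] at h1
    rw [h1] at hpos
    simp at hpos
  · rintro h v w rfl hv
    have e : herm g v a = herm g v (map (adj g g' A) (map A a)) := by
      rw [← hP, ← hv]
    rw [e, herm_map_adj A hg hs hs', ← map_add, h, map_zero]

end Lam

end Adjoint

/-! ### Covariant differentiation along maps -/

namespace RMfd

variable {M N : RMfd}

section

variable {P : Type} [NormedAddCommGroup P] [NormedSpace ℝ P]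

/-- The covariant derivative of a vector field along `p`, in terms of the Christoffel symbols. -/
noncomputable def covE (p : P → M) (X : P → Euc M.dim) (t u : P) : Euc M.dim :=
  fderiv ℝ (fun s => co (p t) (p s) (X s)) t u + Γ (p t) (vel p t u) (X t)

lemma map_co_self (x : M) (a : Lam M.dim) : Lam.map (co x x) a = a := by
  rw [co_self, Lam.map_id_apply]

lemma nablaLam_of_eventually_const {s : M → Lam M.dim} {x : M} {a : Lam M.dim}
    (h : (fun y => Lam.map (co x y) (s y)) =ᶠ[𝓝 x] fun _ => a) (u : Euc M.dim) :
    nablaLam M s x u = Lam.der (Γ x u) a := by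
  have h0 : s x = a := (map_co_self x _).symm.trans h.self_of_nhds
  rw [nablaLam_apply, d_congr h, d_const, h0]
  exact zero_add _

/-- `covAlong` in terms of Christoffel symbols: the vector field along `p` is differentiated in the
preferred chart at `(a t).proj`, and the field with constant components contributes `Γ`. -/
lemma covAlong_leviCivita (a : P → TangentBundle M.I M) (t u : P) :
    covAlong (leviCivita M) a t u = covE (fun s => (a s).proj) (fun s => (a s).2) t u := by
  set x := (a t).proj with hx
  let e := trivializationAt (Euc M.dim) (TangentSpace M.I : M → Type) x
  have h0 : ∀ v : Euc M.dim, e.symm x v = v := fun v =>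
    (trivializationAt_symm (mem_src x) v).trans (by rw [oc_self]; rfl)
  have h1 : (e (a t)).2 = (a t).2 := by
    change co x x (a t).2 = _
    rw [co_self]; rfl
  have h2 : (fun y => (e.symm y (a t).2 : Euc M.dim)) =ᶠ[𝓝 x] fun y => oc x y (a t).2 := by
    filter_upwards [src_mem_nhds (mem_src x)] with y hy using trivializationAt_symm hy _
  have h3 : MDiffVF (fun y => (e.symm y (a t).2 : Euc M.dim)) x := by
    refine MDifferentiableAt.congr_of_eventuallyEq (mdiffVF_oc (mem_src x) (a t).2) ?_
    filter_upwards [h2] with y hy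
    exact congrArg (fun v : Euc M.dim => (⟨y, v⟩ : TangentBundle M.I M)) hy
  have h4 := nabla_congr h3 (mdiffVF_oc (mem_src x) (a t).2) h2
  have h5 := congrArg (fun T : Euc M.dim →L[ℝ] Euc M.dim => T (vel (fun s => (a s).proj) t u)) h4
  have h6 := h5.trans (nabla_oc_self x (vel (fun s => (a s).proj) t u) (a t).2)
  refine congrArg₂ (fun v w : Euc M.dim => v + w) (h0 _) (Eq.trans ?_ h6)
  exact congrArg (fun v : Euc M.dim => nabla M (fun y => (e.symm y v : Euc M.dim)) x
    (vel (fun s => (a s).proj) t u)) h1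

/-- The covariant derivative of a section of the Grassmann bundle along `p`. -/
noncomputable def covLam (p : P → M) (a : P → Lam M.dim) (t u : P) : Lam M.dim :=
  fderiv ℝ (fun s => Lam.map (co (p t) (p s)) (a s)) t u + Lam.der (Γ (p t) (vel p t u)) (a t)

/-- `covAlong` for the Grassmann bundle in terms of the derivations extending the Christoffel
symbols. -/
lemma covAlong_lamConn (a : P → TotalSpace (Lam M.dim) (LamFiber M)) (t u : P) :
    covAlong (lamConn M).toFun a t u = covLam (fun s => (a s).proj) (fun s => (a s).2) t u := by
  set x := (a t).proj with hx
  let e := trivializationAt (Lam M.dim) (LamFiber M) x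
  have hs : ∀ y ∈ src x, ∀ v : Lam M.dim, Lam.map (co x y) (e.symm y v) = v := fun y hy v =>
    congrArg Prod.snd (e.apply_mk_symm (show y ∈ e.baseSet from hy) v)
  have h0 : ∀ v : Lam M.dim, e.symm x v = v := fun v =>
    (map_co_self x _).symm.trans (hs x (mem_src x) v)
  have h1 : (e (a t)).2 = (a t).2 := map_co_self x (a t).2
  have h2 : (fun y => Lam.map (co x y) (e.symm y (a t).2)) =ᶠ[𝓝 x] fun _ => (a t).2 := by
    filter_upwards [src_mem_nhds (mem_src x)] with y hy using hs y hy _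
  have h6 := nablaLam_of_eventually_const h2 (vel (fun s => (a s).proj) t u)
  refine congrArg₂ (fun v w : Lam M.dim => v + w) (h0 _) (Eq.trans ?_ h6)
  exact congrArg (fun v : Lam M.dim => nablaLam M (fun y => (e.symm y v : Lam M.dim)) x
    (vel (fun s => (a s).proj) t u)) h1

lemma covLam_add {p : P → M} {a b : P → Lam M.dim} {t : P}
    (ha : DifferentiableAt ℝ (fun s => Lam.map (co (p t) (p s)) (a s)) t)
    (hb : DifferentiableAt ℝ (fun s => Lam.map (co (p t) (p s)) (b s)) t) (u : P) :
    covLam p (fun s => a s + b s) t u = covLam p a t u + covLam p b t u := by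
  have h := fderiv_fun_add ha hb
  simp only [covLam, map_add]
  rw [h, _root_.add_apply]
  abel

lemma covLam_zero (p : P → M) (t u : P) : covLam p (fun _ => 0) t u = 0 := by
  simp [covLam]

end

/-- A family of linear maps between tangent spaces along `p` and `q`, in the coordinates of the
preferred charts at `p t` and `q t`. -/
noncomputable def famCo {Q : Type*} (p : Q → M) (q : Q → N) (C : Q → Euc M.dim →L[ℝ] Euc N.dim)
    (t s : Q) : Euc M.dim →L[ℝ] Euc N.dim :=
  co (q t) (q s) ∘L C s ∘L oc (p t) (p s)

lemma famCo_self {Q : Type*} (p : Q → M) (q : Q → N) (C : Q → Euc M.dim →L[ℝ] Euc N.dim) (t : Q) :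
    famCo p q C t t = C t := by
  ext; simp [famCo]

lemma map_co_map {Q : Type*} (p : Q → M) (q : Q → N) (C : Q → Euc M.dim →L[ℝ] Euc N.dim) {t s : Q}
    (h : p s ∈ src (p t)) (a : Lam M.dim) :
    Lam.map (co (q t) (q s)) (Lam.map (C s) a) =
      Lam.map (famCo p q C t s) (Lam.map (co (p t) (p s)) a) := by
  rw [famCo, Lam.map_comp_apply, Lam.map_comp_apply, map_oc_co h]

section

variable {EQ HQ Q : Type*} [NormedAddCommGroup EQ] [NormedSpace ℝ EQ] [TopologicalSpace HQ]
  {J : ModelWithCorners ℝ EQ HQ} [TopologicalSpace Q] [ChartedSpace HQ Q]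

/-- A smooth family of linear maps between tangent spaces induces a smooth family of
homomorphisms of exterior algebras. -/
lemma contMDiffAt_map_family {p : Q → M} {q : Q → N} {C : Q → Euc M.dim →L[ℝ] Euc N.dim}
    {a : Q → Lam M.dim} {t : Q} (hq : ContMDiffAt J N.I ∞ q t)
    (hC : ContMDiffAt J 𝓘(ℝ, Euc M.dim →L[ℝ] Euc N.dim) ∞ (famCo p q C t) t)
    (ha : ContMDiffAt J (M.I.prod 𝓘(ℝ, Lam M.dim)) ∞
      (fun s => (⟨p s, a s⟩ : TotalSpace (Lam M.dim) (LamFiber M))) t) :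
    ContMDiffAt J (N.I.prod 𝓘(ℝ, Lam N.dim)) ∞
      (fun s => (⟨q s, Lam.map (C s) (a s)⟩ : TotalSpace (Lam N.dim) (LamFiber N))) t := by
  obtain ⟨hp, ha⟩ := (contMDiffAt_lam_iff_of_mem (x₀ := p t) (mem_src (p t))).1 ha
  refine (contMDiffAt_lam_iff_of_mem (x₀ := q t) (mem_src (q t))).2 ⟨hq, ?_⟩
  have h := (Lam.contDiff_mapL.contMDiff.contMDiffAt.comp t hC).clm_apply ha
  refine h.congr_of_eventuallyEq ?_
  filter_upwards [hp.continuousAt.eventually (src_mem_nhds (mem_src (p t)))] with s hs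
  exact map_co_map p q C hs (a s)

end

section

variable {P : Type} [NormedAddCommGroup P] [NormedSpace ℝ P]

/-- The covariant derivative commutes with `Λ(C)` if `C` is parallel; the hypothesis `hpar`
expresses in coordinates that the covariant derivative of `C` vanishes. -/
lemma covLam_map {p : P → M} {q : P → N} {C : P → Euc M.dim →L[ℝ] Euc N.dim} {a : P → Lam M.dim}
    {t u : P} (hp : ContinuousAt p t)
    (hC : DifferentiableAt ℝ (famCo p q C t) t)
    (ha : DifferentiableAt ℝ (fun s => Lam.map (co (p t) (p s)) (a s)) t)
    (hpar : fderiv ℝ (famCo p q C t) t u =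
      C t ∘L Γ (p t) (vel p t u) - Γ (q t) (vel q t u) ∘L C t) :
    covLam q (fun s => Lam.map (C s) (a s)) t u = Lam.map (C t) (covLam p a t u) := by
  have e : (fun s => Lam.map (co (q t) (q s)) (Lam.map (C s) (a s))) =ᶠ[𝓝 t]
      fun s => Lam.mapL (famCo p q C t s) (Lam.map (co (p t) (p s)) (a s)) := by
    filter_upwards [hp.eventually (src_mem_nhds (mem_src (p t)))] with s hs
    exact map_co_map p q C hs (a s)
  have hm := (Lam.hasFDerivAt_mapL (famCo p q C t t)).comp t hC.hasFDerivAt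
  have hd := (hm.clm_apply ha.hasFDerivAt).fderiv
  rw [famCo_self] at hd
  have hd' := congrArg (fun T : P →L[ℝ] Lam N.dim => T u) (e.fderiv_eq.trans hd)
  simp only [_root_.add_apply, ContinuousLinearMap.comp_apply, ContinuousLinearMap.flip_apply,
    hpar, map_sub, _root_.sub_apply, Lam.fderiv_mapL_comp_left, Lam.fderiv_mapL_comp_right,
    co_self, Lam.map_id_apply, Lam.mapL_apply, Function.comp_apply, famCo_self] at hd'
  rw [covLam, covLam, hd', map_add]
  abel

end

end RMfd

/-! ### The differential and its adjoint as families of linear maps -/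

namespace RMfd

variable {M N : RMfd}

/-- The adjoint of the differential with respect to the Riemannian metrics. -/
noncomputable def dEadj (f : M ⟶ N) (x : M) : Euc N.dim →L[ℝ] Euc M.dim :=
  adj (M.gE x) (N.gE (f x)) (dE f x)

lemma gE_dEadj (f : M ⟶ N) (x : M) (w : Euc N.dim) (v : Euc M.dim) :
    M.gE x (dEadj f x w) v = N.gE (f x) w (dE f x v) := apply_adj (M.gE_pos x) _ _ _

lemma eventually_mem_src (f : M ⟶ N) (x : M) : ∀ᶠ y in 𝓝 x, y ∈ src x ∧ f y ∈ src (f x) :=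
  Filter.Eventually.and (src_mem_nhds (mem_src x))
    ((f.smooth x).continuousAt.eventually (src_mem_nhds (mem_src (f x))))

/-- The adjoint can be formed in coordinates, which shows that it depends smoothly on the point. -/
lemma famCo_dEadj (f : M ⟶ N) {x y : M} (hy : y ∈ src x) (hfy : f y ∈ src (f x)) :
    famCo f.toFun id (dEadj f) x y =
      adj (gco x y) (gco (f x) (f y)) (famCo id f.toFun (dE f) x y) := by
  ext1 w
  refine eq_of_forall_apply_eq (gco_pos hy) fun v => ?_
  rw [apply_adj (gco_pos hy), gco_apply, gco_apply]
  have h1 : oc x y (famCo f.toFun id (dEadj f) x y w) = dEadj f y (oc (f x) (f y) w) :=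
    oc_co_apply hy _
  have h2 : oc (f x) (f y) (famCo id f.toFun (dE f) x y v) = dE f y (oc x y v) :=
    oc_co_apply hfy _
  rw [h1, h2, gE_dEadj]

lemma contMDiffAt_famCo_dE (f : M ⟶ N) (x : M) :
    ContMDiffAt M.I 𝓘(ℝ, Euc M.dim →L[ℝ] Euc N.dim) ∞ (famCo id f.toFun (dE f) x) x :=
  contMDiffAt_dE f x

lemma contMDiffAt_famCo_dEadj (f : M ⟶ N) (x : M) :
    ContMDiffAt M.I 𝓘(ℝ, Euc N.dim →L[ℝ] Euc M.dim) ∞ (famCo f.toFun id (dEadj f) x) x := by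
  have h1 := contMDiffAt_inverse (contMDiffAt_gco x) (gco_pos (mem_src x))
  have h2 := (contMDiffAt_gco (f x)).comp x (f.smooth x)
  refine contMDiffAt_clm_of_apply fun w => ?_
  refine (h1.clm_apply ((h2.clm_apply (contMDiffAt_const (c := w))).clm_comp
    (contMDiffAt_famCo_dE f x))).congr_of_eventuallyEq
      (f₁ := fun y => famCo f.toFun id (dEadj f) x y w) ?_
  filter_upwards [eventually_mem_src f x] with y hy
  exact congrArg (fun T : Euc N.dim →L[ℝ] Euc M.dim => T w) (famCo_dEadj f hy.1 hy.2)

lemma d_comp_map (f : M ⟶ N) {F : Type*} [NormedAddCommGroup F] [NormedSpace ℝ F] {h : N → F}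
    {x : M} (hh : MDifferentiableAt N.I 𝓘(ℝ, F) h (f x)) (u : Euc M.dim) :
    M.d (fun y => h (f y)) x u = N.d h (f x) (dE f x u) :=
  congrArg (fun T : Euc M.dim →L[ℝ] F => T u)
    (mfderiv_comp (I'' := 𝓘(ℝ, F)) x hh ((f.smooth x).mdifferentiableAt (by simp)))

lemma vel_comp_map (f : M ⟶ N) {P : Type*} [NormedAddCommGroup P] [NormedSpace ℝ P] {p : P → M}
    {t : P} (hp : MDifferentiableAt 𝓘(ℝ, P) M.I p t) (u : P) :
    vel (fun s => f (p s)) t u = dE f (p t) (vel p t u) :=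
  congrArg (fun T : P →L[ℝ] Euc N.dim => T u)
    (mfderiv_comp (I' := M.I) t ((f.smooth (p t)).mdifferentiableAt (by simp)) hp)

/-! ### Totally geodesic maps -/

/-- A smooth curve through `x` with initial velocity a given vector up to a scalar, which stays
in the domain of the chart at `x`. -/
lemma exists_curve (x : M) (u : Euc M.dim) : ∃ (r : ℝ) (c : ℝ → M), r ≠ 0 ∧
    ContMDiff 𝓘(ℝ, ℝ) M.I ∞ c ∧ c 0 = x ∧ (∀ s, c s ∈ src x) ∧ vel c 0 1 = r • u := by
  obtain ⟨ε, hε, hball⟩ := Metric.isOpen_iff.1 (isOpen_extChartAt_target (I := M.I) x)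
    (extChartAt M.I x x) (mem_extChartAt_target x)
  obtain ⟨r, hr0, hr⟩ : ∃ r : ℝ, 0 < r ∧ r * ‖u‖ < ε := by
    refine ⟨ε / (‖u‖ + 1), by positivity, ?_⟩
    rw [div_mul_eq_mul_div, div_lt_iff₀ (by positivity)]
    nlinarith [norm_nonneg u]
  -- The sine keeps the curve inside the chart for all times.
  let k : ℝ → Euc M.dim := fun s => extChartAt M.I x x + Real.sin s • (r • u)
  have hk : ∀ s, k s ∈ (extChartAt M.I x).target := fun s => by
    refine hball ?_
    rw [Metric.mem_ball, dist_eq_norm, add_sub_cancel_left, norm_smul, norm_smul, Real.norm_eq_abs,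
      Real.norm_eq_abs, abs_of_pos hr0]
    calc |Real.sin s| * (r * ‖u‖) ≤ 1 * (r * ‖u‖) := by
          gcongr; exact Real.abs_sin_le_one s
      _ < ε := by rwa [one_mul]
  have hks : ContDiff ℝ ∞ k := contDiff_const.add (Real.contDiff_sin.smul contDiff_const)
  let c : ℝ → M := fun s => (extChartAt M.I x).symm (k s)
  have hc : ContMDiff 𝓘(ℝ, ℝ) M.I ∞ c :=
    (contMDiffOn_extChartAt_symm x).comp_contMDiff hks.contMDiff hk
  have hsrc : ∀ s, c s ∈ src x := fun s => by
    have := (extChartAt M.I x).map_target (hk s)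
    rwa [extChartAt_source] at this
  have hc0 : c 0 = x := by
    simp only [c, k, Real.sin_zero, zero_smul, add_zero]
    exact extChartAt_to_inv x
  refine ⟨r, c, hr0.ne', hc, hc0, hsrc, ?_⟩
  have h1 : MDifferentiableAt M.I 𝓘(ℝ, Euc M.dim) (extChartAt M.I x) (c 0) :=
    mdifferentiableAt_extChartAt (hsrc 0)
  have h2 := fderiv_comp_vel h1 ((hc 0).mdifferentiableAt (by simp)) 1
  have h3 : (fun s => extChartAt M.I x (c s)) = k := funext fun s =>
    (extChartAt M.I x).right_inv (hk s)
  have h4 : HasDerivAt k (r • u) 0 := by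
    have := ((Real.hasDerivAt_sin 0).smul_const (r • u)).const_add (extChartAt M.I x x)
    rwa [Real.cos_zero, one_smul] at this
  have h5 : M.d (extChartAt M.I x) x = ContinuousLinearMap.id ℝ _ :=
    (mfderiv_extChartAt (mem_src x)).trans (co_self x)
  rw [h3, h4.hasFDerivAt.fderiv, hc0, h5] at h2
  simpa using h2.symm

/-- The differential of a totally geodesic map is parallel: total geodesy is tested on vector fields
with constant components along curves with arbitrary velocity. -/
lemma d_famCo_dE {f : M ⟶ N} (hf : IsTotallyGeodesic f) (x : M) (u : Euc M.dim) :
    M.d (famCo id f.toFun (dE f) x) x u =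
      dE f x ∘L Γ x u - Γ (f x) (dE f x u) ∘L dE f x := by
  ext1 v
  obtain ⟨r, c, hr, hc, hc0, hsrc, hvel⟩ := exists_curve x u
  let σ : ℝ → TangentBundle M.I M := fun s => ⟨c s, oc x (c s) v⟩
  have hσ : ContMDiff 𝓘(ℝ, ℝ) M.I.tangent ∞ σ := fun s =>
    (contMDiffAt_tangent_iff_of_mem (hsrc s)).2 ⟨hc s,
      (contMDiffAt_const (c := v)).congr_of_eventuallyEq
        (Filter.Eventually.of_forall fun s => co_oc_apply (hsrc s) v)⟩
  have hcd : MDifferentiableAt 𝓘(ℝ, ℝ) M.I c 0 := (hc 0).mdifferentiableAt (by simp)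
  have H : dE f (c 0) (covE c (fun s => oc x (c s) v) 0 1) =
      covE (fun s => f (c s)) (fun s => dE f (c s) (oc x (c s) v)) 0 1 :=
    (congrArg (dE f (c 0)) (covAlong_leviCivita σ 0 1)).symm.trans ((hf σ hσ 0).trans
      (covAlong_leviCivita (fun s => tangentMap M.I N.I f.toFun (σ s)) 0 1))
  have hA : MDifferentiableAt M.I 𝓘(ℝ, Euc M.dim →L[ℝ] Euc N.dim) (famCo id f.toFun (dE f) x) x :=
    (contMDiffAt_famCo_dE f x).mdifferentiableAt (by simp)
  have hv : MDifferentiableAt M.I 𝓘(ℝ, Euc M.dim) (fun _ : M => v) x := mdifferentiableAt_const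
  have h1 : (fun s => co x (c s) (oc x (c s) v)) = fun _ => v :=
    funext fun s => co_oc_apply (hsrc s) v
  have h2 : fderiv ℝ (fun s => famCo id f.toFun (dE f) x (c s) v) 0 1 =
      r • M.d (famCo id f.toFun (dE f) x) x u v := by
    have h := fderiv_comp_vel (f := fun y => famCo id f.toFun (dE f) x y v) (p := c) (t := 0)
      (by rw [hc0]; exact mdiff_clm_apply hA hv) hcd 1
    rw [h, hc0, hvel, map_smul, d_clm_apply hA hv, d_const]
    simp
  rw [covE, covE, vel_comp_map f hcd, hc0, h1, hvel] at H
  change _ = fderiv ℝ (fun s => famCo id f.toFun (dE f) x (c s) v) 0 1 + _ at H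
  rw [h2] at H
  simp only [fderiv_fun_const, oc_self, map_smul, Pi.zero_apply, _root_.smul_apply,
    ContinuousLinearMap.coe_id', id_eq, _root_.zero_apply, zero_add, ← smul_add] at H
  have H' := smul_right_injective _ hr H
  rw [_root_.sub_apply]
  exact eq_sub_of_add_eq H'.symm

/-- The adjoint of the differential of a totally geodesic map is parallel, since the Levi-Civita
connections are metric. -/
lemma d_famCo_dEadj {f : M ⟶ N} (hf : IsTotallyGeodesic f) (x : M) (u : Euc M.dim) :
    M.d (famCo f.toFun id (dEadj f) x) x u =
      dEadj f x ∘L Γ (f x) (dE f x u) - Γ x u ∘L dEadj f x := by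
  ext1 w
  refine eq_of_forall_apply_eq (M.gE_pos x) fun v => ?_
  have hA : MDifferentiableAt M.I 𝓘(ℝ, Euc M.dim →L[ℝ] Euc N.dim) (famCo id f.toFun (dE f) x) x :=
    (contMDiffAt_famCo_dE f x).mdifferentiableAt (by simp)
  have hB : MDifferentiableAt M.I 𝓘(ℝ, Euc N.dim →L[ℝ] Euc M.dim)
      (famCo f.toFun id (dEadj f) x) x :=
    (contMDiffAt_famCo_dEadj f x).mdifferentiableAt (by simp)
  have hg := (contMDiffAt_gco x).mdifferentiableAt (by simp : (∞ : ℕ∞ω) ≠ 0)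
  have hg' := (contMDiffAt_gco (f x)).mdifferentiableAt (by simp : (∞ : ℕ∞ω) ≠ 0)
  have hgf : MDifferentiableAt M.I 𝓘(ℝ, Euc N.dim →L[ℝ] Euc N.dim →L[ℝ] ℝ)
      (fun y => gco (f x) (f y)) x :=
    ((contMDiffAt_gco (f x)).comp x (f.smooth x)).mdifferentiableAt (by simp)
  have hv : MDifferentiableAt M.I 𝓘(ℝ, Euc M.dim) (fun _ : M => v) x := mdifferentiableAt_const
  have hw : MDifferentiableAt M.I 𝓘(ℝ, Euc N.dim) (fun _ : M => w) x := mdifferentiableAt_const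
  have e : (fun y => gco x y (famCo f.toFun id (dEadj f) x y w) v) =ᶠ[𝓝 x]
      fun y => gco (f x) (f y) w (famCo id f.toFun (dE f) x y v) := by
    filter_upwards [eventually_mem_src f x] with y hy
    rw [famCo_dEadj f hy.1 hy.2, apply_adj (gco_pos hy.1)]
  have h : M.d (fun y => gco x y (famCo f.toFun id (dEadj f) x y w) v) x u =
      M.d (fun y => gco (f x) (f y) w (famCo id f.toFun (dE f) x y v)) x u := by rw [d_congr e]
  rw [d_clm_apply (mdiff_clm_apply hg (mdiff_clm_apply hB hw)) hv,
    d_clm_apply hg (mdiff_clm_apply hB hw), d_clm_apply hB hw,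
    d_clm_apply (mdiff_clm_apply hgf hw) (mdiff_clm_apply hA hv), d_clm_apply hgf hw,
    d_clm_apply hA hv, d_comp_map f hg', d_const, d_const, d_famCo_dE hf, famCo_self, famCo_self]
    at h
  simp only [map_zero, add_zero, _root_.add_apply, _root_.sub_apply, _root_.zero_apply, gco_self,
    d_gco_eq, map_sub, gE_dEadj, ContinuousLinearMap.comp_apply] at h
  simp only [map_sub, _root_.sub_apply, ContinuousLinearMap.comp_apply, gE_dEadj]
  linarith

/-! ### The induced maps of Grassmann bundles -/

section

variable {EQ HQ Q : Type*} [NormedAddCommGroup EQ] [NormedSpace ℝ EQ] [TopologicalSpace HQ]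
  {J : ModelWithCorners ℝ EQ HQ} [TopologicalSpace Q] [ChartedSpace HQ Q]

lemma contMDiffAt_map_dE (f : M ⟶ N) {p : Q → M} {a : Q → Lam M.dim} {t : Q}
    (ha : ContMDiffAt J (M.I.prod 𝓘(ℝ, Lam M.dim)) ∞
      (fun s => (⟨p s, a s⟩ : TotalSpace (Lam M.dim) (LamFiber M))) t) :
    ContMDiffAt J (N.I.prod 𝓘(ℝ, Lam N.dim)) ∞
      (fun s => (⟨f (p s), Lam.map (dE f (p s)) (a s)⟩ :
        TotalSpace (Lam N.dim) (LamFiber N))) t := by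
  have hp := ((contMDiffAt_lam_iff_of_mem (x₀ := p t) (mem_src (p t))).1 ha).1
  exact contMDiffAt_map_family (q := fun s => f (p s)) (C := fun s => dE f (p s))
    ((f.smooth (p t)).comp t hp) ((contMDiffAt_famCo_dE f (p t)).comp t hp) ha

lemma contMDiffAt_map_dEadj (f : M ⟶ N) {p : Q → M} {b : Q → Lam N.dim} {t : Q}
    (hp : ContMDiffAt J M.I ∞ p t)
    (hb : ContMDiffAt J (N.I.prod 𝓘(ℝ, Lam N.dim)) ∞
      (fun s => (⟨f (p s), b s⟩ : TotalSpace (Lam N.dim) (LamFiber N))) t) :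
    ContMDiffAt J (M.I.prod 𝓘(ℝ, Lam M.dim)) ∞
      (fun s => (⟨p s, Lam.map (dEadj f (p s)) (b s)⟩ : TotalSpace (Lam M.dim) (LamFiber M))) t :=
  contMDiffAt_map_family (p := fun s => f (p s)) (C := fun s => dEadj f (p s)) hp
    ((contMDiffAt_famCo_dEadj f (p t)).comp t hp) hb

end

section

variable {P : Type} [NormedAddCommGroup P] [NormedSpace ℝ P] {p : P → M} {t : P}

lemma covLam_map_dE {f : M ⟶ N} (hf : IsTotallyGeodesic f) {a : P → Lam M.dim}
    (hp : MDifferentiableAt 𝓘(ℝ, P) M.I p t)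
    (ha : DifferentiableAt ℝ (fun s => Lam.map (co (p t) (p s)) (a s)) t) (u : P) :
    covLam (fun s => f (p s)) (fun s => Lam.map (dE f (p s)) (a s)) t u =
      Lam.map (dE f (p t)) (covLam p a t u) := by
  have hA : MDifferentiableAt M.I 𝓘(ℝ, Euc M.dim →L[ℝ] Euc N.dim)
      (famCo id f.toFun (dE f) (p t)) (p t) :=
    (contMDiffAt_famCo_dE f (p t)).mdifferentiableAt (by simp)
  refine covLam_map (q := fun s => f (p s)) (C := fun s => dE f (p s)) hp.continuousAt
    (hA.comp t hp).differentiableAt ha ?_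
  refine (fderiv_comp_vel hA hp u).trans ?_
  rw [d_famCo_dE hf, vel_comp_map f hp]

lemma covLam_map_dEadj {f : M ⟶ N} (hf : IsTotallyGeodesic f) {b : P → Lam N.dim}
    (hp : MDifferentiableAt 𝓘(ℝ, P) M.I p t)
    (hb : DifferentiableAt ℝ (fun s => Lam.map (co (f (p t)) (f (p s))) (b s)) t) (u : P) :
    covLam p (fun s => Lam.map (dEadj f (p s)) (b s)) t u =
      Lam.map (dEadj f (p t)) (covLam (fun s => f (p s)) b t u) := by
  have hA : MDifferentiableAt M.I 𝓘(ℝ, Euc N.dim →L[ℝ] Euc M.dim)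
      (famCo f.toFun id (dEadj f) (p t)) (p t) :=
    (contMDiffAt_famCo_dEadj f (p t)).mdifferentiableAt (by simp)
  refine covLam_map (p := fun s => f (p s)) (q := p) (C := fun s => dEadj f (p s))
    ((f.smooth (p t)).continuousAt.comp hp.continuousAt)
    (hA.comp t hp).differentiableAt hb ?_
  refine (fderiv_comp_vel hA hp u).trans ?_
  rw [d_famCo_dEadj hf, vel_comp_map f hp]

end

end RMfd

/-! ### Riemannian embeddings and submersions -/

namespace RMfd

variable {M N P : RMfd}

lemma dE_id (x : M) : dE (𝟙 M) x = ContinuousLinearMap.id ℝ _ :=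
  ContinuousLinearMap.ext fun v => differential_id x v

lemma dE_comp (f : M ⟶ N) (h : N ⟶ P) (x : M) : dE (f ≫ h) x = dE h (f x) ∘L dE f x :=
  ContinuousLinearMap.ext fun v => differential_comp f h x v

lemma dEadj_id (x : M) : dEadj (𝟙 M) x = ContinuousLinearMap.id ℝ _ := by
  ext1 w
  refine eq_of_forall_apply_eq (M.gE_pos x) fun v => ?_
  rw [gE_dEadj, dE_id]
  rfl

lemma dEadj_comp (f : M ⟶ N) (h : N ⟶ P) (x : M) :
    dEadj (f ≫ h) x = dEadj f x ∘L dEadj h (f x) := by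
  ext1 w
  refine eq_of_forall_apply_eq (M.gE_pos x) fun v => ?_
  rw [gE_dEadj, dE_comp, ContinuousLinearMap.comp_apply, ContinuousLinearMap.comp_apply, gE_dEadj,
    gE_dEadj]
  rfl

/-- The differential of `f` is fibrewise isometric, encoded as `(Df)^* Df = 1`. -/
def IsIsom (f : M ⟶ N) : Prop := ∀ x v, dEadj f x (dE f x v) = v

/-- The differential of `f` is fibrewise co-isometric, encoded as `Df (Df)^* = 1`. -/
def IsCoisom (f : M ⟶ N) : Prop := ∀ x w, dE f x (dEadj f x w) = w

lemma isIsom_of_isRiemEmb {f : M ⟶ N} (hf : IsRiemEmb f) : IsIsom f := fun x v => by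
  refine eq_of_forall_apply_eq (M.gE_pos x) fun u => ?_
  rw [gE_dEadj]
  exact hf.2 x v u

lemma isHorizontal_dEadj (f : M ⟶ N) (x : M) (w : Euc N.dim) : IsHorizontal f x (dEadj f x w) := by
  intro u hu
  have h := gE_dEadj f x w u
  have h' : dE f x u = 0 := hu
  rw [h', map_zero] at h
  exact h

lemma isCoisom_of_isRiemSub {f : M ⟶ N} (hf : IsRiemSub f) : IsCoisom f := fun x w => by
  refine eq_of_forall_apply_eq (N.gE_pos (f x)) fun u => ?_
  obtain ⟨v, hv⟩ := hf.1 x u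
  have hv' : dE f x v = u := hv
  have h : N.gE (f x) (dE f x (dEadj f x w)) (dE f x v) = M.gE x (dEadj f x w) v :=
    hf.2 x _ v (isHorizontal_dEadj f x w)
  rw [← hv', h]
  exact gE_dEadj f x w v

lemma isPartialIsometry {f : M ⟶ N} (hf : IsIsom f ∨ IsCoisom f) (x : M) :
    IsPartialIsometry (M.gE x) (N.gE (f x)) (dE f x) := fun v => by
  rcases hf with hf | hf
  · exact congrArg (dE f x) (hf x v)
  · exact hf x _

/-- The adjoint of the differential inverts the differential on horizontal vectors. -/
lemma dEadj_dE_of_isHorizontal {f : M ⟶ N} (hf : IsIsom f ∨ IsCoisom f) {x : M} {v : Euc M.dim}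
    (hv : IsHorizontal f x v) : dEadj f x (dE f x v) = v := by
  have hk : dE f x (v - dEadj f x (dE f x v)) = 0 := by
    have h : dE f x (dEadj f x (dE f x v)) = dE f x v := isPartialIsometry hf x v
    rw [map_sub, h, sub_self]
  have h1 : M.gE x v (v - dEadj f x (dE f x v)) = 0 := hv _ hk
  have h2 : M.gE x (dEadj f x (dE f x v)) (v - dEadj f x (dE f x v)) = 0 := by
    rw [gE_dEadj, hk, map_zero]
  by_contra hne
  have h3 := M.gE_pos x _ (sub_ne_zero.2 (Ne.symm hne))
  rw [map_sub (M.gE x), _root_.sub_apply, h1, h2, sub_zero] at h3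
  exact lt_irrefl _ h3

lemma map_dEadj_map_dE {f : M ⟶ N} (hf : IsIsom f) (x : M) (v : Lam M.dim) :
    Lam.map (dEadj f x) (Lam.map (dE f x) v) = v := by
  rw [← Lam.map_comp_apply]
  have : dEadj f x ∘L dE f x = ContinuousLinearMap.id ℝ _ := ContinuousLinearMap.ext (hf x)
  rw [this, Lam.map_id_apply]

lemma map_dE_map_dEadj {f : M ⟶ N} (hf : IsCoisom f) (x : M) (w : Lam N.dim) :
    Lam.map (dE f x) (Lam.map (dEadj f x) w) = w := by
  rw [← Lam.map_comp_apply]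
  have : dE f x ∘L dEadj f x = ContinuousLinearMap.id ℝ _ := ContinuousLinearMap.ext (hf x)
  rw [this, Lam.map_id_apply]

/-! ### The propagator of a map -/

/-- `Λ(Df)` and `Λ((Df)^*)` map `v` and `w` to each other. -/
def MutualImage (f : M ⟶ N) (x : M) (v : Lam M.dim) (w : Lam N.dim) : Prop :=
  w = Lam.map (dE f x) v ∧ v = Lam.map (dEadj f x) w

/-- The propagator which over `x` consists of the pairs which `Λ(Df)` and `Λ((Df)^*)` map to each
other. For Riemannian embeddings and submersions it is both the Grassmann and the Clifford
propagator. -/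
noncomputable def mutualSpan (f : M ⟶ N) : Span (toHerm lamDirac M) (toHerm lamDirac N) :=
  graphSpan (A := toHerm lamDirac M) (B := toHerm lamDirac N) f fun x v w => MutualImage f x v w

lemma mutualSpan_rel {f : M ⟶ N} {x : M} {v : Lam M.dim} {w : Lam N.dim} :
    (mutualSpan f).rel x ⟨x, v⟩ ⟨f x, w⟩ ↔ MutualImage f x v w := by
  constructor
  · rintro ⟨v', w', h, hv, hw⟩
    obtain rfl := eq_of_heq (TotalSpace.mk.inj hv).2
    obtain rfl := eq_of_heq (TotalSpace.mk.inj hw).2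
    exact h
  · exact fun h => ⟨v, w, h, rfl, rfl⟩

lemma herm_eq_of_mutualImage {f : M ⟶ N} {x : M} {v : Lam M.dim} {w : Lam N.dim}
    (h : MutualImage f x v w) : Lam.herm (M.gE x) v v = Lam.herm (N.gE (f x)) w w := by
  have h1 := Lam.herm_map_adj (dE f x) (M.gE_pos x) (M.gE_symm x) (N.gE_symm (f x)) v w
  rw [← h.1] at h1
  exact (h1.trans (congrArg (Lam.herm (M.gE x) v) h.2.symm)).symm

/-- The axioms of propagators hold for every smooth map: the condition is symmetric in `Λ(Df)` and
`Λ((Df)^*)`, which are adjoint to each other and both depend smoothly on the point. -/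
lemma isPropagator_mutualSpan (f : M ⟶ N) : (mutualSpan f).IsPropagator where
  zero x := mutualSpan_rel.2 ⟨(map_zero _).symm, (map_zero _).symm⟩
  add := by
    rintro r x y v w v' w' ⟨v₁, w₁, h, hv, hw⟩ h'
    obtain ⟨rfl, hv⟩ := TotalSpace.mk.inj hv
    obtain ⟨rfl, hw⟩ := TotalSpace.mk.inj hw
    obtain rfl := eq_of_heq hv
    obtain rfl := eq_of_heq hw
    have h₂ := mutualSpan_rel.1 h'
    refine mutualSpan_rel.2 ⟨?_, ?_⟩
    · exact (congrArg₂ (fun p q : Lam N.dim => p + q) h.1 h₂.1).trans (map_add _ _ _).symm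
    · exact (congrArg₂ (fun p q : Lam M.dim => p + q) h.2 h₂.2).trans (map_add _ _ _).symm
  smul := by
    rintro r x y v w c ⟨v₁, w₁, h, hv, hw⟩
    obtain ⟨rfl, hv⟩ := TotalSpace.mk.inj hv
    obtain ⟨rfl, hw⟩ := TotalSpace.mk.inj hw
    obtain rfl := eq_of_heq hv
    obtain rfl := eq_of_heq hw
    refine mutualSpan_rel.2 ⟨?_, ?_⟩
    · exact (congrArg (fun p : Lam N.dim => c • p) h.1).trans (map_smul _ _ _).symm
    · exact (congrArg (fun p : Lam M.dim => c • p) h.2).trans (map_smul _ _ _).symm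
  isometric := by
    rintro r x y v w ⟨v₁, w₁, h, hv, hw⟩
    obtain ⟨rfl, hv⟩ := TotalSpace.mk.inj hv
    obtain ⟨rfl, hw⟩ := TotalSpace.mk.inj hw
    obtain rfl := eq_of_heq hv
    obtain rfl := eq_of_heq hw
    exact herm_eq_of_mutualImage h
  smooth := by
    intro k p a b hp h
    choose v w h ha hb using h
    obtain rfl := funext ha
    obtain rfl := funext hb
    constructor
    · intro hs t
      refine (contMDiffAt_map_dE f (hs t)).congr_of_eventuallyEq
        (Filter.Eventually.of_forall fun s => ?_)
      exact congrArg (fun c : Lam N.dim => (⟨f (p s), c⟩ : TotalSpace (Lam N.dim) (LamFiber N)))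
        (h s).1
    · intro hs t
      refine (contMDiffAt_map_dEadj f (ContMDiff.contMDiffAt hp) (hs t)).congr_of_eventuallyEq
        (Filter.Eventually.of_forall fun s => ?_)
      exact congrArg (fun c : Lam M.dim => (⟨p s, c⟩ : TotalSpace (Lam M.dim) (LamFiber M))) (h s).2

lemma graphSpan_congr {A B : HermBundle} (f : A.base ⟶ B.base)
    {G G' : ∀ x, A.bundle.fiber x → B.bundle.fiber (f x) → Prop} (h : ∀ x v w, G x v w ↔ G' x v w) :
    graphSpan f G = graphSpan f G' := by
  obtain rfl : G = G' := funext fun x => funext fun v => funext fun w => propext (h x v w)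
  rfl

lemma graphSpan_rel_congr {A B : HermBundle} (f : A.base ⟶ B.base)
    {G G' : ∀ x, A.bundle.fiber x → B.bundle.fiber (f x) → Prop} (h : ∀ x v w, G x v w ↔ G' x v w) :
    ((graphSpan f G).rel : A.base → A.Tot → B.Tot → Prop) = (graphSpan f G').rel := by
  obtain rfl : G = G' := funext fun x => funext fun v => funext fun w => propext (h x v w)
  rfl

lemma grassmannSpan_eq {f : M ⟶ N} (hf : IsIsom f ∨ IsCoisom f) :
    grassmannSpan lamDirac lamEquiv f = mutualSpan f :=
  graphSpan_congr (A := toHerm lamDirac M) (B := toHerm lamDirac N) f fun x v w =>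
    Lam.graph_iff (dE f x) (M.gE_pos x) (M.gE_symm x) (N.gE_symm (f x)) (isPartialIsometry hf x) v w

/-! ### The Clifford propagator -/

lemma mutualImage_one (f : M ⟶ N) (x : M) : MutualImage f x 1 1 :=
  ⟨(map_one _).symm, (map_one _).symm⟩

/-- Both `Df` and its adjoint are isometric on the pair `u`, `Df u`. -/
lemma mutualImage_cliff {f : M ⟶ N} {x : M} {u : Euc M.dim} (hu : dEadj f x (dE f x u) = u)
    {v : Lam M.dim} {w : Lam N.dim} (h : MutualImage f x v w) (ε : ℝ) :
    MutualImage f x (Lam.cliff ε (M.gE x) u v) (Lam.cliff ε (N.gE (f x)) (dE f x u) w) := by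
  have h1 : ∀ z, N.gE (f x) (dE f x u) (dE f x z) = M.gE x u z := fun z => by
    rw [← gE_dEadj, hu]
  have h2 : ∀ z, M.gE x (dEadj f x (dE f x u)) (dEadj f x z) = N.gE (f x) (dE f x u) z :=
    fun z => by
    rw [hu, M.gE_symm, gE_dEadj, N.gE_symm]
  constructor
  · rw [Lam.map_cliff _ h1, ← h.1]
  · rw [Lam.map_cliff _ h2, ← h.2, hu]

lemma mutualImage_invol {f : M ⟶ N} {x : M} {v : Lam M.dim} {w : Lam N.dim}
    (h : MutualImage f x v w) : MutualImage f x (Lam.invol v) (Lam.invol w) :=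
  ⟨by rw [Lam.map_invol, ← h.1], by rw [Lam.map_invol, ← h.2]⟩

lemma mutualImage_lmulC_cvec {f : M ⟶ N} {x : M} {u : Euc M.dim}
    (hu : dEadj f x (dE f x u) = u) {v : Lam M.dim} {w : Lam N.dim} (h : MutualImage f x v w) :
    MutualImage f x (lmulC x (cvecE M x u) v) (lmulC (f x) (cvecE N (f x) (dE f x u)) w) := by
  rw [lmulC_cvec, lmulC_cvec]
  exact mutualImage_cliff hu h _

lemma mutualImage_rmulC_cvec {f : M ⟶ N} {x : M} {u : Euc M.dim}
    (hu : dEadj f x (dE f x u) = u) {v : Lam M.dim} {w : Lam N.dim} (h : MutualImage f x v w) :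
    MutualImage f x (rmulC x (cvecE M x u) v) (rmulC (f x) (cvecE N (f x) (dE f x u)) w) := by
  rw [rmulC_cvec, rmulC_cvec]
  exact mutualImage_cliff hu (mutualImage_invol h) _

lemma lmulC_mul (x : M) (a b : Clifford M x) (v : Lam M.dim) :
    lmulC x (a * b) v = lmulC x a (lmulC x b v) := by simp [lmulC, mul_assoc]

lemma lmulC_add (x : M) (a b : Clifford M x) (v : Lam M.dim) :
    lmulC x (a + b) v = lmulC x a v + lmulC x b v := by simp [lmulC, add_mul]

lemma lmulC_algebraMap (x : M) (c : ℂ) (v : Lam M.dim) :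
    lmulC x (algebraMap ℂ (Clifford M x) c) v = c • v := by
  simp [lmulC, Algebra.algebraMap_eq_smul_one]

lemma rmulC_mul (x : M) (a b : Clifford M x) (v : Lam M.dim) :
    rmulC x (a * b) v = rmulC x b (rmulC x a v) := by simp [rmulC, mul_assoc]

lemma rmulC_add (x : M) (a b : Clifford M x) (v : Lam M.dim) :
    rmulC x (a + b) v = rmulC x a v + rmulC x b v := by simp [rmulC, mul_add]

lemma rmulC_algebraMap (x : M) (c : ℂ) (v : Lam M.dim) :
    rmulC x (algebraMap ℂ (Clifford M x) c) v = c • v := by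
  simp [rmulC, Algebra.algebraMap_eq_smul_one]

lemma MutualImage.add {f : M ⟶ N} {x : M} {v v' : Lam M.dim} {w w' : Lam N.dim}
    (h : MutualImage f x v w) (h' : MutualImage f x v' w') : MutualImage f x (v + v') (w + w') :=
  ⟨by rw [map_add, ← h.1, ← h'.1], by rw [map_add, ← h.2, ← h'.2]⟩

lemma MutualImage.smul {f : M ⟶ N} {x : M} {v : Lam M.dim} {w : Lam N.dim} (c : ℂ)
    (h : MutualImage f x v w) : MutualImage f x (c • v) (c • w) :=
  ⟨by rw [map_smul, ← h.1], by rw [map_smul, ← h.2]⟩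

/-- The propagator is stable under the Clifford actions. -/
lemma mutualImage_mulC {f : M ⟶ N} (hf : IsIsom f ∨ IsCoisom f) {x : M}
    {p : Clifford M x × Clifford N (f x)} (hp : p ∈ cliffordGraph f x) :
    ∀ {v : Lam M.dim} {w : Lam N.dim}, MutualImage f x v w →
      MutualImage f x (lmulC x p.1 v) (lmulC (f x) p.2 w) ∧
        MutualImage f x (rmulC x p.1 v) (rmulC (f x) p.2 w) := by
  induction hp using Algebra.adjoin_induction with
  | mem p hp =>
    obtain ⟨u, hu, rfl⟩ := hp
    intro v w h
    have hu' := dEadj_dE_of_isHorizontal hf hu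
    exact ⟨mutualImage_lmulC_cvec hu' h, mutualImage_rmulC_cvec hu' h⟩
  | algebraMap c =>
    intro v w h
    have h1 := h.smul c
    refine ⟨?_, ?_⟩
    · rw [← lmulC_algebraMap, ← lmulC_algebraMap] at h1
      exact h1
    · rw [← rmulC_algebraMap, ← rmulC_algebraMap] at h1
      exact h1
  | add p q _ _ hp hq =>
    intro v w h
    have h1 := (hp h).1.add (hq h).1
    have h2 := (hp h).2.add (hq h).2
    rw [← lmulC_add, ← lmulC_add] at h1
    rw [← rmulC_add, ← rmulC_add] at h2
    exact ⟨h1, h2⟩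
  | mul p q _ _ hp hq =>
    intro v w h
    have h1 := (hp (hq h).1).1
    have h2 := (hq (hp h).2).2
    rw [← lmulC_mul, ← lmulC_mul] at h1
    rw [← rmulC_mul, ← rmulC_mul] at h2
    exact ⟨h1, h2⟩

lemma cvec_mem_cliffordGraph {f : M ⟶ N} {x : M} {v : Euc M.dim} (hv : IsHorizontal f x v) :
    (cvecE M x v, cvecE N (f x) (dE f x v)) ∈ cliffordGraph f x :=
  Algebra.subset_adjoin ⟨v, hv, rfl⟩

/-- If `f` is isometric, all vectors are horizontal and generate the first factor. -/
lemma exists_snd_mem_cliffordGraph {f : M ⟶ N} (hf : IsIsom f) (x : M) (a : Clifford M x) :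
    ∃ b, (a, b) ∈ cliffordGraph f x := by
  induction a using Clifford.left_induction with
  | one => exact ⟨1, one_mem _⟩
  | cvec_mul v a ha =>
    obtain ⟨b, hb⟩ := ha
    have hv : IsHorizontal f x v := by
      have h := isHorizontal_dEadj f x (dE f x v)
      rwa [hf x v] at h
    exact ⟨_, mul_mem (cvec_mem_cliffordGraph hv) hb⟩
  | add a a' ha ha' =>
    obtain ⟨b, hb⟩ := ha
    obtain ⟨b', hb'⟩ := ha'
    exact ⟨_, add_mem hb hb'⟩
  | smul c a ha =>
    obtain ⟨b, hb⟩ := ha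
    exact ⟨_, Subalgebra.smul_mem _ hb c⟩

/-- If `f` is co-isometric, the images of horizontal vectors generate the second factor. -/
lemma exists_fst_mem_cliffordGraph {f : M ⟶ N} (hf : IsCoisom f) (x : M) (b : Clifford N (f x)) :
    ∃ a, (a, b) ∈ cliffordGraph f x := by
  induction b using Clifford.left_induction with
  | one => exact ⟨1, one_mem _⟩
  | cvec_mul w b hb =>
    obtain ⟨a, ha⟩ := hb
    have h := cvec_mem_cliffordGraph (isHorizontal_dEadj f x w)
    rw [hf x w] at h
    exact ⟨_, mul_mem h ha⟩
  | add b b' hb hb' =>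
    obtain ⟨a, ha⟩ := hb
    obtain ⟨a', ha'⟩ := hb'
    exact ⟨_, add_mem ha ha'⟩
  | smul c b hb =>
    obtain ⟨a, ha⟩ := hb
    exact ⟨_, Subalgebra.smul_mem _ ha c⟩

/-- The algebra generated by the pairs of horizontal vectors preserves the relation, which contains
the pair of units. -/
lemma mutualImage_symb {f : M ⟶ N} (hf : IsIsom f ∨ IsCoisom f) {x : M} {a : Clifford M x}
    {b : Clifford N (f x)} (h : (a, b) ∈ cliffordGraph f x) :
    MutualImage f x (symb M x a) (symb N (f x) b) := by
  have e : ∀ (M : RMfd) (x : M) (a : Clifford M x), lmulC x a 1 = symb M x a := fun M x a => by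
    rw [lmulC, (LinearEquiv.symm_apply_eq _).2 (symb_one M x).symm, mul_one]
  have h1 := (mutualImage_mulC hf h (mutualImage_one f x)).1
  rwa [e, e] at h1

/-- The subalgebra is mapped into the relation by the symbol maps, and it is all of it because it
projects onto that side from which the relation is a graph. -/
lemma mem_cliffordGraph_iff {f : M ⟶ N} (hf : IsIsom f ∨ IsCoisom f) {x : M} {v : Lam M.dim}
    {w : Lam N.dim} : ((symb M x).symm v, (symb N (f x)).symm w) ∈ cliffordGraph f x ↔
      MutualImage f x v w := by
  constructor
  · intro h
    have := mutualImage_symb hf h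
    rwa [LinearEquiv.apply_symm_apply, LinearEquiv.apply_symm_apply] at this
  · intro h
    rcases hf with hf | hf
    · obtain ⟨b, hb⟩ := exists_snd_mem_cliffordGraph hf x ((symb M x).symm v)
      have h1 := (mutualImage_symb (Or.inl hf) hb).1
      rw [LinearEquiv.apply_symm_apply, ← h.1] at h1
      rwa [← h1, LinearEquiv.symm_apply_apply]
    · obtain ⟨a, ha⟩ := exists_fst_mem_cliffordGraph hf x ((symb N (f x)).symm w)
      have h1 := (mutualImage_symb (Or.inr hf) ha).2
      rw [LinearEquiv.apply_symm_apply, ← h.2] at h1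
      rwa [← h1, LinearEquiv.symm_apply_apply]

lemma cliffordSpan_eq {f : M ⟶ N} (hf : IsIsom f ∨ IsCoisom f) :
    cliffordSpan lamHerm cliffEquiv f = mutualSpan f :=
  graphSpan_congr (A := toHerm lamDirac M) (B := toHerm lamDirac N) f fun _ _ _ =>
    mem_cliffordGraph_iff hf

lemma isCliffordStable_mutualSpan {f : M ⟶ N} (hf : IsIsom f ∨ IsCoisom f) :
    IsCliffordStable f (lamDirac M) (lamDirac N) (mutualSpan f).rel := fun _ _ _ h _ hp =>
  have h' := mutualImage_mulC hf hp (mutualSpan_rel.1 h)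
  ⟨mutualSpan_rel.2 h'.1, mutualSpan_rel.2 h'.2⟩

/-! ### Local frames -/

/-- A jointly injective pair of linear maps maps a basis to a basis of the image. -/
lemma linearIndependent_and_span {m n d : ℕ} {ι : Type*} (b : Module.Basis ι ℂ (Lam d))
    (T : Lam d →ₗ[ℂ] Lam m) (T' : Lam d →ₗ[ℂ] Lam n) (h : ∀ c, T c = 0 → T' c = 0 → c = 0) :
    LinearIndependent ℂ (fun i => (T (b i), T' (b i))) ∧
      ∀ v w, (v, w) ∈ Submodule.span ℂ (Set.range fun i => (T (b i), T' (b i))) ↔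
        ∃ c, T c = v ∧ T' c = w := by
  have hk : LinearMap.ker (T.prod T') = ⊥ := by
    refine (Submodule.eq_bot_iff _).2 fun c hc => ?_
    have hc' : T.prod T' c = 0 := hc
    exact h c (congrArg Prod.fst hc') (congrArg Prod.snd hc')
  refine ⟨b.linearIndependent.map' (T.prod T') hk, fun v w => ?_⟩
  have e : Set.range (fun i => (T (b i), T' (b i))) = T.prod T' '' Set.range b := by
    rw [← Set.range_comp]
    rfl
  rw [e, Submodule.span_image, b.span_eq, Submodule.mem_map]
  simp

/-- A criterion for local triviality: local frames arise from constant frames by means of a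
parametrization of the relation. -/
lemma exists_frame (f : M ⟶ N) {k d : ℕ} (p : Euc k → M) (t₀ : Euc k)
    (T : Euc k → Lam d →ₗ[ℂ] Lam M.dim) (T' : Euc k → Lam d →ₗ[ℂ] Lam N.dim)
    (hT : ∀ c, ContMDiffAt 𝓘(ℝ, Euc k) (M.I.prod 𝓘(ℝ, Lam M.dim)) ∞
      (fun t => (⟨p t, T t c⟩ : TotalSpace (Lam M.dim) (LamFiber M))) t₀)
    (hT' : ∀ c, ContMDiffAt 𝓘(ℝ, Euc k) (N.I.prod 𝓘(ℝ, Lam N.dim)) ∞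
      (fun t => (⟨f (p t), T' t c⟩ : TotalSpace (Lam N.dim) (LamFiber N))) t₀)
    (h : ∀ᶠ t in 𝓝 t₀, (∀ c, T t c = 0 → T' t c = 0 → c = 0) ∧
      ∀ v w, MutualImage f (p t) v w ↔ ∃ c, T t c = v ∧ T' t c = w) :
    ∃ (r : ℕ) (a : Fin r → Euc k → Lam M.dim) (b : Fin r → Euc k → Lam N.dim),
      (∀ i, ContMDiffAt 𝓘(ℝ, Euc k) (M.I.prod 𝓘(ℝ, Lam M.dim)) ∞
        (fun t => (⟨p t, a i t⟩ : TotalSpace (Lam M.dim) (LamFiber M))) t₀) ∧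
      (∀ i, ContMDiffAt 𝓘(ℝ, Euc k) (N.I.prod 𝓘(ℝ, Lam N.dim)) ∞
        (fun t => (⟨f (p t), b i t⟩ : TotalSpace (Lam N.dim) (LamFiber N))) t₀) ∧
      ∀ᶠ t in 𝓝 t₀, LinearIndependent ℂ (fun i => (a i t, b i t)) ∧
        ∀ v w, MutualImage f (p t) v w ↔
          (v, w) ∈ Submodule.span ℂ (Set.range fun i => (a i t, b i t)) := by
  let B := Module.finBasis ℂ (Lam d)
  refine ⟨_, fun i t => T t (B i), fun i t => T' t (B i), fun i => hT _, fun i => hT' _, ?_⟩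
  filter_upwards [h] with t ht
  obtain ⟨h1, h2⟩ := linearIndependent_and_span B (T t) (T' t) ht.1
  exact ⟨h1, fun v w => (ht.2 v w).trans (h2 v w).symm⟩

lemma contMDiffAt_map_oc {k : ℕ} {p : Euc k → M} {t₀ : Euc k}
    (hp : ContMDiffAt 𝓘(ℝ, Euc k) M.I ∞ p t₀) (c : Lam M.dim) :
    ContMDiffAt 𝓘(ℝ, Euc k) (M.I.prod 𝓘(ℝ, Lam M.dim)) ∞
      (fun t => (⟨p t, Lam.map (oc (p t₀) (p t)) c⟩ : TotalSpace (Lam M.dim) (LamFiber M))) t₀ := by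
  refine (contMDiffAt_lam_iff_of_mem (x₀ := p t₀) (mem_src (p t₀))).2 ⟨hp, ?_⟩
  refine (contMDiffAt_const (c := c)).congr_of_eventuallyEq ?_
  filter_upwards [hp.continuousAt.eventually (src_mem_nhds (mem_src (p t₀)))] with t ht
  exact map_co_oc ht c

/-- The relation is the graph of `Λ(Df)` on `Λ(TM)` in the isometric case, and the graph of
`Λ((Df)^*)` on the pull-back of `Λ(TN)` in the co-isometric case; frames arise from constant
components in charts. -/
lemma isSmoothSubbundle_mutualSpan {f : M ⟶ N} (hf : IsIsom f ∨ IsCoisom f) :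
    (mutualSpan f).IsSmoothSubbundle := by
  intro k (p : Euc k → M) (hp' : ContMDiff 𝓘(ℝ, Euc k) M.I ∞ p) t₀
  have key : ∃ (r : ℕ) (a : Fin r → Euc k → Lam M.dim) (b : Fin r → Euc k → Lam N.dim),
      (∀ i, ContMDiffAt 𝓘(ℝ, Euc k) (M.I.prod 𝓘(ℝ, Lam M.dim)) ∞
        (fun t => (⟨p t, a i t⟩ : TotalSpace (Lam M.dim) (LamFiber M))) t₀) ∧
      (∀ i, ContMDiffAt 𝓘(ℝ, Euc k) (N.I.prod 𝓘(ℝ, Lam N.dim)) ∞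
        (fun t => (⟨f (p t), b i t⟩ : TotalSpace (Lam N.dim) (LamFiber N))) t₀) ∧
      ∀ᶠ t in 𝓝 t₀, LinearIndependent ℂ (fun i => (a i t, b i t)) ∧
        ∀ v w, MutualImage f (p t) v w ↔
          (v, w) ∈ Submodule.span ℂ (Set.range fun i => (a i t, b i t)) := by
    rcases hf with hf | hf
    · refine exists_frame f p t₀ (fun t => (Lam.map (oc (p t₀) (p t))).toLinearMap)
        (fun t => (Lam.map (dE f (p t))).toLinearMap ∘ₗ
          (Lam.map (oc (p t₀) (p t))).toLinearMap)
        (fun c => contMDiffAt_map_oc (hp' t₀) c)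
        (fun c => contMDiffAt_map_dE f (contMDiffAt_map_oc (hp' t₀) c)) ?_
      filter_upwards [(hp' t₀).continuousAt.eventually (src_mem_nhds (mem_src (p t₀)))]
        with t ht
      refine ⟨fun c hc _ => ?_, fun v w => ⟨fun h => ?_, ?_⟩⟩
      · have h := congrArg (Lam.map (co (p t₀) (p t))) hc
        exact (map_co_oc ht c).symm.trans (h.trans (map_zero _))
      · exact ⟨Lam.map (co (p t₀) (p t)) v, map_oc_co ht v,
          (congrArg (Lam.map (dE f (p t))) (map_oc_co ht v)).trans h.1.symm⟩
      · rintro ⟨c, rfl, rfl⟩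
        exact ⟨rfl, (map_dEadj_map_dE hf (p t) _).symm⟩
    · have hfp : ContMDiffAt 𝓘(ℝ, Euc k) N.I ∞ (fun t => f (p t)) t₀ :=
        (f.smooth _).comp t₀ (hp' t₀)
      refine exists_frame f p t₀
        (fun t => (Lam.map (dEadj f (p t))).toLinearMap ∘ₗ
          (Lam.map (oc (f (p t₀)) (f (p t)))).toLinearMap)
        (fun t => (Lam.map (oc (f (p t₀)) (f (p t)))).toLinearMap)
        (fun c => contMDiffAt_map_dEadj f (hp' t₀) (contMDiffAt_map_oc hfp c))
        (fun c => contMDiffAt_map_oc hfp c) ?_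
      filter_upwards [hfp.continuousAt.eventually (src_mem_nhds (mem_src (f (p t₀))))] with t ht
      refine ⟨fun c _ hc => ?_, fun v w => ⟨fun h => ?_, ?_⟩⟩
      · have h := congrArg (Lam.map (co (f (p t₀)) (f (p t)))) hc
        exact (map_co_oc ht c).symm.trans (h.trans (map_zero _))
      · exact ⟨Lam.map (co (f (p t₀)) (f (p t))) w,
          (congrArg (Lam.map (dEadj f (p t))) (map_oc_co ht w)).trans h.2.symm, map_oc_co ht w⟩
      · rintro ⟨c, rfl, rfl⟩
        exact ⟨(map_dE_map_dEadj hf (p t) _).symm, rfl⟩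
  obtain ⟨r, a, b, ha, hb, h⟩ := key
  refine ⟨r, a, b, ha, hb, ?_⟩
  filter_upwards [h] with t ht
  exact ⟨ht.1, fun v w => mutualSpan_rel.trans (ht.2 v w)⟩

lemma grassmannSpan_rel_eq {f : M ⟶ N} (hf : IsIsom f ∨ IsCoisom f) :
    ((grassmannSpan lamDirac lamEquiv f).rel : M → (lamDirac M).Tot → (lamDirac N).Tot → Prop) =
      (mutualSpan f).rel :=
  graphSpan_rel_congr (A := toHerm lamDirac M) (B := toHerm lamDirac N) f fun x v w =>
    Lam.graph_iff (dE f x) (M.gE_pos x) (M.gE_symm x) (N.gE_symm (f x)) (isPartialIsometry hf x) v w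

lemma isCliffordStable_of_eq {f : M ⟶ N} {E : DiracBundleOver M} {E' : DiracBundleOver N}
    {r r' : M → E.Tot → E'.Tot → Prop} (h : r = r') (h' : IsCliffordStable f E E' r') :
    IsCliffordStable f E E' r := by
  rwa [h]

/-! ### Parallelism of the propagator -/

lemma differentiableAt_of_contMDiffAt {P : Type} [NormedAddCommGroup P] [NormedSpace ℝ P]
    {p : P → M} {v : P → Lam M.dim} {t : P}
    (h : ContMDiffAt 𝓘(ℝ, P) (M.I.prod 𝓘(ℝ, Lam M.dim)) ∞
      (fun s => (⟨p s, v s⟩ : TotalSpace (Lam M.dim) (LamFiber M))) t) :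
    MDifferentiableAt 𝓘(ℝ, P) M.I p t ∧
      DifferentiableAt ℝ (fun s => Lam.map (co (p t) (p s)) (v s)) t := by
  obtain ⟨h1, h2⟩ := (contMDiffAt_lam_iff_of_mem (x₀ := p t) (mem_src (p t))).1 h
  exact ⟨h1.mdifferentiableAt (by simp), (h2.mdifferentiableAt (by simp)).differentiableAt⟩

/-- The two equations which define the relation are parallel, since `Df` and its adjoint are. -/
lemma isParallel_mutualSpan {f : M ⟶ N} (hf : IsTotallyGeodesic f) :
    IsParallel (lamDirac M) (lamDirac N) (mutualSpan f).rel := by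
  intro k (p : Euc k → M) a b (hp : ContMDiff 𝓘(ℝ, Euc k) M.I ∞ p) ha hb h t u
  choose v w h hav hbw using h
  obtain rfl := funext hav
  obtain rfl := funext hbw
  obtain ⟨h1, h2⟩ := differentiableAt_of_contMDiffAt (ha t)
  obtain ⟨-, h3⟩ := differentiableAt_of_contMDiffAt (hb t)
  have e1 := covLam_map_dE hf h1 h2 u
  have e2 := covLam_map_dEadj hf h1 h3 u
  have hw : (fun s => Lam.map (dE f (p s)) (v s)) = w := funext fun s => (h s).1.symm
  have hv : (fun s => Lam.map (dEadj f (p s)) (w s)) = v := funext fun s => (h s).2.symm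
  rw [hw] at e1
  rw [hv] at e2
  have key : MutualImage f (p t) (covLam p v t u) (covLam (fun s => f (p s)) w t u) := ⟨e1, e2⟩
  refine ⟨_, _, key, ?_, ?_⟩
  · exact congrArg (fun c : Lam M.dim => (⟨p t, c⟩ : TotalSpace (Lam M.dim) (LamFiber M)))
      (covAlong_lamConn (fun s => ⟨p s, v s⟩) t u)
  · exact congrArg (fun c : Lam N.dim => (⟨f (p t), c⟩ : TotalSpace (Lam N.dim) (LamFiber N)))
      (covAlong_lamConn (fun s => ⟨f (p s), w s⟩) t u)

/-- The orthogonal complement is the kernel of `Λ((Df)^*) Λ(Df) + Λ((Df)^*)`, which is parallel for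
totally geodesic maps. -/
lemma orthogonal_mutualSpan {f : M ⟶ N} (hf : IsIsom f ∨ IsCoisom f) {x : M} {v : Lam M.dim}
    {w : Lam N.dim} : (mutualSpan f).orthogonal x ⟨x, v⟩ ⟨f x, w⟩ ↔
      Lam.map (dEadj f x) (Lam.map (dE f x) v) + Lam.map (dEadj f x) w = 0 := by
  refine Iff.trans ?_ (Lam.orthogonal_graph_iff (dE f x) (M.gE_pos x) (M.gE_symm x)
    (N.gE_symm (f x)) (isPartialIsometry hf x) v w)
  constructor
  · intro h v' w' h1 h2
    exact h.2.2 v' w' (mutualSpan_rel.2 ⟨h1, h2⟩)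
  · intro h
    refine ⟨rfl, rfl, fun v' w' h' => ?_⟩
    have h'' := mutualSpan_rel.1 h'
    exact h v' w' h''.1 h''.2

lemma isParallel_orthogonal_mutualSpan {f : M ⟶ N} (hf : IsIsom f ∨ IsCoisom f)
    (hg : IsTotallyGeodesic f) :
    IsParallel (lamDirac M) (lamDirac N) (mutualSpan f).orthogonal := by
  intro k (p : Euc k → M) a b (hp : ContMDiff 𝓘(ℝ, Euc k) M.I ∞ p) ha hb h t u
  have hav : ∀ t, ∃ v : Lam M.dim, a t = ⟨p t, v⟩ := fun t => by
    have h1 : (a t).proj = p t := (h t).1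
    rw [← h1]
    exact ⟨(a t).2, rfl⟩
  have hbw : ∀ t, ∃ w : Lam N.dim, b t = ⟨f (p t), w⟩ := fun t => by
    have h1 : (b t).proj = f (p t) := (h t).2.1
    rw [← h1]
    exact ⟨(b t).2, rfl⟩
  choose v hav using hav
  choose w hbw using hbw
  obtain rfl := funext hav
  obtain rfl := funext hbw
  have h0 : ∀ s, Lam.map (dEadj f (p s)) (Lam.map (dE f (p s)) (v s)) +
      Lam.map (dEadj f (p s)) (w s) = 0 := fun s => (orthogonal_mutualSpan hf).1 (h s)
  obtain ⟨h1, h2⟩ := differentiableAt_of_contMDiffAt (ha t)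
  have hs1 := contMDiffAt_map_dE f (ha t)
  obtain ⟨-, h3⟩ := differentiableAt_of_contMDiffAt (hb t)
  obtain ⟨-, h4⟩ := differentiableAt_of_contMDiffAt hs1
  obtain ⟨-, h5⟩ := differentiableAt_of_contMDiffAt (contMDiffAt_map_dEadj f (hp t) hs1)
  obtain ⟨-, h6⟩ := differentiableAt_of_contMDiffAt (contMDiffAt_map_dEadj f (hp t) (hb t))
  have e := covLam_add h5 h6 u
  rw [funext h0, covLam_zero, covLam_map_dEadj hg h1 h4, covLam_map_dEadj hg h1 h3,
    covLam_map_dE hg h1 h2] at e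
  have key : (mutualSpan f).orthogonal (p t) ⟨p t, covLam p v t u⟩
      ⟨f (p t), covLam (fun s => f (p s)) w t u⟩ := (orthogonal_mutualSpan hf).2 e.symm
  have ea : (⟨p t, covAlong (lamConn M).toFun (fun s => ⟨p s, v s⟩) t u⟩ :
      TotalSpace (Lam M.dim) (LamFiber M)) = ⟨p t, covLam p v t u⟩ :=
    congrArg (fun c : Lam M.dim => (⟨p t, c⟩ : TotalSpace (Lam M.dim) (LamFiber M)))
      (covAlong_lamConn (fun s => ⟨p s, v s⟩) t u)
  have eb : (⟨f (p t), covAlong (lamConn N).toFun (fun s => ⟨f (p s), w s⟩) t u⟩ :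
      TotalSpace (Lam N.dim) (LamFiber N)) = ⟨f (p t), covLam (fun s => f (p s)) w t u⟩ :=
    congrArg (fun c : Lam N.dim => (⟨f (p t), c⟩ : TotalSpace (Lam N.dim) (LamFiber N)))
      (covAlong_lamConn (fun s => ⟨f (p s), w s⟩) t u)
  exact Eq.mpr (congrArg₂ (fun a b => (mutualSpan f).orthogonal (p t) a b) ea eb) key

/-! ### The functors -/

lemma isSmoothFamily_grassmannFib (f : M ⟶ N) :
    IsSmoothFamily (A := toHerm lamDirac M) (B := toHerm lamDirac N) f
      (grassmannFib lamDirac lamEquiv f) := by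
  have h : ContMDiff (M.I.prod 𝓘(ℝ, Lam M.dim)) (N.I.prod 𝓘(ℝ, Lam N.dim)) ∞
      (fun b : TotalSpace (Lam M.dim) (LamFiber M) =>
        (⟨f b.proj, Lam.map (dE f b.proj) b.2⟩ : TotalSpace (Lam N.dim) (LamFiber N))) := fun _ =>
    contMDiffAt_map_dE f (p := fun b : TotalSpace (Lam M.dim) (LamFiber M) => b.proj)
      (a := fun b => b.2) contMDiffAt_id
  exact h

lemma _root_.BundleMap.mk_congr {A B : HermBundle} {f : A.base ⟶ B.base}
    {F F' : ∀ x, A.bundle.fiber x →ₗ[ℂ] B.bundle.fiber (f x)} (h : F = F') (hF : IsSmoothFamily f F)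
    (hF' : IsSmoothFamily f F') : BundleMap.mk f F hF = BundleMap.mk f F' hF' := by
  subst h
  rfl

lemma mutualImage_id {x : M} {v w : Lam M.dim} : MutualImage (𝟙 M) x v w ↔ v = w := by
  rw [MutualImage, dE_id, dEadj_id, Lam.map_id_apply, Lam.map_id_apply]
  exact ⟨fun h => h.2, fun h => ⟨h.symm, h⟩⟩

/-- The propagator of the identity. -/
noncomputable def mutualSpanId (M : RMfd) :
    Span.Iso (mutualSpan (𝟙 M)) (Span.id (toHerm lamDirac M)) where
  e := Homeomorph.refl M
  smooth := dSmooth_id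
  smooth_symm := dSmooth_id
  src_eq _ := rfl
  tgt_eq _ := rfl
  rel_iff x a b := by
    constructor
    · rintro ⟨rfl, rfl⟩
      exact mutualSpan_rel.2 (mutualImage_id.2 rfl)
    · rintro ⟨v, w, h, rfl, rfl⟩
      obtain rfl := mutualImage_id.1 h
      exact ⟨rfl, rfl⟩

/-- In the isometric case the intermediate element is determined by `v`, in the co-isometric case
by `w`. A mixture of both cases need not be functorial. -/
lemma mutualImage_comp {f : M ⟶ N} {h : N ⟶ P}
    (hfh : (IsIsom f ∧ IsIsom h) ∨ (IsCoisom f ∧ IsCoisom h)) {x : M} {v : Lam M.dim}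
    {w : Lam P.dim} :
    MutualImage (f ≫ h) x v w ↔ ∃ u, MutualImage f x v u ∧ MutualImage h (f x) u w := by
  have e : MutualImage (f ≫ h) x v w ↔ w = Lam.map (dE h (f x)) (Lam.map (dE f x) v) ∧
      v = Lam.map (dEadj f x) (Lam.map (dEadj h (f x)) w) := by
    rw [MutualImage, dE_comp, dEadj_comp, Lam.map_comp_apply, Lam.map_comp_apply]
  rw [e]
  constructor
  · rintro ⟨h1, h2⟩
    rcases hfh with ⟨hf, hh⟩ | ⟨hf, hh⟩
    · refine ⟨Lam.map (dE f x) v, ⟨rfl, (map_dEadj_map_dE hf x v).symm⟩, h1, ?_⟩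
      rw [h1, map_dEadj_map_dE hh]
    · refine ⟨Lam.map (dEadj h (f x)) w, ⟨?_, h2⟩, (map_dE_map_dEadj hh (f x) w).symm, rfl⟩
      rw [h2, map_dE_map_dEadj hf]
  · rintro ⟨u, ⟨h1, h2⟩, h3, h4⟩
    exact ⟨by rw [← h1, ← h3], by rw [← h4, ← h2]⟩

/-- The propagator of a composition is the composition of the propagators. -/
noncomputable def mutualSpanComp {f : M ⟶ N} {h : N ⟶ P}
    (hfh : (IsIsom f ∧ IsIsom h) ∨ (IsCoisom f ∧ IsCoisom h)) :
    Span.Iso (mutualSpan (f ≫ h)) ((mutualSpan f).comp (mutualSpan h)) where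
  e :=
    { toFun := fun x => ⟨(x, f x), rfl⟩
      invFun := fun r => r.1.1
      left_inv := fun x => rfl
      right_inv := fun r => Subtype.ext (Prod.ext rfl r.2)
      continuous_toFun := (continuous_id.prodMk f.smooth.continuous).subtype_mk _
      continuous_invFun := continuous_fst.comp continuous_subtype_val }
  smooth _ _ hp := ⟨hp, f.smooth.comp hp⟩
  smooth_symm _ _ hp := hp.1
  src_eq _ := rfl
  tgt_eq _ := rfl
  rel_iff x a b := by
    constructor
    · rintro ⟨c, ⟨v, u, h1, rfl, rfl⟩, u', w, h2, hu, rfl⟩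
      obtain rfl := eq_of_heq (TotalSpace.mk.inj hu).2
      exact ⟨v, w, (mutualImage_comp hfh).2 ⟨u, h1, h2⟩, rfl, rfl⟩
    · rintro ⟨v, w, h1, rfl, rfl⟩
      obtain ⟨u, h1, h2⟩ := (mutualImage_comp hfh).1 h1
      exact ⟨⟨f x, u⟩, ⟨v, u, h1, rfl, rfl⟩, u, w, h2, rfl, rfl⟩

lemma _root_.Propagator.mk_congr {A B : HermBundle} {S S' : Span A B} (h : S = S')
    (hS : S.IsPropagator) (hS' : S'.IsPropagator) : Propagator.mk S hS = Propagator.mk S' hS' := by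
  subst h
  rfl

/-- In each Riemannian category all arrows are isometric, or all arrows are co-isometric. -/
lemma arrows_cases {c : MfdClass} (hc : c.IsRiemannian) :
    (∀ {M N : RMfd} (f : M ⟶ N), c.arrows f → IsIsom f) ∨
      (∀ {M N : RMfd} (f : M ⟶ N), c.arrows f → IsCoisom f) := by
  cases c with
  | smooth | emb | sub => exact hc.elim
  | riemEmb => exact Or.inl fun f hf => isIsom_of_isRiemEmb hf
  | riemSub => exact Or.inr fun f hf => isCoisom_of_isRiemSub hf
  | geoEmb => exact Or.inl fun f hf => isIsom_of_isRiemEmb hf.1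
  | geoSub => exact Or.inr fun f hf => isCoisom_of_isRiemSub hf.1
  | geoEmbComp => exact Or.inl fun f hf => isIsom_of_isRiemEmb hf.1.1
  | geoCov => exact Or.inr fun f hf => isCoisom_of_isRiemSub hf.1.1

lemma isTotallyGeodesic_of_isGeodesic {c : MfdClass} (hc : c.IsGeodesic) {f : M ⟶ N}
    (hf : c.arrows f) : IsTotallyGeodesic f := by
  cases c with
  | smooth | emb | sub | riemEmb | riemSub => exact hc.elim
  | geoEmb | geoSub => exact hf.2
  | geoEmbComp | geoCov => exact hf.1.2

/-- A family of spans which agree with the propagators `mutualSpan f` is functorial. -/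
lemma exists_propagator_functor {c : MfdClass} (hc : c.IsRiemannian)
    (S : ∀ {M N : RMfd}, (M ⟶ N) → Span (toHerm lamDirac M) (toHerm lamDirac N))
    (hS : ∀ {M N : RMfd} (f : M ⟶ N), IsIsom f ∨ IsCoisom f → S f = mutualSpan f) :
    ∃ h : ∀ {M N : c.Cat} (f : M ⟶ N), (S f.hom).IsPropagator,
      ∃ Λ : c.Cat ⥤ PropagatorCat, Λ.toPrefunctor =
        { obj := fun M => ⟨toHerm lamDirac M.obj⟩
          map := fun f => Propagator.mk (S f.hom) (h f) } ∧
      ∃ Λ' : c.Cat ⥤ AmplifiedCat, Λ' = Λ ⋙ amplify := by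
  have hS' : ∀ {M N : c.Cat} (f : M ⟶ N), S f.hom = mutualSpan f.hom := fun f =>
    hS _ ((arrows_cases hc).imp (fun h => h _ f.property) (fun h => h _ f.property))
  have hfh : ∀ {M N P : c.Cat} (f : M ⟶ N) (h : N ⟶ P),
      (IsIsom f.hom ∧ IsIsom h.hom) ∨ (IsCoisom f.hom ∧ IsCoisom h.hom) := fun f h =>
    (arrows_cases hc).imp (fun H => ⟨H _ f.property, H _ h.property⟩)
      (fun H => ⟨H _ f.property, H _ h.property⟩)
  have hprop : ∀ {M N : c.Cat} (f : M ⟶ N), (S f.hom).IsPropagator := fun f => by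
    rw [hS' f]
    exact isPropagator_mutualSpan _
  refine ⟨hprop, {
    obj := fun M => ⟨toHerm lamDirac M.obj⟩
    map := fun f => Propagator.mk (S f.hom) (hprop f)
    map_id := fun M => ?_
    map_comp := fun f h => ?_ }, rfl, _, rfl⟩
  · exact (Propagator.mk_congr (hS' (𝟙 M)) _ (isPropagator_mutualSpan _)).trans
      (Quotient.sound ⟨mutualSpanId M.obj⟩)
  · have e : Propagator.mk (mutualSpan (f.hom ≫ h.hom)) (isPropagator_mutualSpan _) =
        (Propagator.mk (mutualSpan f.hom) (isPropagator_mutualSpan _)).comp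
          (Propagator.mk (mutualSpan h.hom) (isPropagator_mutualSpan _)) :=
      Quotient.sound ⟨mutualSpanComp (hfh f h)⟩
    refine (Propagator.mk_congr (hS' (f ≫ h)) _ (isPropagator_mutualSpan _)).trans (e.trans ?_)
    exact congrArg₂ Propagator.comp
      (Propagator.mk_congr (hS' f) _ (isPropagator_mutualSpan _)).symm
      (Propagator.mk_congr (hS' h) _ (isPropagator_mutualSpan _)).symm

lemma map_dE_id (x : M) (v : Lam M.dim) : Lam.map (dE (𝟙 M) x) v = v := by
  rw [dE_id, Lam.map_id_apply]

lemma map_dE_comp (f : M ⟶ N) (h : N ⟶ P) (x : M) (v : Lam M.dim) :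
    Lam.map (dE (f ≫ h) x) v = Lam.map (dE h (f x)) (Lam.map (dE f x) v) := by
  rw [dE_comp, Lam.map_comp_apply]

/-- The functor to bundle morphisms. -/
lemma exists_bundle_functor (c : MfdClass) : ∃ Λ : c.Cat ⥤ BundleCat, Λ.toPrefunctor =
    { obj := fun M => ⟨toHerm lamDirac M.obj⟩
      map := fun f => ⟨f.hom, grassmannFib lamDirac lamEquiv f.hom,
        isSmoothFamily_grassmannFib f.hom⟩ } := by
  refine ⟨{
    obj := fun M => ⟨toHerm lamDirac M.obj⟩
    map := fun f =>
      ⟨f.hom, grassmannFib lamDirac lamEquiv f.hom, isSmoothFamily_grassmannFib f.hom⟩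
    map_id := fun M => ?_
    map_comp := fun {M N P} f h => ?_ }, rfl⟩
  · refine BundleMap.mk_congr (A := toHerm lamDirac M.obj) (B := toHerm lamDirac M.obj)
      (f := 𝟙 M.obj) (funext fun x => LinearMap.ext fun v => ?_) _ _
    exact map_dE_id x v
  · refine BundleMap.mk_congr (A := toHerm lamDirac M.obj) (B := toHerm lamDirac P.obj)
      (f := f.hom ≫ h.hom) (funext fun x => LinearMap.ext fun v => ?_) _ _
    exact map_dE_comp f.hom h.hom x v

lemma herm_map_of_isIsom {f : M ⟶ N} (hf : IsIsom f) (x : M) (v w : Lam M.dim) :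
    Lam.herm (N.gE (f x)) (Lam.map (dE f x) v) (Lam.map (dE f x) w) = Lam.herm (M.gE x) v w :=
  Lam.herm_map_map _ _ _ (fun a b => by rw [← gE_dEadj, hf]) v w

lemma herm_map_of_isCoisom {f : M ⟶ N} (hf : IsCoisom f) (x : M) (v w : Lam M.dim)
    (hv : ∀ u, Lam.map (dE f x) u = 0 → Lam.herm (M.gE x) u v = 0) :
    Lam.herm (N.gE (f x)) (Lam.map (dE f x) v) (Lam.map (dE f x) w) = Lam.herm (M.gE x) v w := by
  have h := ((Lam.graph_iff (dE f x) (M.gE_pos x) (M.gE_symm x) (N.gE_symm (f x))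
    (isPartialIsometry (Or.inr hf) x) v _).1 ⟨hv, rfl⟩).2
  rw [Lam.herm_symm _ (N.gE_symm (f x)), Lam.herm_map_adj _ (M.gE_pos x) (M.gE_symm x)
    (N.gE_symm (f x)), ← h, ← Lam.herm_symm _ (M.gE_symm x)]

end RMfd

theorem mainTheorem1 :
    (∀ M : RMfd, ∃ D, IsLeviCivita M D) ∧
    ∃ (L : ∀ M : RMfd, DiracBundleOver M)
      (φ : ∀ (M : RMfd) (x : M), (L M).fiber x ≃ₗ[ℂ] Grassmann M x)
      (K : ∀ M : RMfd, HermBundleOver M)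
      (ψ : ∀ (M : RMfd) (x : M), (K M).fiber x ≃ₗ[ℂ] Clifford M x),
      -- the objects
      (∀ M, IsGrassmannBundle M (L M) (φ M)) ∧
      (∀ M, IsCliffordBundle M (L M) (φ M) (K M) (ψ M)) ∧
      -- the functors to bundle morphisms
      (∃ h : ∀ {M N : RMfd} (f : M ⟶ N),
          IsSmoothFamily (A := toHerm L M) (B := toHerm L N) f (grassmannFib L φ f),
        ∀ c : MfdClass, ∃ Λ : c.Cat ⥤ BundleCat, Λ.toPrefunctor =
          { obj := fun M => ⟨toHerm L M.obj⟩
            map := fun f => ⟨f.hom, grassmannFib L φ f.hom, h f.hom⟩ }) ∧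
      -- isometries and co-isometries
      (∀ {M N : RMfd} (f : M ⟶ N), IsRiemEmb f → ∀ x v w,
        (L N).herm (f x) (grassmannFib L φ f x v) (grassmannFib L φ f x w) = (L M).herm x v w) ∧
      (∀ {M N : RMfd} (f : M ⟶ N), IsRiemSub f → ∀ x,
        Function.Surjective (grassmannFib L φ f x) ∧
        ∀ v w, (∀ u, grassmannFib L φ f x u = 0 → (L M).herm x u v = 0) →
          (L N).herm (f x) (grassmannFib L φ f x v) (grassmannFib L φ f x w) =
            (L M).herm x v w) ∧
      -- the functors to propagators
      ∀ c : MfdClass, c.IsRiemannian →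
        (∃ h : ∀ {M N : c.Cat} (f : M ⟶ N), (grassmannSpan L φ f.hom).IsPropagator,
          ∃ Λ : c.Cat ⥤ PropagatorCat, Λ.toPrefunctor =
            { obj := fun M => ⟨toHerm L M.obj⟩
              map := fun f => Propagator.mk (grassmannSpan L φ f.hom) (h f) } ∧
          ∃ Λ' : c.Cat ⥤ AmplifiedCat, Λ' = Λ ⋙ amplify) ∧
        (∃ h : ∀ {M N : c.Cat} (f : M ⟶ N), (cliffordSpan K ψ f.hom).IsPropagator,
          ∃ Cl : c.Cat ⥤ PropagatorCat, Cl.toPrefunctor =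
            { obj := fun M => ⟨⟨M.obj, K M.obj⟩⟩
              map := fun f => Propagator.mk (cliffordSpan K ψ f.hom) (h f) } ∧
          ∃ Cl' : c.Cat ⥤ AmplifiedCat, Cl' = Cl ⋙ amplify) ∧
        ∀ {M N : c.Cat} (f : M ⟶ N),
          (grassmannSpan L φ f.hom).IsSmoothSubbundle ∧
          (cliffordSpan K ψ f.hom).IsSmoothSubbundle ∧
          IsCliffordStable f.hom (L M.obj) (L N.obj) (grassmannSpan L φ f.hom).rel ∧
          (c.IsGeodesic →
            IsParallel (L M.obj) (L N.obj) (grassmannSpan L φ f.hom).rel ∧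
            IsParallel (L M.obj) (L N.obj) (grassmannSpan L φ f.hom).orthogonal) := by
  refine ⟨fun M => ⟨RMfd.lc M, RMfd.isLeviCivita_lc M⟩, RMfd.lamDirac, RMfd.lamEquiv, RMfd.lamHerm,
    RMfd.cliffEquiv, RMfd.isGrassmannBundle, RMfd.isCliffordBundle,
    ⟨RMfd.isSmoothFamily_grassmannFib, RMfd.exists_bundle_functor⟩,
    fun f hf x v w => RMfd.herm_map_of_isIsom (RMfd.isIsom_of_isRiemEmb hf) x v w,
    fun f hf x => ⟨fun w => ⟨Lam.map (RMfd.dEadj f x) w,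
      RMfd.map_dE_map_dEadj (RMfd.isCoisom_of_isRiemSub hf) x w⟩,
      fun v w hv => RMfd.herm_map_of_isCoisom (RMfd.isCoisom_of_isRiemSub hf) x v w hv⟩,
    fun c hc => ⟨?_, ?_, fun {M N} f => ?_⟩⟩
  · exact RMfd.exists_propagator_functor hc (fun f => grassmannSpan RMfd.lamDirac RMfd.lamEquiv f)
      fun _ hf => RMfd.grassmannSpan_eq hf
  · exact RMfd.exists_propagator_functor hc (fun f => cliffordSpan RMfd.lamHerm RMfd.cliffEquiv f)
      fun _ hf => RMfd.cliffordSpan_eq hf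
  · have hf : RMfd.IsIsom f.hom ∨ RMfd.IsCoisom f.hom :=
      (RMfd.arrows_cases hc).imp (fun h => h _ f.property) (fun h => h _ f.property)
    have e : (cliffordSpan RMfd.lamHerm RMfd.cliffEquiv f.hom).IsSmoothSubbundle :=
      (RMfd.cliffordSpan_eq hf).symm ▸ RMfd.isSmoothSubbundle_mutualSpan hf
    refine ⟨?_, e, ?_, fun hg => ?_⟩
    · rw [RMfd.grassmannSpan_eq hf]
      exact RMfd.isSmoothSubbundle_mutualSpan hf
    · exact RMfd.isCliffordStable_of_eq (RMfd.grassmannSpan_rel_eq hf)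
        (RMfd.isCliffordStable_mutualSpan hf)
    · have hg' := RMfd.isTotallyGeodesic_of_isGeodesic hg f.property
      rw [RMfd.grassmannSpan_eq hf]
      exact ⟨RMfd.isParallel_mutualSpan hg', RMfd.isParallel_orthogonal_mutualSpan hf hg'⟩
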